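/- **Setting.** Let $A$ be a unital $*$-algebra over $\mathbb C$ with a $*$-filtration by finite-dimensional subspaces: $A_m\subseteq A_n$ for $m\le n$, $A=\bigcup_n A_n$, $A_n^*=A_n$, $A_mA_n\subseteq A_{m+n}$, $A_0=\mathbb C1$. Let $\sigma$ be a faithful state on $A$: a linear functional with $\sigma(1)=1$ and $\sigma(a^*a)>0$ for all $a\ne0$. Let $L^2(A,\sigma)$ be the GNS Hilbert space, with norm $\|\cdot\|_2$, and assume that the left regular representation of $A$ on it is by bounded operators; $\|\cdot\|$ denotes the operator norm on $L^2(A,\sigma)$, and $A$ is regarded both as a space of vectors and as an algebra of operators. Let $Q_n$ be the orthogonal projection of $L^2(A,\sigma)$ onto $A_n$, $P_0=Q_0$, $P_n=Q_n-Q_{n-1}$ for $n\ge1$, and for $a\in A$ let $a_k=P_k(a)\in A$. We say that $(A,\{A_n\},\sigma)$ satisfies the *Haagerup-type condition with constant $C$* if $$\|P_m\,a_k\,P_n\|\le C\,\|a_k\|_2\qquad\text{for all }a\in A\text{ and all integers }m,n,k\ge0 .$$ Let $D=\sum_n nP_n$, with its natural domain, and $L(a)=\|[D,a]\|$ for $a\in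 A$. A state of $A$ is a linear functional $\varphi$ with $\varphi(1)=1$ and $|\varphi(a)|\le\|a\|$ for all $a$. We say that $L$ is a *Lip-norm*, and that $(A,L)$ is a *compact quantum metric space*, if $L$ is a finite seminorm on $A$ with $L(a)=0$ exactly for $a\in\mathbb C1$, and the topology on the state space of $A$ given by the metric $\rho_L(\varphi,\psi)=\sup\{|\varphi(a)-\psi(a)|:L(a)\le1\}\in[0,\infty]$ is the weak-$*$ topology. **Theorem.** Let $A^1$ and $A^2$ be unital $*$-algebras with $*$-filtrations $\{A^1_n\}$, $\{A^2_n\}$ and faithful tracial states $\sigma^1$, $\sigma^2$ as above, and suppose that both satisfy the Haagerup-type condition with constant $C$. Let $A=A^1*A^2$ be the algebraic free product (with amalgamated units), with the involution that extends those of $A^1$ and $A^2$, and let $A_n$ be the linear span of all products $A^{i_1}_{n_1}\cdots A^{i_\alpha}_{n_\alpha}$ with $i_j\in\{1,2\}$, $i_j\ne i_{j+1}$ and $\sum_j n_j\le n$; this is a $*$-filtration of $A$ by finite-dimensional subspaces. Then: 1. There is a unique linear functional $\sigma=\sigma^1*\sigma^2$ on $A$ that restricts to $\sigma^i$ on $A^i$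 and satisfies $\sigma(a_1\cdots a_\alpha)=0$ whenever $\alpha\ge1$, $a_j\in A^{i_j}$, $\sigma^{i_j}(a_j)=0$ for all $j$, and $i_j\neq i_{j+1}$ for all $j<\alpha$. It is a faithful tracial state, and the left regular representation of $A$ on $L^2(A,\sigma)$ is by bounded operators. 2. $(A,\{A_n\},\sigma)$ satisfies the Haagerup-type condition with constant $\sqrt5\,C$. 3. The seminorm $L(a)=\|[D,a]\|$ on $A$ defined by $\{A_n\}$ and $\sigma$ is a Lip-norm, so that $A$, with the reduced free product norm, is a compact quantum metric space. -/

import Mathlib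

open scoped ComplexOrder InnerProductSpace ENNReal Topology

set_option linter.unusedSectionVars false

noncomputable section

namespace QMS

/-! ### Filtered algebras with a faithful state -/

section Basic

variable (A : Type*) [Ring A] [StarRing A] [Algebra ℂ A]

/-- A `*`-filtration of a unital `*`-algebra by finite-dimensional subspaces. -/
structure StarFiltration where
  space : ℕ → Submodule ℂ A
  finite : ∀ n, FiniteDimensional ℂ (space n)
  mono : ∀ m n, m ≤ n → space m ≤ space n
  exhaust : ∀ a, ∃ n, a ∈ space n
  star_mem : ∀ n, ∀ a ∈ space n, star a ∈ space n
  mul_mem : ∀ m n, ∀ a ∈ space m, ∀ b ∈ space n, a * b ∈ space (m + n)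
  zero : space 0 = Submodule.span ℂ {(1 : A)}

/-- A faithful state `σ` on a unital `*`-algebra `A` for which left multiplication by each element
of `A` is bounded for the norm `‖b‖₂ = σ(b* b)^(1/2)`, that is, for which the left regular
representation of `A` on `L²(A, σ)` is by bounded operators. -/
structure RegularState where
  toLin : A →ₗ[ℂ] ℂ
  map_one : toLin 1 = 1
  pos : ∀ a, a ≠ 0 → 0 < toLin (star a * a)
  bounded : ∀ a, ∃ K : ℝ, ∀ b,
    (toLin (star (a * b) * (a * b))).re ≤ K * (toLin (star b * b)).re

end Basic

attribute [instance] StarFiltration.finite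

variable {A : Type*} [Ring A] [StarRing A] [Algebra ℂ A]

namespace RegularState

/-- The state is a trace. -/
def IsTracial (σ : RegularState A) : Prop := ∀ a b, σ.toLin (a * b) = σ.toLin (b * a)

lemma nonneg (σ : RegularState A) (a : A) : 0 ≤ σ.toLin (star a * a) := by
  by_cases h : a = 0
  · simp [h]
  · exact (σ.pos a h).le

/-- The algebra `A`, considered as a space of vectors. -/
def Pre (_ : RegularState A) : Type _ := A

instance (σ : RegularState A) : AddCommGroup σ.Pre := inferInstanceAs (AddCommGroup A)
instance (σ : RegularState A) : Module ℂ σ.Pre := inferInstanceAs (Module ℂ A)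

/-- An element of `A`, viewed as a vector. -/
def toPre (σ : RegularState A) : A ≃ₗ[ℂ] σ.Pre := LinearEquiv.refl ℂ A

variable [StarModule ℂ A]

lemma conj_symm (σ : RegularState A) (a b : A) :
    (starRingEnd ℂ) (σ.toLin (star b * a)) = σ.toLin (star a * b) := by
  have im0 : ∀ c, (σ.toLin (star c * c)).im = 0 := fun c =>
    ((Complex.nonneg_iff.mp (σ.nonneg c)).2).symm
  have h1 := im0 (a + b)
  have h2 := im0 (a + Complex.I • b)
  have ha := im0 a
  have hb := im0 b
  simp only [star_add, star_smul, add_mul, mul_add, map_add, Complex.add_im, smul_mul_assoc,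
    mul_smul_comm, map_smul, smul_eq_mul, Complex.mul_im, Complex.mul_re, Complex.star_def,
    Complex.conj_I, Complex.neg_im, Complex.neg_re, Complex.I_re, Complex.I_im] at h1 h2
  apply Complex.ext
  · simp only [Complex.conj_re]; linarith
  · simp only [Complex.conj_im]; linarith

/-- The inner product `⟪a, b⟫ = σ(a* b)`. -/
@[reducible] def core (σ : RegularState A) : InnerProductSpace.Core ℂ σ.Pre where
  inner a b := σ.toLin (star (σ.toPre.symm a) * σ.toPre.symm b)
  conj_inner_symm a b := σ.conj_symm _ _
  re_inner_nonneg a := (Complex.nonneg_iff.mp (σ.nonneg (σ.toPre.symm a))).1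
  add_left a b c := by simp [add_mul]
  smul_left a b r := by simp
  definite a h := by
    by_contra hne
    exact (σ.pos (σ.toPre.symm a) (by simpa using hne)).ne' h

instance (σ : RegularState A) : NormedAddCommGroup σ.Pre := σ.core.toNormedAddCommGroup
instance (σ : RegularState A) : InnerProductSpace ℂ σ.Pre :=
  InnerProductSpace.ofCore σ.core.toCore

/-- The GNS Hilbert space `L²(A, σ)`. -/
abbrev L2 (σ : RegularState A) : Type _ := UniformSpace.Completion σ.Pre

/-- An element of `A`, viewed as a vector of `L²(A, σ)`. -/
def vec (σ : RegularState A) : A →ₗ[ℂ] σ.L2 :=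
  (UniformSpace.Completion.toComplₗᵢ (𝕜 := ℂ) (E := σ.Pre)).toLinearMap ∘ₗ σ.toPre.toLinearMap

lemma inner_vec (σ : RegularState A) (a b : A) :
    ⟪σ.vec a, σ.vec b⟫_ℂ = σ.toLin (star a * b) :=
  UniformSpace.Completion.inner_coe (𝕜 := ℂ) (σ.toPre a) (σ.toPre b)

/-- Left multiplication by `a`, on `A` viewed as a space of vectors. -/
def preMul (σ : RegularState A) (a : A) : σ.Pre →L[ℂ] σ.Pre :=
  (σ.toPre.toLinearMap ∘ₗ LinearMap.mulLeft ℂ a ∘ₗ σ.toPre.symm.toLinearMap).mkContinuousOfExistsBound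
    (by
      have hn : ∀ b : A, ‖σ.toPre b‖ = √(σ.toLin (star b * b)).re := fun b => rfl
      obtain ⟨K, hK⟩ := σ.bounded a
      refine ⟨√K, fun x => ?_⟩
      have h0 : 0 ≤ (σ.toLin (star (σ.toPre.symm x) * σ.toPre.symm x)).re :=
        (Complex.nonneg_iff.mp (σ.nonneg _)).1
      have := Real.sqrt_le_sqrt (hK (σ.toPre.symm x))
      rw [Real.sqrt_mul' _ h0] at this
      exact this)

/-- The left regular representation of `A` on `L²(A, σ)`. Its operator norm is the norm of the
pre-C*-algebra `A`. -/
def op (σ : RegularState A) (a : A) : σ.L2 →L[ℂ] σ.L2 := (σ.preMul a).completion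

lemma op_vec (σ : RegularState A) (a b : A) : σ.op a (σ.vec b) = σ.vec (a * b) := by
  change (σ.preMul a).completion ((σ.toPre b : σ.Pre) : σ.L2) = _
  simp only [vec, ContinuousLinearMap.completion_apply_coe]
  rfl

end RegularState

section Haagerup

variable [StarModule ℂ A] (F : StarFiltration A) (σ : RegularState A)

/-- The subspace `A_n`, viewed as a subspace of `L²(A, σ)`. -/
def spaceL2 (n : ℕ) : Submodule ℂ σ.L2 := (F.space n).map σ.vec

instance (n : ℕ) : FiniteDimensional ℂ (spaceL2 F σ n) :=
  inferInstanceAs (FiniteDimensional ℂ ((F.space n).map σ.vec))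

/-- The orthogonal projection `Q_n` of `L²(A, σ)` onto `A_n`. -/
def Q (n : ℕ) : σ.L2 →L[ℂ] σ.L2 := (spaceL2 F σ n).starProjection

/-- `P_0 = Q_0` and `P_n = Q_n - Q_{n-1}` for `n ≥ 1`. -/
def P : ℕ → (σ.L2 →L[ℂ] σ.L2)
  | 0 => Q F σ 0
  | n + 1 => Q F σ (n + 1) - Q F σ n

lemma exists_comp (n : ℕ) (a : A) : ∃ b : A, σ.vec b = P F σ n (σ.vec a) := by
  have hQ : ∀ n, ∃ b : A, σ.vec b = Q F σ n (σ.vec a) := fun n => by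
    obtain ⟨b, -, hb⟩ := Submodule.mem_map.mp
      ((spaceL2 F σ n).starProjection_apply_mem (σ.vec a))
    exact ⟨b, hb⟩
  cases n with
  | zero => exact hQ 0
  | succ n =>
    obtain ⟨b, hb⟩ := hQ (n + 1)
    obtain ⟨c, hc⟩ := hQ n
    exact ⟨b - c, by simp [P, hb, hc]⟩

/-- The component `a_n = P_n(a)` of `a`, as an element of `A`; it is the unique element of `A`
whose vector is `P_n` of the vector of `a`. -/
def comp (n : ℕ) (a : A) : A := (exists_comp F σ n a).choose

lemma vec_comp (n : ℕ) (a : A) : σ.vec (comp F σ n a) = P F σ n (σ.vec a) :=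
  (exists_comp F σ n a).choose_spec

/-- The Haagerup-type condition with constant `C`. -/
def HaagerupType (C : ℝ) : Prop :=
  ∀ (a : A) (k m n : ℕ),
    ‖P F σ m ∘L σ.op (comp F σ k a) ∘L P F σ n‖ ≤ C * ‖σ.vec (comp F σ k a)‖

/-! ### The Dirac operator and compact quantum metric spaces -/

/-- The domain of the self-adjoint operator `D = ∑ n P_n`. -/
def diracDomain : Set σ.L2 := {ξ | Summable fun n : ℕ => (n : ℝ) ^ 2 * ‖P F σ n ξ‖ ^ 2}

/-- The operator `D = ∑ n P_n`; only its values on `diracDomain` are meaningful. -/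
def dirac (ξ : σ.L2) : σ.L2 := ∑' n : ℕ, (n : ℂ) • P F σ n ξ

/-- `L(a) = ‖[D, a]‖`, the norm of `[D, a]` on its natural domain
`{ξ | ξ ∈ dom D and a ξ ∈ dom D}` (with value `∞` if `[D, a]` is unbounded). -/
def lipSeminorm (a : A) : ℝ≥0∞ :=
  ⨆ ξ : σ.L2, ⨆ _ : ξ ∈ diracDomain F σ ∧ σ.op a ξ ∈ diracDomain F σ ∧ ‖ξ‖ ≤ 1,
    ‖dirac F σ (σ.op a ξ) - σ.op a (dirac F σ ξ)‖ₑ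

/-- The state space of the pre-C*-algebra `A` with the operator norm of `L²(A, σ)`: the linear
functionals `φ` with `φ(1) = 1 = ‖φ‖` (equivalently, the positive norm-continuous ones with
`φ(1) = 1`). -/
def StateSpace : Type _ := {φ : A →ₗ[ℂ] ℂ // φ 1 = 1 ∧ ∀ a, ‖φ a‖ ≤ ‖σ.op a‖}

/-- The weak-* topology on the state space: pointwise convergence on `A`. -/
@[reducible] def weakStar : TopologicalSpace (StateSpace σ) :=
  TopologicalSpace.induced (fun (φ : StateSpace σ) (a : A) => φ.1 a) Pi.topologicalSpace

/-- `ρ_L(φ, ψ) = sup {|φ(a) - ψ(a)| : L(a) ≤ 1}`, with values in `[0, ∞]`. -/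
def rho (L : A → ℝ≥0∞) (φ ψ : StateSpace σ) : ℝ≥0∞ := ⨆ a : A, ⨆ _ : L a ≤ 1, ‖φ.1 a - ψ.1 a‖ₑ

/-- `L` is a Lip-norm on the pre-C*-algebra `A`: it is a finite seminorm vanishing exactly on the
scalars, and the topology on the state space given by the metric `ρ_L` is the weak-* topology.
With such an `L`, `A` is a compact quantum metric space. -/
structure IsLipNorm (L : A → ℝ≥0∞) : Prop where
  finite : ∀ a, L a ≠ ∞
  add_le : ∀ a b, L (a + b) ≤ L a + L b
  smul_eq : ∀ (c : ℂ) a, L (c • a) = ‖c‖ₑ * L a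
  eq_zero_iff : ∀ a, L a = 0 ↔ a ∈ Submodule.span ℂ {(1 : A)}
  isOpen_iff : ∀ U : Set (StateSpace σ), IsOpen[weakStar σ] U ↔
    ∀ φ ∈ U, ∃ ε : ℝ≥0∞, 0 < ε ∧ ∀ ψ, rho σ L φ ψ < ε → ψ ∈ U

end Haagerup

/-! ### The algebraic free product of two `*`-algebras -/

section FreeProduct

open LinearAlgebra

variable (B : Fin 2 → Type*) [∀ i, Ring (B i)] [∀ i, Algebra ℂ (B i)]

/-- The algebraic free product `B 0 * B 1` of two unital algebras (with identified units). -/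
abbrev Free : Type _ := FreeProduct ℂ B

/-- The canonical homomorphism of `B i` into the free product. -/
abbrev incl (i : Fin 2) : B i →ₐ[ℂ] Free B := FreeProduct.ι ℂ B i

variable {B}

lemma free_hom_ext {R : Type*} [Semiring R] [Algebra ℂ R] {f g : Free B →ₐ[ℂ] R}
    (h : ∀ i b, f (incl B i b) = g (incl B i b)) : f = g := by
  apply (FreeProduct.lift ℂ B).symm.injective
  funext i
  ext b
  simpa using h i b

variable (B) in
/-- The opposite algebra of the free product, with the conjugate scalar multiplication. -/
def ConjOp : Type _ := (Free B)ᵐᵒᵖ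

instance : Ring (ConjOp B) := inferInstanceAs (Ring (Free B)ᵐᵒᵖ)

instance : Algebra ℂ (ConjOp B) :=
  RingHom.toAlgebra' ((algebraMap ℂ (Free B)ᵐᵒᵖ).comp (starRingEnd ℂ))
    (fun c x => Algebra.commutes (A := (Free B)ᵐᵒᵖ) (starRingEnd ℂ c) x)

/-- The identity map of the free product to its conjugate-opposite algebra. -/
def toConj (x : Free B) : ConjOp B := (MulOpposite.op x : (Free B)ᵐᵒᵖ)

/-- The inverse of `toConj`. -/
def ofConj (x : ConjOp B) : Free B := MulOpposite.unop (show (Free B)ᵐᵒᵖ from x)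

lemma toConj_algebraMap (c : ℂ) :
    algebraMap ℂ (ConjOp B) c = toConj (algebraMap ℂ (Free B) (starRingEnd ℂ c)) := rfl

lemma ofConj_mul (x y : ConjOp B) : ofConj (x * y) = ofConj y * ofConj x := rfl

lemma ofConj_add (x y : ConjOp B) : ofConj (x + y) = ofConj x + ofConj y := rfl

lemma ofConj_toConj (x : Free B) : ofConj (toConj x) = x := rfl

lemma ofConj_algebraMap (c : ℂ) :
    ofConj (algebraMap ℂ (ConjOp B) c) = algebraMap ℂ (Free B) (starRingEnd ℂ c) := rfl

lemma ofConj_one : ofConj (1 : ConjOp B) = 1 := rfl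

lemma ofConj_zero : ofConj (0 : ConjOp B) = 0 := rfl

lemma ofConj_injective : Function.Injective (ofConj (B := B)) :=
  fun _ _ h => MulOpposite.unop_injective h

variable [∀ i, StarRing (B i)] [∀ i, StarModule ℂ (B i)]

/-- The map `b ↦ b*` from `B i` to the conjugate-opposite algebra of the free product. -/
def inclStar (i : Fin 2) : B i →ₐ[ℂ] ConjOp B where
  toFun b := toConj (incl B i (star b))
  map_one' := ofConj_injective (by simp [ofConj_toConj, ofConj_one])
  map_mul' a b := ofConj_injective (by simp [ofConj_toConj, ofConj_mul])
  map_zero' := ofConj_injective (by simp [ofConj_toConj, ofConj_zero])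
  map_add' a b := ofConj_injective (by simp [ofConj_toConj, ofConj_add])
  commutes' c := by
    rw [toConj_algebraMap, ← AlgHom.commutes (incl B i), ← algebraMap_star_comm]
    rfl

variable (B) in
/-- The involution of the free product, as a homomorphism to the conjugate-opposite algebra. -/
def starHom : Free B →ₐ[ℂ] ConjOp B := FreeProduct.lift ℂ B (fun {i} => inclStar i)

/-- The involution of the free product: the conjugate-linear antiautomorphism that extends the
involutions of the two factors. -/
def freeStar (x : Free B) : Free B := ofConj (starHom B x)

lemma freeStar_incl (i : Fin 2) (b : B i) : freeStar (incl B i b) = incl B i (star b) := by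
  have h : (starHom B).comp (incl B i) = inclStar i := FreeProduct.lift_comp_ι ℂ B _
  exact congrArg ofConj (DFunLike.congr_fun h b)

lemma freeStar_mul (x y : Free B) : freeStar (x * y) = freeStar y * freeStar x := by
  simp [freeStar, ofConj_mul]

lemma freeStar_add (x y : Free B) : freeStar (x + y) = freeStar x + freeStar y := by
  simp [freeStar, ofConj_add]

lemma freeStar_algebraMap (c : ℂ) :
    freeStar (algebraMap ℂ (Free B) c) = algebraMap ℂ (Free B) (starRingEnd ℂ c) := by
  rw [freeStar, AlgHom.commutes, ofConj_algebraMap]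

lemma freeStar_freeStar (x : Free B) : freeStar (freeStar x) = x := by
  let f : Free B →ₐ[ℂ] Free B :=
    { toFun := fun x => freeStar (freeStar x)
      map_one' := by simp [freeStar, ofConj_one]
      map_mul' := fun x y => by rw [freeStar_mul, freeStar_mul]
      map_zero' := by simp [freeStar, ofConj_zero]
      map_add' := fun x y => by rw [freeStar_add, freeStar_add]
      commutes' := fun c => by rw [freeStar_algebraMap, freeStar_algebraMap, Complex.conj_conj] }
  have h : f = AlgHom.id ℂ (Free B) := free_hom_ext fun i b => by
    change freeStar (freeStar (incl B i b)) = _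
    rw [freeStar_incl, freeStar_incl, star_star]
    rfl
  exact DFunLike.congr_fun h x

instance : StarRing (Free B) where
  star := freeStar
  star_involutive := freeStar_freeStar
  star_mul := freeStar_mul
  star_add := freeStar_add

lemma star_incl (i : Fin 2) (b : B i) : star (incl B i b) = incl B i (star b) :=
  freeStar_incl i b

instance : StarModule ℂ (Free B) where
  star_smul c x := by
    rw [Algebra.smul_def, star_mul, Algebra.smul_def, Algebra.commutes]
    exact congrArg (star x * ·) (freeStar_algebraMap c) |>.trans (Algebra.commutes _ _).symm ▸ by
      rw [Algebra.commutes]; rfl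

/-! ### The filtration of the free product -/

variable (F : ∀ i, StarFiltration (B i))

/-- The span of the products `A^{i_1}_{n_1} ⋯ A^{i_α}_{n_α}`, for the list of the pairs
`(i_j, n_j)`. -/
def wordSpace (l : List (Fin 2 × ℕ)) : Submodule ℂ (Free B) :=
  (l.map fun p => ((F p.1).space p.2).map (incl B p.1).toLinearMap).prod

/-- The span of all the products `A^{i_1}_{n_1} ⋯ A^{i_α}_{n_α}` with `i_j ≠ i_{j+1}` and
`n_1 + ⋯ + n_α ≤ n`. -/
def freeSpace (n : ℕ) : Submodule ℂ (Free B) :=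
  ⨆ l : List (Fin 2 × ℕ), ⨆ _ : l.IsChain (fun p q => p.1 ≠ q.1) ∧ (l.map Prod.snd).sum ≤ n,
    wordSpace F l

lemma wordSpace_cons (p : Fin 2 × ℕ) (l : List (Fin 2 × ℕ)) :
    wordSpace F (p :: l) =
      ((F p.1).space p.2).map (incl B p.1).toLinearMap * wordSpace F l := by
  simp [wordSpace]

lemma wordSpace_append (l l' : List (Fin 2 × ℕ)) :
    wordSpace F (l ++ l') = wordSpace F l * wordSpace F l' := by
  simp [wordSpace]

lemma map_space_zero (i : Fin 2) :
    ((F i).space 0).map (incl B i).toLinearMap = 1 := by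
  rw [(F i).zero, Submodule.map_span, Submodule.one_eq_span]
  simp

lemma map_space_mul_le (i : Fin 2) (m n : ℕ) :
    ((F i).space m).map (incl B i).toLinearMap * ((F i).space n).map (incl B i).toLinearMap ≤
      ((F i).space (m + n)).map (incl B i).toLinearMap := by
  rw [Submodule.mul_le]
  rintro _ ⟨a, ha, rfl⟩ _ ⟨b, hb, rfl⟩
  exact ⟨a * b, (F i).mul_mem m n a ha b hb, by simp⟩

lemma exists_chain (l : List (Fin 2 × ℕ)) : ∃ l' : List (Fin 2 × ℕ),
    l'.IsChain (fun p q => p.1 ≠ q.1) ∧ (l'.map Prod.snd).sum = (l.map Prod.snd).sum ∧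
      wordSpace F l ≤ wordSpace F l' := by
  induction l with
  | nil => exact ⟨[], by simp, rfl, le_rfl⟩
  | cons p l ih =>
    obtain ⟨l', hc, hs, hle⟩ := ih
    cases l' with
    | nil =>
      refine ⟨[p], by simp, by simpa using hs.symm, ?_⟩
      rw [wordSpace_cons, wordSpace_cons]
      exact mul_le_mul_right hle _
    | cons q l' =>
      by_cases hpq : p.1 = q.1
      · obtain ⟨i, m⟩ := p
        obtain ⟨j, n⟩ := q
        obtain rfl : i = j := hpq
        refine ⟨(i, m + n) :: l', ?_, ?_, ?_⟩
        · cases l' with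
          | nil => simp
          | cons r l' => simpa [List.isChain_cons_cons] using hc
        · simp only [List.map_cons, List.sum_cons] at hs ⊢
          omega
        · rw [wordSpace_cons] at hle ⊢
          refine (mul_le_mul_right hle _).trans ?_
          rw [wordSpace_cons, ← mul_assoc]
          exact mul_le_mul_left (map_space_mul_le F i m n) _
      · refine ⟨p :: q :: l', List.isChain_cons_cons.mpr ⟨hpq, hc⟩, ?_, ?_⟩
        · simp only [List.map_cons, List.sum_cons] at hs ⊢
          omega
        · rw [wordSpace_cons, wordSpace_cons F p (q :: l')]
          exact mul_le_mul_right hle _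

lemma wordSpace_le (l : List (Fin 2 × ℕ)) {n : ℕ} (h : (l.map Prod.snd).sum ≤ n) :
    wordSpace F l ≤ freeSpace F n := by
  obtain ⟨l', hc, hs, hle⟩ := exists_chain F l
  exact hle.trans (le_iSup₂_of_le l' ⟨hc, hs.trans_le h⟩ le_rfl)

lemma freeSpace_mono {m n : ℕ} (h : m ≤ n) : freeSpace F m ≤ freeSpace F n :=
  iSup₂_le fun l hl => wordSpace_le F l (hl.2.trans h)

lemma exists_pos (l : List (Fin 2 × ℕ)) : ∃ l' : List (Fin 2 × ℕ),
    (∀ p ∈ l', p.2 ≠ 0) ∧ (l'.map Prod.snd).sum = (l.map Prod.snd).sum ∧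
      wordSpace F l = wordSpace F l' := by
  induction l with
  | nil => exact ⟨[], by simp, rfl, rfl⟩
  | cons p l ih =>
    obtain ⟨l', hc, hs, hle⟩ := ih
    obtain ⟨i, m⟩ := p
    by_cases hm : m = 0
    · subst hm
      exact ⟨l', hc, by simpa using hs, by rw [wordSpace_cons, map_space_zero, one_mul, hle]⟩
    · refine ⟨(i, m) :: l', ?_, by simpa using hs, by rw [wordSpace_cons, wordSpace_cons, hle]⟩
      simpa [hm] using hc

lemma length_le_sum (l : List (Fin 2 × ℕ)) (h : ∀ p ∈ l, p.2 ≠ 0) :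
    l.length ≤ (l.map Prod.snd).sum := by
  induction l with
  | nil => simp
  | cons p l ih =>
    have h1 := ih fun q hq => h q (List.mem_cons_of_mem _ hq)
    have h2 := h p List.mem_cons_self
    simp only [List.length_cons, List.map_cons, List.sum_cons]
    omega

lemma wordSpace_fg (l : List (Fin 2 × ℕ)) : (wordSpace F l).FG := by
  induction l with
  | nil =>
    have h : wordSpace F [] = 1 := rfl
    rw [h, Submodule.one_eq_span]
    exact Submodule.fg_span_singleton _
  | cons p l ih =>
    rw [wordSpace_cons]
    exact (((Submodule.fg_iff_finiteDimensional _).mpr ((F p.1).finite p.2)).map _).mul ih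

lemma freeSpace_finite (n : ℕ) : FiniteDimensional ℂ (freeSpace F n) := by
  let S : Set (List (Fin 2 × Fin (n + 1))) := {l | l.length ≤ n}
  have hS : S.Finite := List.finite_length_le _ n
  have : Finite S := hS
  let W : Submodule ℂ (Free B) :=
    ⨆ l : S, wordSpace F (l.1.map fun p => (p.1, (p.2 : ℕ)))
  have hW : W.FG := Submodule.fg_iSup _ fun l => wordSpace_fg F _
  have hle : freeSpace F n ≤ W := by
    refine iSup₂_le fun l hl => ?_
    obtain ⟨l', hpos, hs, heq⟩ := exists_pos F l
    have hs' : (l'.map Prod.snd).sum ≤ n := hs.trans_le hl.2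
    have hlt : ∀ p ∈ l', p.2 < n + 1 := fun p hp =>
      Nat.lt_succ_of_le ((List.single_le_sum (by simp) _ (List.mem_map_of_mem hp)).trans hs')
    rw [heq]
    refine le_iSup_of_le (⟨l'.map fun p => (p.1, Fin.ofNat (n + 1) p.2), ?_⟩ : S) (le_of_eq ?_)
    · simpa [S] using (length_le_sum l' hpos).trans hs'
    · congr 1
      rw [List.map_map]
      conv_lhs => rw [← List.map_id l']
      refine List.map_congr_left fun p hp => ?_
      simp [Nat.mod_eq_of_lt (hlt p hp)]
  have : FiniteDimensional ℂ W := (Submodule.fg_iff_finiteDimensional _).mp hW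
  exact Submodule.finiteDimensional_of_le hle

lemma freeSpace_mul (m n : ℕ) (a : Free B) (ha : a ∈ freeSpace F m) (b : Free B)
    (hb : b ∈ freeSpace F n) : a * b ∈ freeSpace F (m + n) := by
  have h : freeSpace F m * freeSpace F n ≤ freeSpace F (m + n) := by
    simp only [freeSpace, Submodule.iSup_mul, Submodule.mul_iSup]
    refine iSup₂_le fun l hl => iSup₂_le fun l' hl' => ?_
    rw [← wordSpace_append]
    refine wordSpace_le F _ ?_
    rw [List.map_append, List.sum_append]
    exact add_le_add hl'.2 hl.2
  exact h (Submodule.mul_mem_mul ha hb)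

lemma wordSpace_star (l : List (Fin 2 × ℕ)) (a : Free B) (ha : a ∈ wordSpace F l) :
    star a ∈ wordSpace F l.reverse := by
  induction l generalizing a with
  | nil =>
    simp only [wordSpace, List.map_nil, List.prod_nil, List.reverse_nil] at ha ⊢
    obtain ⟨c, rfl⟩ := Submodule.mem_one.mp ha
    exact Submodule.mem_one.mpr ⟨starRingEnd ℂ c, (freeStar_algebraMap c).symm⟩
  | cons p l ih =>
    rw [wordSpace_cons] at ha
    rw [List.reverse_cons, wordSpace_append]
    refine Submodule.mul_induction_on ha ?_ ?_
    · rintro _ ⟨b, hb, rfl⟩ y hy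
      rw [star_mul]
      refine Submodule.mul_mem_mul (ih y hy) ?_
      rw [wordSpace_cons]
      refine (mul_one (star ((incl B p.1).toLinearMap b))) ▸ Submodule.mul_mem_mul ?_ ?_
      · exact ⟨star b, (F p.1).star_mem _ b hb, (star_incl p.1 b).symm⟩
      · simpa [wordSpace] using Submodule.mem_one.mpr ⟨1, by simp⟩
    · intro x y hx hy
      rw [star_add]
      exact add_mem hx hy

lemma freeSpace_star (n : ℕ) (a : Free B) (ha : a ∈ freeSpace F n) :
    star a ∈ freeSpace F n := by
  let T : Submodule ℂ (Free B) :=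
    { carrier := {x | star x ∈ freeSpace F n}
      add_mem' := fun {x y} hx hy => by
        change star (x + y) ∈ freeSpace F n
        rw [star_add]
        exact add_mem hx hy
      zero_mem' := by
        change star (0 : Free B) ∈ freeSpace F n
        rw [star_zero]
        exact zero_mem _
      smul_mem' := fun c x hx => by
        change star (c • x) ∈ freeSpace F n
        rw [star_smul]
        exact Submodule.smul_mem _ _ hx }
  have h : freeSpace F n ≤ T := iSup₂_le fun l hl x hx =>
    wordSpace_le F l.reverse (by simpa [List.sum_reverse] using hl.2) (wordSpace_star F l x hx)
  exact h ha

lemma freeSpace_exhaust (a : Free B) : ∃ n, a ∈ freeSpace F n := by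
  have hone : ∀ c : ℂ, algebraMap ℂ (Free B) c ∈ freeSpace F 0 := fun c =>
    wordSpace_le F [] (by simp) (by simp [wordSpace])
  let T : Subalgebra ℂ (Free B) :=
    { carrier := {x | ∃ n, x ∈ freeSpace F n}
      mul_mem' := by
        rintro x y ⟨m, hx⟩ ⟨n, hy⟩
        exact ⟨m + n, freeSpace_mul F m n x hx y hy⟩
      add_mem' := by
        rintro x y ⟨m, hx⟩ ⟨n, hy⟩
        exact ⟨max m n, add_mem (freeSpace_mono F (le_max_left m n) hx)
          (freeSpace_mono F (le_max_right m n) hy)⟩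
      algebraMap_mem' := fun c => ⟨0, hone c⟩ }
  have hT : ∀ i (b : B i), incl B i b ∈ T := fun i b => by
    obtain ⟨n, hn⟩ := (F i).exhaust b
    refine ⟨n, wordSpace_le F [(i, n)] (by simp) ?_⟩
    simp only [wordSpace, List.map_cons, List.map_nil, List.prod_cons, List.prod_nil, mul_one]
    exact ⟨b, hn, rfl⟩
  let f : Free B →ₐ[ℂ] T :=
    FreeProduct.lift ℂ B (fun {i} => (incl B i).codRestrict T (hT i))
  have hf : T.val.comp f = AlgHom.id ℂ (Free B) := free_hom_ext fun i b => by
    have h : f.comp (incl B i) = (incl B i).codRestrict T (hT i) := FreeProduct.lift_comp_ι ℂ B _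
    exact congrArg Subtype.val (DFunLike.congr_fun h b)
  have h := DFunLike.congr_fun hf a
  have h2 : (f a : Free B) = a := h
  rw [← h2]
  exact (f a).2

/-- The filtration of the free product by the subspaces `freeSpace`. -/
def freeFiltration : StarFiltration (Free B) where
  space := freeSpace F
  finite := freeSpace_finite F
  mono _ _ h := freeSpace_mono F h
  exhaust := freeSpace_exhaust F
  star_mem := freeSpace_star F
  mul_mem := freeSpace_mul F
  zero := by
    rw [← Submodule.one_eq_span]
    refine le_antisymm (iSup₂_le fun l hl => ?_) (wordSpace_le F [] (by simp))
    obtain ⟨l', hpos, hs, heq⟩ := exists_pos F l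
    have h0 := length_le_sum l' hpos
    have : l' = [] := List.eq_nil_of_length_eq_zero (by have := hl.2; omega)
    subst this
    exact heq.le

/-- The defining properties of the free product functional `σ⁰ * σ¹`: it restricts to `σⁱ` on
`B i`, and it vanishes on each product `a_1 ⋯ a_α` with `α ≥ 1` of elements `a_j` of `B i_j` with
`σ(a_j) = 0` and `i_j ≠ i_{j+1}`. -/
structure IsFreeProductState (σ : ∀ i, RegularState (B i)) (τ : Free B →ₗ[ℂ] ℂ) : Prop where
  restrict : ∀ i (b : B i), τ (incl B i b) = (σ i).toLin b
  alternating : ∀ l : List (Σ i, B i), l ≠ [] → l.IsChain (fun p q => p.1 ≠ q.1) →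
    (∀ p ∈ l, (σ p.1).toLin p.2 = 0) → τ (l.map fun p => incl B p.1 p.2).prod = 0

end FreeProduct

end QMS

end

/-!
The proof works in coordinates. Since `σⁱ` is a trace, the adjoint is isometric for the norm of
`L²(A i, σⁱ)`, so there is an orthonormal basis of `A i` that consists of self-adjoint elements, has
the unit as a member and is adapted to the filtration (`adaptedBasis`). The words with letters
alternately from the two bases, without the units, form a basis of the free product `A`: for each
factor, the span of the words is a direct sum of copies of `A i`, so both factors act on it, hence
so does `A` (`rep`), and the orbit map of the empty word inverts the map that multiplies out the
words.

*The state.* The words are orthonormal for an inner product for which `rep` is a `*`-representation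
by bounded operators. The coefficient of the empty word is therefore a faithful state with a bounded
left regular representation; it has the defining properties of `σ⁰ * σ¹`, and these determine its
values on words (`freeState`, `isFreeProductState_freeState`, `IsFreeProductState.eq_freeState`). A
word of degree `n` spans a line in the range of `P_n` (`P_freeState`).

*The Haagerup-type condition.* Since the letters are self-adjoint, the product of a word `a b` and
an element of the form `b⁻¹ c`, with `b⁻¹` the reversed word, has the term `a c`, in which `b`
cancels. The product of `a s b` and `b⁻¹ t c` also has the terms `a r c`, in which the letters `s`
and `t` of one factor merge to a letter `r` (`coef_mul`). If the degrees `k`, `n` of the arguments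
and the degree `m` of the term are fixed, they determine the degree at which the cancellation ends
in each of the three words. So for a given word the cut is unique, and so is the letter that the
cancellation stops at. For terms of one kind, the estimate then follows from the Cauchy-Schwarz
inequality or from the Haagerup-type condition of the factors (`sum_norm_sq_mergeSum_le`). There are
four kinds: pure cancellations, mergings with `deg t = deg s + deg r` or `deg s = deg r + deg t`,
and the other mergings. The first three are the contributions to the same words of the product, but
come from orthogonal parts of the arguments; the fourth contributes to other words. This gives the
constant `2 C` (`sum_norm_sq_product_le`, `haagerupType_freeState_two_mul`), which is at most `√5 C`
as `C ≥ 1`.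

*The Lip-norm property* holds for each filtered algebra with a Haagerup-type condition
(`HaagerupType.isLipNorm`). The `j`-th diagonal `∑ P_m a P_n`, `m - n = j`, of `a` has the norm of
its largest block, which is controlled by the components `a_k`; the `j`-th diagonal of `[D, a]` is
`j` times that of `a`, and by Bessel's inequality for `z ↦ z^D [D, a] z^{-D}` the diagonals of
`[D, a]` are square-summable. So the diagonals of `a` with large `|j|` are uniformly small in sum
for `L(a) ≤ 1`, and the set of the `a` with `L(a) ≤ 1` and `σ(a) = 0` is totally bounded in the
operator norm, whence the metric `ρ_L` induces the weak-* topology.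
-/

noncomputable section

namespace QMS

lemma sum_le_sum_of_injOn_support {α β : Type*} {s : Finset α} {t : Finset β} {f : α → ℝ}
    {g : β → ℝ} (φ : α → β) (hg : ∀ b ∈ t, 0 ≤ g b)
    (hm : ∀ a ∈ s, f a ≠ 0 → φ a ∈ t ∧ f a ≤ g (φ a))
    (hi : ∀ a ∈ s, ∀ a' ∈ s, f a ≠ 0 → f a' ≠ 0 → φ a = φ a' → a = a') :
    ∑ a ∈ s, f a ≤ ∑ b ∈ t, g b := by
  classical
  rw [← Finset.sum_filter_ne_zero]
  refine (Finset.sum_le_sum fun a ha => (hm a (Finset.mem_filter.mp ha).1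
    (Finset.mem_filter.mp ha).2).2).trans ?_
  rw [← Finset.sum_image (f := g) (g := φ) (s := s.filter fun a => f a ≠ 0) fun a ha a' ha' h =>
    hi a (Finset.mem_filter.mp ha).1 a' (Finset.mem_filter.mp ha').1
      (Finset.mem_filter.mp ha).2 (Finset.mem_filter.mp ha').2 h]
  refine Finset.sum_le_sum_of_subset_of_nonneg (fun b hb => ?_) fun b hb _ => hg b hb
  obtain ⟨a, ha, rfl⟩ := Finset.mem_image.mp hb
  exact (hm a (Finset.mem_filter.mp ha).1 (Finset.mem_filter.mp ha).2).1

/-! ### The GNS space and its grading -/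

section GNS

variable {A : Type*} [Ring A] [StarRing A] [Algebra ℂ A] [StarModule ℂ A]
variable (F : StarFiltration A) (σ : RegularState A)

lemma vec_injective : Function.Injective σ.vec := fun _ _ h =>
  σ.toPre.injective (UniformSpace.Completion.coe_injective _ h)

lemma denseRange_vec : DenseRange σ.vec :=
  UniformSpace.Completion.denseRange_coe.comp σ.toPre.surjective.denseRange
    (UniformSpace.Completion.continuous_coe _)

lemma norm_vec_sq (a : A) : ‖σ.vec a‖ ^ 2 = (σ.toLin (star a * a)).re := by
  rw [← σ.inner_vec a a]
  exact (inner_self_eq_norm_sq (𝕜 := ℂ) (σ.vec a)).symm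

lemma norm_vec_one : ‖σ.vec (1 : A)‖ = 1 := by
  have := norm_vec_sq σ (1 : A)
  rw [star_one, one_mul, σ.map_one, Complex.one_re] at this
  exact (pow_eq_one_iff_of_nonneg (norm_nonneg _) two_ne_zero).mp this

lemma eq_of_eq_on_vec {E : Type*} [TopologicalSpace E] [T2Space E] {f g : σ.L2 → E}
    (hf : Continuous f) (hg : Continuous g) (h : ∀ a, f (σ.vec a) = g (σ.vec a)) (ξ : σ.L2) :
    f ξ = g ξ :=
  congrFun ((denseRange_vec σ).equalizer hf hg (funext h)) ξ

lemma le_of_le_on_vec {f g : σ.L2 → ℝ} (hf : Continuous f) (hg : Continuous g)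
    (h : ∀ a, f (σ.vec a) ≤ g (σ.vec a)) (ξ : σ.L2) : f ξ ≤ g ξ :=
  (denseRange_vec σ).induction_on (p := fun ξ => f ξ ≤ g ξ) ξ (isClosed_le hf hg) h

lemma op_add (a b : A) : σ.op (a + b) = σ.op a + σ.op b := by
  ext ξ
  refine eq_of_eq_on_vec σ (σ.op (a + b)).continuous (σ.op a + σ.op b).continuous (fun c => ?_) ξ
  simp [RegularState.op_vec, add_mul]

lemma op_smul (r : ℂ) (a : A) : σ.op (r • a) = r • σ.op a := by
  ext ξ
  refine eq_of_eq_on_vec σ (σ.op (r • a)).continuous (r • σ.op a).continuous (fun c => ?_) ξ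
  simp [RegularState.op_vec]

/-- The left regular representation as a linear map. -/
def opLin : A →ₗ[ℂ] (σ.L2 →L[ℂ] σ.L2) where
  toFun := σ.op
  map_add' := op_add σ
  map_smul' := op_smul σ

lemma opLin_apply (a : A) : opLin σ a = σ.op a := rfl

lemma inner_op_left (a : A) (ξ η : σ.L2) : ⟪σ.op a ξ, η⟫_ℂ = ⟪ξ, σ.op (star a) η⟫_ℂ := by
  refine eq_of_eq_on_vec σ (f := fun η => ⟪σ.op a ξ, η⟫_ℂ)
    (g := fun η => ⟪ξ, σ.op (star a) η⟫_ℂ) (by fun_prop) (by fun_prop) (fun c => ?_) η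
  refine eq_of_eq_on_vec σ (f := fun ξ => ⟪σ.op a ξ, σ.vec c⟫_ℂ)
    (g := fun ξ => ⟪ξ, σ.op (star a) (σ.vec c)⟫_ℂ) (by fun_prop) (by fun_prop) (fun b => ?_) ξ
  simp only [RegularState.op_vec, RegularState.inner_vec, star_mul, mul_assoc]

lemma vec_mem_spaceL2 {n : ℕ} {a : A} : σ.vec a ∈ spaceL2 F σ n ↔ a ∈ F.space n := by
  constructor
  · rintro ⟨b, hb, h⟩
    exact vec_injective σ h ▸ hb
  · exact fun h => ⟨a, h, rfl⟩

lemma spaceL2_mono {m n : ℕ} (h : m ≤ n) : spaceL2 F σ m ≤ spaceL2 F σ n :=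
  Submodule.map_mono (F.mono m n h)

lemma Q_apply_mem (n : ℕ) (ξ : σ.L2) : Q F σ n ξ ∈ spaceL2 F σ n :=
  Submodule.starProjection_apply_mem _ _

lemma Q_eq_self {n : ℕ} {ξ : σ.L2} (h : ξ ∈ spaceL2 F σ n) : Q F σ n ξ = ξ :=
  Submodule.starProjection_eq_self_iff.mpr h

lemma Q_vec {n : ℕ} {a : A} (h : a ∈ F.space n) : Q F σ n (σ.vec a) = σ.vec a :=
  Q_eq_self F σ ((vec_mem_spaceL2 F σ).mpr h)

lemma inner_Q_left (n : ℕ) (ξ η : σ.L2) : ⟪Q F σ n ξ, η⟫_ℂ = ⟪ξ, Q F σ n η⟫_ℂ :=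
  Submodule.inner_starProjection_left_eq_right _ _ _

lemma Q_Q_of_le {m n : ℕ} (h : m ≤ n) (ξ : σ.L2) : Q F σ n (Q F σ m ξ) = Q F σ m ξ :=
  Q_eq_self F σ (spaceL2_mono F σ h (Q_apply_mem F σ m ξ))

lemma Q_Q_of_ge {m n : ℕ} (h : m ≤ n) (ξ : σ.L2) : Q F σ m (Q F σ n ξ) = Q F σ m ξ := by
  refine ext_inner_left ℂ fun η => ?_
  rw [← inner_Q_left, ← inner_Q_left, Q_Q_of_le F σ h, inner_Q_left]

lemma norm_Q_le (n : ℕ) (ξ : σ.L2) : ‖Q F σ n ξ‖ ≤ ‖ξ‖ :=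
  Submodule.norm_starProjection_apply_le _ _

lemma inner_P_left (n : ℕ) (ξ η : σ.L2) : ⟪P F σ n ξ, η⟫_ℂ = ⟪ξ, P F σ n η⟫_ℂ := by
  cases n with
  | zero => exact inner_Q_left F σ 0 ξ η
  | succ n => simp [P, inner_sub_left, inner_sub_right, inner_Q_left]

lemma sum_P (n : ℕ) (ξ : σ.L2) : ∑ k ∈ Finset.range (n + 1), P F σ k ξ = Q F σ n ξ := by
  induction n with
  | zero => simp [P]
  | succ n ih => rw [Finset.sum_range_succ, ih]; simp [P]

lemma P_apply_mem (n : ℕ) (ξ : σ.L2) : P F σ n ξ ∈ spaceL2 F σ n := by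
  cases n with
  | zero => exact Q_apply_mem F σ 0 ξ
  | succ n =>
    exact sub_mem (Q_apply_mem F σ _ ξ) (spaceL2_mono F σ n.le_succ (Q_apply_mem F σ n ξ))

lemma P_eq_zero_of_mem {m n : ℕ} (h : m < n) {ξ : σ.L2} (hξ : ξ ∈ spaceL2 F σ m) :
    P F σ n ξ = 0 := by
  cases n with
  | zero => omega
  | succ n =>
    simp [P, Q_eq_self F σ (spaceL2_mono F σ h.le hξ),
      Q_eq_self F σ (spaceL2_mono F σ (Nat.lt_succ_iff.mp h) hξ)]

lemma P_P_of_ne {m n : ℕ} (h : m ≠ n) (ξ : σ.L2) : P F σ m (P F σ n ξ) = 0 := by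
  rcases lt_or_gt_of_ne h with h | h
  · refine ext_inner_left ℂ fun η => ?_
    rw [← inner_P_left, ← inner_P_left, P_eq_zero_of_mem F σ h (P_apply_mem F σ m η)]
    simp
  · exact P_eq_zero_of_mem F σ h (P_apply_mem F σ n ξ)

lemma P_P_self (n : ℕ) (ξ : σ.L2) : P F σ n (P F σ n ξ) = P F σ n ξ := by
  cases n with
  | zero => exact Q_Q_of_le F σ le_rfl ξ
  | succ n =>
    simp [P, Q_Q_of_le F σ le_rfl, Q_Q_of_le F σ n.le_succ, Q_Q_of_ge F σ n.le_succ]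

lemma P_vec_of_lt {m n : ℕ} (h : m < n) {a : A} (ha : a ∈ F.space m) : P F σ n (σ.vec a) = 0 :=
  P_eq_zero_of_mem F σ h ((vec_mem_spaceL2 F σ).mpr ha)

lemma sum_P_vec {n : ℕ} {a : A} (h : a ∈ F.space n) :
    ∑ k ∈ Finset.range (n + 1), P F σ k (σ.vec a) = σ.vec a := by
  rw [sum_P, Q_vec F σ h]

lemma inner_P_P_of_ne {m n : ℕ} (h : m ≠ n) (ξ η : σ.L2) : ⟪P F σ m ξ, P F σ n η⟫_ℂ = 0 := by
  rw [inner_P_left, P_P_of_ne F σ h, inner_zero_right]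

/-- Pythagoras' theorem for vectors in the ranges of the projections `P_k`. -/
lemma norm_sum_P_sq (s : Finset ℕ) (ξ : ℕ → σ.L2) :
    ‖∑ k ∈ s, P F σ k (ξ k)‖ ^ 2 = ∑ k ∈ s, ‖P F σ k (ξ k)‖ ^ 2 := by
  have h : (⟪∑ k ∈ s, P F σ k (ξ k), ∑ k ∈ s, P F σ k (ξ k)⟫_ℂ) =
      ∑ k ∈ s, ((‖P F σ k (ξ k)‖ ^ 2 : ℝ) : ℂ) := by
    rw [sum_inner]
    refine Finset.sum_congr rfl fun k hk => ?_
    rw [inner_sum, Finset.sum_eq_single_of_mem k hk fun l _ hl => inner_P_P_of_ne F σ hl.symm _ _,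
      inner_self_eq_norm_sq_to_K]
    simp
  rw [inner_self_eq_norm_sq_to_K, ← Complex.ofReal_sum] at h
  exact Complex.ofReal_injective (by simpa using h)

lemma sum_norm_P_sq_le (n : ℕ) (ξ : σ.L2) :
    ∑ k ∈ Finset.range n, ‖P F σ k ξ‖ ^ 2 ≤ ‖ξ‖ ^ 2 := by
  refine (Finset.sum_le_sum_of_subset_of_nonneg (Finset.range_mono n.le_succ)
    fun _ _ _ => sq_nonneg _).trans ?_
  rw [← norm_sum_P_sq F σ _ fun _ => ξ, sum_P]
  exact pow_le_pow_left₀ (norm_nonneg _) (norm_Q_le F σ n ξ) 2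

lemma norm_P_le (n : ℕ) (ξ : σ.L2) : ‖P F σ n ξ‖ ≤ ‖ξ‖ := by
  refine (sq_le_sq₀ (norm_nonneg _) (norm_nonneg _)).mp ?_
  exact (Finset.single_le_sum (f := fun k => ‖P F σ k ξ‖ ^ 2) (fun _ _ => sq_nonneg _)
    (Finset.self_mem_range_succ n)).trans (sum_norm_P_sq_le F σ (n + 1) ξ)

lemma comp_mem (n : ℕ) (a : A) : comp F σ n a ∈ F.space n := by
  rw [← vec_mem_spaceL2 F σ, vec_comp]
  exact P_apply_mem F σ n _

lemma sum_comp {n : ℕ} {a : A} (h : a ∈ F.space n) :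
    ∑ k ∈ Finset.range (n + 1), comp F σ k a = a := by
  apply vec_injective σ
  simp only [map_sum, vec_comp]
  exact sum_P_vec F σ h

lemma HaagerupType.bound {C : ℝ} (h : HaagerupType F σ C) (a b : A) (k m n : ℕ) :
    ‖P F σ m (σ.vec (comp F σ k a * comp F σ n b))‖ ≤
      C * ‖σ.vec (comp F σ k a)‖ * ‖σ.vec (comp F σ n b)‖ := by
  have h1 := (P F σ m ∘L σ.op (comp F σ k a) ∘L P F σ n).le_of_opNorm_le (h a k m n)
    (σ.vec (comp F σ n b))
  have h2 : P F σ n (σ.vec (comp F σ n b)) = σ.vec (comp F σ n b) := by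
    rw [vec_comp, P_P_self]
  simpa only [ContinuousLinearMap.comp_apply, h2, RegularState.op_vec] using h1

/-- The Haagerup-type condition only has to be checked on the vectors from the algebra. -/
lemma haagerupType_of_bound {C : ℝ} (hC : 0 ≤ C)
    (h : ∀ (a b : A) (k m n : ℕ), ‖P F σ m (σ.vec (comp F σ k a * comp F σ n b))‖ ≤
      C * ‖σ.vec (comp F σ k a)‖ * ‖σ.vec (comp F σ n b)‖) : HaagerupType F σ C := by
  intro a k m n
  have hK : 0 ≤ C * ‖σ.vec (comp F σ k a)‖ := by positivity
  refine ContinuousLinearMap.opNorm_le_bound _ hK fun ξ => ?_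
  refine le_of_le_on_vec σ (f := fun ξ => ‖(P F σ m ∘L σ.op (comp F σ k a) ∘L P F σ n) ξ‖)
    (g := fun ξ => C * ‖σ.vec (comp F σ k a)‖ * ‖ξ‖) (by fun_prop) (by fun_prop) (fun b => ?_) ξ
  have h1 := h a b k m n
  simp only [ContinuousLinearMap.comp_apply, ← vec_comp F σ n b, RegularState.op_vec]
  refine h1.trans (mul_le_mul_of_nonneg_left ?_ hK)
  rw [vec_comp]
  exact norm_P_le F σ n _

lemma HaagerupType.one_le {C : ℝ} (h : HaagerupType F σ C) : 1 ≤ C := by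
  have h1 : (1 : A) ∈ F.space 0 := by
    rw [F.zero]
    exact Submodule.mem_span_singleton_self 1
  have h2 : comp F σ 0 (1 : A) = 1 := by simpa using sum_comp F σ h1
  have h4 := h.bound F σ 1 1 0 0 0
  rw [h2, one_mul, ← vec_comp, h2, norm_vec_one] at h4
  linarith

end GNS

/-! ### Commutators with the Dirac operator -/

section Dirac

variable {A : Type*} [Ring A] [StarRing A] [Algebra ℂ A] [StarModule ℂ A]
variable (F : StarFiltration A) (σ : RegularState A)

lemma hasSum_dirac_vec {N : ℕ} {b : A} (hb : b ∈ F.space N) :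
    HasSum (fun n : ℕ => (n : ℂ) • P F σ n (σ.vec b))
      (∑ n ∈ Finset.range (N + 1), (n : ℂ) • P F σ n (σ.vec b)) := by
  refine hasSum_sum_of_ne_finset_zero fun n hn => ?_
  rw [P_vec_of_lt F σ (by simpa using hn) hb, smul_zero]

lemma dirac_vec {N : ℕ} {b : A} (hb : b ∈ F.space N) :
    dirac F σ (σ.vec b) = ∑ n ∈ Finset.range (N + 1), (n : ℂ) • P F σ n (σ.vec b) :=
  (hasSum_dirac_vec F σ hb).tsum_eq

lemma vec_mem_diracDomain (b : A) : σ.vec b ∈ diracDomain F σ := by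
  obtain ⟨N, hb⟩ := F.exhaust b
  refine summable_of_ne_finset_zero (s := Finset.range (N + 1)) fun n hn => ?_
  rw [P_vec_of_lt F σ (by simpa using hn) hb]
  simp

lemma dirac_smul (c : ℂ) (ξ : σ.L2) : dirac F σ (c • ξ) = c • dirac F σ ξ := by
  simp only [dirac, map_smul, smul_comm _ c]
  exact tsum_const_smul'' c

lemma dirac_vec_add (a b : A) :
    dirac F σ (σ.vec (a + b)) = dirac F σ (σ.vec a) + dirac F σ (σ.vec b) := by
  obtain ⟨M, ha⟩ := F.exhaust a
  obtain ⟨N, hb⟩ := F.exhaust b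
  have ha' := F.mono _ _ (le_max_left M N) ha
  have hb' := F.mono _ _ (le_max_right M N) hb
  rw [dirac_vec F σ ha', dirac_vec F σ hb', dirac_vec F σ (add_mem ha' hb'),
    ← Finset.sum_add_distrib]
  simp

lemma summable_dirac {ξ : σ.L2} (h : ξ ∈ diracDomain F σ) :
    Summable fun n : ℕ => (n : ℂ) • P F σ n ξ := by
  have hV : OrthogonalFamily ℂ (fun n : ℕ => (P F σ n).range)
      fun n => (P F σ n).range.subtypeₗᵢ := by
    rintro m n hmn ⟨_, x, rfl⟩ ⟨_, y, rfl⟩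
    exact inner_P_P_of_ne F σ hmn x y
  have := (hV.summable_iff_norm_sq_summable
    (fun n => (n : ℂ) • (⟨P F σ n ξ, ξ, rfl⟩ : (P F σ n).range))).mpr (by
      refine (show Summable _ from h).congr fun n => ?_
      rw [norm_smul, mul_pow, Complex.norm_natCast]
      rfl)
  exact this

/-- The operator `D` is symmetric. -/
lemma inner_vec_dirac (c : A) {ξ : σ.L2} (h : ξ ∈ diracDomain F σ) :
    ⟪σ.vec c, dirac F σ ξ⟫_ℂ = ⟪dirac F σ (σ.vec c), ξ⟫_ℂ := by
  obtain ⟨N, hc⟩ := F.exhaust c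
  have h1 := (summable_dirac F σ h).hasSum.mapL (innerSL ℂ (σ.vec c))
  have h2 : HasSum (fun n : ℕ => ⟪σ.vec c, (n : ℂ) • P F σ n ξ⟫_ℂ)
      (∑ n ∈ Finset.range (N + 1), ⟪σ.vec c, (n : ℂ) • P F σ n ξ⟫_ℂ) := by
    refine hasSum_sum_of_ne_finset_zero fun n hn => ?_
    rw [inner_smul_right, ← inner_P_left, P_vec_of_lt F σ (by simpa using hn) hc]
    simp
  have h3 := h1.unique h2
  rw [dirac_vec F σ hc, sum_inner]
  refine h3.trans (Finset.sum_congr rfl fun n _ => ?_)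
  rw [inner_smul_right, inner_smul_left, inner_P_left, Complex.conj_natCast]

/-- The operator `[D, a]` on the vectors from the algebra is bounded by `r`. -/
def LipBound (a : A) (r : ℝ) : Prop :=
  ∀ b, ‖dirac F σ (σ.vec (a * b)) - σ.op a (dirac F σ (σ.vec b))‖ ≤ r * ‖σ.vec b‖

lemma norm_le_of_inner_vec_le {ζ : σ.L2} {r : ℝ}
    (h : ∀ c, ‖⟪σ.vec c, ζ⟫_ℂ‖ ≤ r * ‖σ.vec c‖) : ‖ζ‖ ≤ r := by
  have h1 := le_of_le_on_vec σ (f := fun η => ‖⟪η, ζ⟫_ℂ‖) (g := fun η => r * ‖η‖)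
    (by fun_prop) (by fun_prop) h ζ
  rw [inner_self_eq_norm_sq_to_K] at h1
  simp only [Complex.coe_algebraMap, norm_pow, Complex.norm_real, norm_norm] at h1
  rw [sq] at h1
  by_contra! hlt
  have h0 : ‖ζ‖ = 0 := by
    by_contra h0
    exact hlt.not_ge (le_of_mul_le_mul_right h1 (lt_of_le_of_ne (norm_nonneg _) (Ne.symm h0)))
  have h2 := h 1
  rw [norm_eq_zero.mp h0, inner_zero_right, norm_zero, norm_vec_one, mul_one] at h2
  rw [h0] at hlt
  exact hlt.not_ge h2

/-- The norm of `[D, a]` on its natural domain is its norm on the vectors from the algebra,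
since the adjoint of `[D, a]` on these vectors is `[a*, D]`. -/
lemma lipSeminorm_le_iff (a : A) {r : ℝ} (hr : 0 ≤ r) :
    lipSeminorm F σ a ≤ ENNReal.ofReal r ↔ LipBound F σ a r := by
  constructor
  · intro h b
    by_cases hb : σ.vec b = 0
    · have h0 : b = 0 := vec_injective σ (by simpa using hb)
      simp [h0, dirac]
    · have hb' : 0 < ‖σ.vec b‖ := norm_pos_iff.mpr hb
      set t : ℂ := ((‖σ.vec b‖⁻¹ : ℝ) : ℂ) with ht
      have htn : ‖t‖ = ‖σ.vec b‖⁻¹ := by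
        rw [ht, Complex.norm_real, Real.norm_of_nonneg (by positivity)]
      have h1 := (le_iSup₂_of_le (f := fun (ξ : σ.L2)
        (_ : ξ ∈ diracDomain F σ ∧ σ.op a ξ ∈ diracDomain F σ ∧ ‖ξ‖ ≤ 1) =>
          ‖dirac F σ (σ.op a ξ) - σ.op a (dirac F σ ξ)‖ₑ) (σ.vec (t • b))
        ⟨vec_mem_diracDomain F σ _, by
          rw [RegularState.op_vec]; exact vec_mem_diracDomain F σ _, by
          rw [map_smul, norm_smul, htn, inv_mul_cancel₀ hb'.ne']⟩ le_rfl).trans h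
      simp only [map_smul, dirac_smul, ← smul_sub, RegularState.op_vec] at h1
      rw [← ofReal_norm, ENNReal.ofReal_le_ofReal_iff hr, norm_smul, htn,
        inv_mul_le_iff₀ hb'] at h1
      linarith
  · intro h
    refine iSup₂_le fun ξ hξ => ?_
    obtain ⟨h1, h2, h3⟩ := hξ
    rw [← ofReal_norm, ENNReal.ofReal_le_ofReal_iff hr]
    refine norm_le_of_inner_vec_le σ fun c => ?_
    have key : ∀ ξ, ξ ∈ diracDomain F σ → σ.op a ξ ∈ diracDomain F σ →
        ⟪σ.vec c, dirac F σ (σ.op a ξ) - σ.op a (dirac F σ ξ)⟫_ℂ =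
          ⟪σ.op (star a) (dirac F σ (σ.vec c)) - dirac F σ (σ.vec (star a * c)), ξ⟫_ℂ := by
      intro ξ h1 h2
      rw [inner_sub_right, inner_sub_left, inner_vec_dirac F σ c h2, inner_op_left, star_star,
        ← inner_vec_dirac F σ _ h1, ← RegularState.op_vec, inner_op_left, star_star]
    rw [key ξ h1 h2]
    have h4 := le_of_le_on_vec σ (f := fun ξ => ‖⟪σ.op (star a) (dirac F σ (σ.vec c)) -
        dirac F σ (σ.vec (star a * c)), ξ⟫_ℂ‖) (g := fun ξ => ‖σ.vec c‖ * (r * ‖ξ‖))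
      (by fun_prop) (by fun_prop) (fun b => by
        rw [← key (σ.vec b) (vec_mem_diracDomain F σ b)
          (by rw [RegularState.op_vec]; exact vec_mem_diracDomain F σ _)]
        refine (norm_inner_le_norm _ _).trans (mul_le_mul_of_nonneg_left ?_ (norm_nonneg _))
        rw [RegularState.op_vec]
        exact h b) ξ
    refine h4.trans ?_
    rw [mul_comm r]
    exact mul_le_mul_of_nonneg_left (by nlinarith) (norm_nonneg _) |>.trans_eq (mul_comm _ _)

lemma inner_commutator {N : ℕ} {b c : A} (a : A) (hb : b ∈ F.space N) (hc : c ∈ F.space N) :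
    ⟪σ.vec c, dirac F σ (σ.vec (a * b)) - σ.op a (dirac F σ (σ.vec b))⟫_ℂ =
      ∑ p ∈ Finset.range (N + 1) ×ˢ Finset.range (N + 1), ((p.1 : ℤ) - (p.2 : ℤ) : ℤ) *
        ⟪P F σ p.1 (σ.vec c), σ.op a (P F σ p.2 (σ.vec b))⟫_ℂ := by
  have hB : ∀ η, ⟪η, σ.op a (σ.vec b)⟫_ℂ =
      ∑ n ∈ Finset.range (N + 1), ⟪η, σ.op a (P F σ n (σ.vec b))⟫_ℂ := fun η => by
    rw [← inner_sum, ← map_sum, sum_P_vec F σ hb]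
  have hC : ∀ ζ, ⟪σ.vec c, ζ⟫_ℂ =
      ∑ m ∈ Finset.range (N + 1), ⟪P F σ m (σ.vec c), ζ⟫_ℂ := fun ζ => by
    rw [← sum_inner, sum_P_vec F σ hc]
  rw [inner_sub_right, inner_vec_dirac F σ c (vec_mem_diracDomain F σ _), hC,
    ← RegularState.op_vec, dirac_vec F σ hb, dirac_vec F σ hc, sum_inner, Finset.sum_product,
    ← Finset.sum_sub_distrib]
  refine Finset.sum_congr rfl fun m _ => ?_
  rw [inner_smul_left, hB, map_sum, inner_sum, Finset.mul_sum, ← Finset.sum_sub_distrib]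
  refine Finset.sum_congr rfl fun n _ => ?_
  rw [map_smul, inner_smul_right, Complex.conj_natCast]
  push_cast
  ring

end Dirac

/-! ### Diagonals of an operator and the Lip-norm property -/

/-- Bessel's inequality for trigonometric polynomials. -/
lemma sum_norm_sq_le_of_trigPoly_le (s : Finset ℤ) (k : ℤ → ℂ) {B : ℝ}
    (h : ∀ z : ℂ, ‖z‖ = 1 → ‖∑ j ∈ s, k j * z ^ j‖ ≤ B) : ∑ j ∈ s, ‖k j‖ ^ 2 ≤ B ^ 2 := by
  have hB : 0 ≤ B := (norm_nonneg _).trans (h 1 (by simp))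
  let p : C(UnitAddCircle, ℂ) := ∑ j ∈ s, k j • fourier j
  have hp : ‖p‖ ≤ B := by
    refine (ContinuousMap.norm_le _ hB).mpr fun x => ?_
    refine le_trans (le_of_eq ?_) (h (AddCircle.toCircle x : ℂ) (Circle.norm_coe _))
    simp only [p, ContinuousMap.coe_sum, Finset.sum_apply, ContinuousMap.coe_smul, Pi.smul_apply,
      fourier_apply, smul_eq_mul, AddCircle.toCircle_zsmul, Circle.coe_zpow]
  let v := ContinuousMap.toLp (E := ℂ) 2 (AddCircle.haarAddCircle (T := (1 : ℝ))) ℂ p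
  have hv1 : v = ∑ j ∈ s, k j • fourierLp (T := (1 : ℝ)) 2 j := by
    simp only [v, p, map_sum, map_smul, fourierLp]
  have hv2 : ‖v‖ ^ 2 = ∑ j ∈ s, ‖k j‖ ^ 2 := by
    have h1 : ⟪v, v⟫_ℂ = ∑ j ∈ s, (starRingEnd ℂ) (k j) * k j := by
      rw [hv1]
      exact orthonormal_fourier.inner_sum k k s
    rw [inner_self_eq_norm_sq_to_K] at h1
    simp only [← Complex.normSq_eq_conj_mul_self, Complex.normSq_eq_norm_sq] at h1
    rw [← Complex.ofReal_sum] at h1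
    exact Complex.ofReal_injective (by simpa using h1)
  have hv3 : ‖v‖ ≤ ‖p‖ := by
    refine (ContinuousLinearMap.le_opNorm _ _).trans ?_
    refine (mul_le_mul_of_nonneg_right (ContinuousMap.toLp_norm_le _) (norm_nonneg _)).trans ?_
    simp [MeasureTheory.measureUnivNNReal]
  rw [← hv2]
  exact pow_le_pow_left₀ (norm_nonneg _) (hv3.trans hp) 2

section LipNorm

variable {A : Type*} [Ring A] [StarRing A] [Algebra ℂ A] [StarModule ℂ A]
variable (F : StarFiltration A) (σ : RegularState A)

/-- The pairing of `η` with the `j`-th diagonal `∑ P_m T P_n`, `m - n = j`, of the operator `T`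
applied to `ξ`, cut off at `m, n ≤ N`. -/
def diag (T : σ.L2 →L[ℂ] σ.L2) (N : ℕ) (η ξ : σ.L2) (j : ℤ) : ℂ :=
  ∑ p ∈ Finset.range (N + 1) ×ˢ Finset.range (N + 1) with (p.1 : ℤ) - (p.2 : ℤ) = j,
    ⟪P F σ p.1 η, T (P F σ p.2 ξ)⟫_ℂ

lemma sum_fiber_diff {E : Type*} [AddCommMonoid E] (N : ℕ) (f : ℕ × ℕ → E) :
    ∑ j ∈ Finset.Icc (-N : ℤ) N,
      ∑ p ∈ Finset.range (N + 1) ×ˢ Finset.range (N + 1) with (p.1 : ℤ) - (p.2 : ℤ) = j, f p =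
      ∑ p ∈ Finset.range (N + 1) ×ˢ Finset.range (N + 1), f p := by
  refine Finset.sum_fiberwise_of_maps_to (fun p hp => ?_) f
  simp only [Finset.mem_product, Finset.mem_range, Finset.mem_Icc] at hp ⊢
  omega

/-- The `j`-th diagonal of an operator is bounded by the largest of its blocks. -/
lemma norm_diag_le {T : σ.L2 →L[ℂ] σ.L2} {B : ℝ} (hB : 0 ≤ B)
    (h : ∀ m n ξ η, ‖⟪P F σ m η, T (P F σ n ξ)⟫_ℂ‖ ≤ B * (‖P F σ m η‖ * ‖P F σ n ξ‖))
    (N : ℕ) (η ξ : σ.L2) (j : ℤ) : ‖diag F σ T N η ξ j‖ ≤ B * (‖η‖ * ‖ξ‖) := by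
  refine (norm_sum_le _ _).trans ((Finset.sum_le_sum fun p _ => h p.1 p.2 ξ η).trans ?_)
  rw [← Finset.mul_sum]
  refine mul_le_mul_of_nonneg_left ?_ hB
  refine (Real.sum_mul_le_sqrt_mul_sqrt _ _ _).trans (mul_le_mul ?_ ?_ (Real.sqrt_nonneg _)
    (norm_nonneg _))
  · refine Real.sqrt_le_iff.mpr ⟨norm_nonneg _, le_trans ?_ (sum_norm_P_sq_le F σ (N + 1) η)⟩
    refine sum_le_sum_of_injOn_support Prod.fst (fun _ _ => sq_nonneg _)
      (fun p hp _ => ⟨(Finset.mem_product.mp (Finset.mem_filter.mp hp).1).1, le_rfl⟩) ?_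
    intro p hp q hq _ _ hpq
    have hp' := (Finset.mem_filter.mp hp).2
    have hq' := (Finset.mem_filter.mp hq).2
    exact Prod.ext hpq (by omega)
  · refine Real.sqrt_le_iff.mpr ⟨norm_nonneg _, le_trans ?_ (sum_norm_P_sq_le F σ (N + 1) ξ)⟩
    refine sum_le_sum_of_injOn_support Prod.snd (fun _ _ => sq_nonneg _)
      (fun p hp _ => ⟨(Finset.mem_product.mp (Finset.mem_filter.mp hp).1).2, le_rfl⟩) ?_
    intro p hp q hq _ _ hpq
    have hp' := (Finset.mem_filter.mp hp).2
    have hq' := (Finset.mem_filter.mp hq).2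
    exact Prod.ext (by omega) hpq

lemma inner_eq_sum_diag {N : ℕ} {b c : A} (T : σ.L2 →L[ℂ] σ.L2) (hb : b ∈ F.space N)
    (hc : c ∈ F.space N) :
    ⟪σ.vec c, T (σ.vec b)⟫_ℂ =
      ∑ j ∈ Finset.Icc (-N : ℤ) N, diag F σ T N (σ.vec c) (σ.vec b) j := by
  unfold diag
  rw [sum_fiber_diff]
  conv_lhs => rw [← sum_P_vec F σ hb, ← sum_P_vec F σ hc]
  rw [sum_inner, Finset.sum_product]
  simp only [map_sum, inner_sum]

lemma inner_commutator_eq_sum_diag {N : ℕ} {b c : A} (a : A) (hb : b ∈ F.space N)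
    (hc : c ∈ F.space N) :
    ⟪σ.vec c, dirac F σ (σ.vec (a * b)) - σ.op a (dirac F σ (σ.vec b))⟫_ℂ =
      ∑ j ∈ Finset.Icc (-N : ℤ) N, j * diag F σ (σ.op a) N (σ.vec c) (σ.vec b) j := by
  rw [inner_commutator F σ a hb hc, ← sum_fiber_diff]
  refine Finset.sum_congr rfl fun j _ => ?_
  rw [diag, Finset.mul_sum]
  refine Finset.sum_congr rfl fun p hp => ?_
  rw [(Finset.mem_filter.mp hp).2]

/-- The sum `∑ z^k a_k`, as an element of the algebra. -/
def twist (z : ℂ) (N : ℕ) (a : A) : A := ∑ k ∈ Finset.range (N + 1), z ^ k • comp F σ k a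

lemma twist_mem (z : ℂ) (N : ℕ) (a : A) : twist F σ z N a ∈ F.space N :=
  sum_mem fun k hk => Submodule.smul_mem _ _
    (F.mono _ _ (Nat.lt_succ_iff.mp (Finset.mem_range.mp hk)) (comp_mem F σ k a))

lemma P_twist (z : ℂ) {N k : ℕ} (h : k ≤ N) (a : A) :
    P F σ k (σ.vec (twist F σ z N a)) = z ^ k • P F σ k (σ.vec a) := by
  simp only [twist, map_sum, map_smul, vec_comp]
  rw [Finset.sum_eq_single_of_mem k (Finset.mem_range.mpr (Nat.lt_succ_iff.mpr h))
    fun l _ hl => by rw [P_P_of_ne F σ hl.symm, smul_zero], P_P_self]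

lemma norm_twist_le {z : ℂ} (hz : ‖z‖ = 1) (N : ℕ) (a : A) :
    ‖σ.vec (twist F σ z N a)‖ ≤ ‖σ.vec a‖ := by
  refine (sq_le_sq₀ (norm_nonneg _) (norm_nonneg _)).mp ?_
  refine le_trans (le_of_eq ?_) (sum_norm_P_sq_le F σ (N + 1) (σ.vec a))
  rw [← sum_P_vec F σ (twist_mem F σ z N a), norm_sum_P_sq F σ _ fun _ => _]
  refine Finset.sum_congr rfl fun k hk => ?_
  rw [P_twist F σ z (Nat.lt_succ_iff.mp (Finset.mem_range.mp hk)), norm_smul, norm_pow, hz,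
    one_pow, one_mul]

lemma diag_twist {z : ℂ} (hz : ‖z‖ = 1) (T : σ.L2 →L[ℂ] σ.L2) (N : ℕ) (c b : A) (j : ℤ) :
    diag F σ T N (σ.vec (twist F σ z N c)) (σ.vec (twist F σ z N b)) j =
      diag F σ T N (σ.vec c) (σ.vec b) j * ((starRingEnd ℂ) z) ^ j := by
  have hz0 : z ≠ 0 := by
    rintro rfl
    simp at hz
  have hz1 : (starRingEnd ℂ) z = z⁻¹ := by
    rw [Complex.inv_def, Complex.normSq_eq_norm_sq, hz]
    simp
  unfold diag
  rw [Finset.sum_mul]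
  refine Finset.sum_congr rfl fun p hp => ?_
  simp only [Finset.mem_filter, Finset.mem_product, Finset.mem_range] at hp
  rw [P_twist F σ z (by omega), P_twist F σ z (by omega), map_smul, inner_smul_left,
    inner_smul_right, map_pow, ← hp.2, hz1, zpow_sub₀ (inv_ne_zero hz0), zpow_natCast,
    zpow_natCast, inv_pow, inv_pow]
  field_simp

/-- The diagonals of `[D, a]` are `j` times those of `a`, and they are square-summable. -/
lemma LipBound.sum_diag_sq_le {a : A} {r : ℝ} (h : LipBound F σ a r) (hr : 0 ≤ r) (N : ℕ)
    (b c : A) :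
    ∑ j ∈ Finset.Icc (-N : ℤ) N, ‖(j : ℂ) * diag F σ (σ.op a) N (σ.vec c) (σ.vec b) j‖ ^ 2 ≤
      (r * (‖σ.vec c‖ * ‖σ.vec b‖)) ^ 2 := by
  refine sum_norm_sq_le_of_trigPoly_le _ _ fun z hz => ?_
  have hz' : ‖(starRingEnd ℂ) z‖ = 1 := by rw [RCLike.norm_conj, hz]
  have h1 := inner_commutator_eq_sum_diag F σ a (twist_mem F σ ((starRingEnd ℂ) z) N b)
    (twist_mem F σ ((starRingEnd ℂ) z) N c)
  simp only [diag_twist F σ hz', Complex.conj_conj, ← mul_assoc] at h1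
  rw [← h1]
  refine (norm_inner_le_norm _ _).trans ((mul_le_mul (norm_twist_le F σ hz' N c)
    ((h _).trans (mul_le_mul_of_nonneg_left (norm_twist_le F σ hz' N b) hr)) (norm_nonneg _)
    (norm_nonneg _)).trans_eq (by ring))

lemma LipBound.sum_comp_sq_le {a : A} {r : ℝ} (h : LipBound F σ a r) (N : ℕ) :
    ∑ k ∈ Finset.range N, ((k : ℝ) * ‖P F σ k (σ.vec a)‖) ^ 2 ≤ r ^ 2 := by
  have h1 := h 1
  have hone : (1 : A) ∈ F.space 0 := by
    rw [F.zero]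
    exact Submodule.mem_span_singleton_self 1
  rw [mul_one, dirac_vec F σ hone, Finset.sum_range_one, Nat.cast_zero, zero_smul, map_zero,
    sub_zero, norm_vec_one, mul_one] at h1
  obtain ⟨M, ha⟩ := F.exhaust a
  have h2 := norm_sum_P_sq F σ (Finset.range (M + 1)) fun k => (k : ℂ) • σ.vec a
  simp only [map_smul, ← dirac_vec F σ ha, norm_smul, Complex.norm_natCast] at h2
  calc _ ≤ ∑ k ∈ Finset.range (M + 1), ((k : ℝ) * ‖P F σ k (σ.vec a)‖) ^ 2 := by
        refine sum_le_sum_of_injOn_support id (fun _ _ => sq_nonneg _) (fun k _ h0 => ⟨?_, le_rfl⟩)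
          fun _ _ _ _ _ _ h => h
        by_contra hk
        rw [P_vec_of_lt F σ (by simpa using hk) ha] at h0
        simp at h0
    _ = _ := h2.symm
    _ ≤ _ := pow_le_pow_left₀ (norm_nonneg _) h1 2

lemma norm_op_le_of_inner_le {T : σ.L2 →L[ℂ] σ.L2} {R : ℝ} (hR : 0 ≤ R)
    (h : ∀ b c, ‖⟪σ.vec c, T (σ.vec b)⟫_ℂ‖ ≤ R * (‖σ.vec c‖ * ‖σ.vec b‖)) : ‖T‖ ≤ R := by
  refine T.opNorm_le_bound hR fun ξ => ?_
  refine le_of_le_on_vec σ (f := fun ξ => ‖T ξ‖) (g := fun ξ => R * ‖ξ‖) (by fun_prop)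
    (by fun_prop) (fun b => norm_le_of_inner_vec_le σ fun c => (h b c).trans_eq (by ring)) ξ

lemma exists_finset_sum_inv_sq_lt {ι : Type*} [DecidableEq ι] {f : ι → ℝ} (hf : Summable f)
    (hf0 : ∀ i, 0 ≤ f i) (i₀ : ι) {ε : ℝ} (hε : 0 < ε) :
    ∃ S : Finset ι, i₀ ∈ S ∧ ∀ t, Disjoint t S → ∑ i ∈ t, f i < ε := by
  obtain ⟨S, hS⟩ := summable_iff_vanishing_norm.mp hf ε hε
  refine ⟨insert i₀ S, Finset.mem_insert_self _ _, fun t ht => ?_⟩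
  have := hS t (ht.mono_right (Finset.subset_insert _ _))
  rwa [Real.norm_of_nonneg (Finset.sum_nonneg fun i _ => hf0 i)] at this

/-- If `∑ (j u_j)²` is at most `B²` and `∑ 1/j²` is small, then `∑ u_j` is small. -/
lemma sum_le_of_sum_mul_sq_le {ι : Type*} (t : Finset ι) (w u : ι → ℝ) (hw : ∀ i ∈ t, w i ≠ 0)
    {δ B : ℝ} (hδ : 0 ≤ δ) (hB : 0 ≤ B) (h1 : ∑ i ∈ t, 1 / w i ^ 2 ≤ δ ^ 2)
    (h2 : ∑ i ∈ t, (w i * u i) ^ 2 ≤ B ^ 2) : ∑ i ∈ t, u i ≤ δ * B := by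
  have h3 := Real.sum_mul_le_sqrt_mul_sqrt t (fun i => 1 / w i) fun i => w i * u i
  have h4 : ∑ i ∈ t, u i = ∑ i ∈ t, 1 / w i * (w i * u i) :=
    Finset.sum_congr rfl fun i hi => by
      have := hw i hi
      field_simp
  rw [h4]
  refine h3.trans (mul_le_mul ?_ ?_ (Real.sqrt_nonneg _) hδ)
  · refine Real.sqrt_le_iff.mpr ⟨hδ, ?_⟩
    simpa only [div_pow, one_pow] using h1
  · exact Real.sqrt_le_iff.mpr ⟨hB, h2⟩

/-- The operator norm of `a` is controlled by a small multiple of `L(a)` and finitely many of the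
norms `‖a_k‖₂`. -/
lemma HaagerupType.norm_op_le {C : ℝ} (hC : HaagerupType F σ C) {ε : ℝ} (hε : 0 < ε) :
    ∃ (K : Finset ℕ) (M : ℝ), 0 ≤ M ∧ ∀ (a : A) (r : ℝ), 0 ≤ r → LipBound F σ a r →
      ‖σ.op a‖ ≤ ε * r + M * ∑ k ∈ K, ‖P F σ k (σ.vec a)‖ := by
  have hC0 : 0 ≤ C := zero_le_one.trans hC.one_le
  obtain ⟨S, hS0, hS⟩ := exists_finset_sum_inv_sq_lt
    (Real.summable_one_div_int_pow.mpr one_lt_two) (fun j => by positivity) 0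
    (show 0 < (ε / 2) ^ 2 by positivity)
  set δ : ℝ := ε / 2 / (S.card * C + 1) with hδ
  have hδ0 : 0 < δ := by positivity
  obtain ⟨K, hK0, hK⟩ := exists_finset_sum_inv_sq_lt
    (Real.summable_one_div_nat_pow.mpr one_lt_two) (fun j => by positivity) 0
    (show 0 < δ ^ 2 by positivity)
  refine ⟨K, S.card * C, by positivity, fun a r hr ha => ?_⟩
  obtain ⟨M, hM⟩ := F.exhaust a
  set s₁ := ∑ k ∈ K, ‖P F σ k (σ.vec a)‖
  have hs₁ : 0 ≤ s₁ := Finset.sum_nonneg fun _ _ => norm_nonneg _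
  have hsum : ∑ k ∈ Finset.range (M + 1), ‖P F σ k (σ.vec a)‖ ≤ s₁ + δ * r := by
    rw [← Finset.sum_inter_add_sum_sdiff _ K]
    refine add_le_add (Finset.sum_le_sum_of_subset_of_nonneg Finset.inter_subset_right
      fun _ _ _ => norm_nonneg _) ?_
    refine sum_le_of_sum_mul_sq_le _ (fun k : ℕ => (k : ℝ)) _ (fun k hk => ?_) hδ0.le hr
      (hK _ Finset.sdiff_disjoint).le ?_
    · intro h0
      have : k = 0 := by exact_mod_cast h0
      exact (Finset.mem_sdiff.mp hk).2 (this ▸ hK0)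
    · exact (Finset.sum_le_sum_of_subset_of_nonneg Finset.sdiff_subset
        fun _ _ _ => sq_nonneg _).trans (ha.sum_comp_sq_le F σ (M + 1))
  have hblock : ∀ m n ξ η, ‖⟪P F σ m η, σ.op a (P F σ n ξ)⟫_ℂ‖ ≤
      C * (s₁ + δ * r) * (‖P F σ m η‖ * ‖P F σ n ξ‖) := by
    intro m n ξ η
    have h1 : ⟪P F σ m η, σ.op a (P F σ n ξ)⟫_ℂ = ∑ k ∈ Finset.range (M + 1),
        ⟪P F σ m η, (P F σ m ∘L σ.op (comp F σ k a) ∘L P F σ n) (P F σ n ξ)⟫_ℂ := by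
      conv_lhs => rw [← sum_comp F σ hM, ← opLin_apply, map_sum]
      simp only [sum_apply, inner_sum, opLin_apply]
      refine Finset.sum_congr rfl fun k _ => ?_
      simp only [ContinuousLinearMap.comp_apply]
      rw [← inner_P_left, P_P_self, P_P_self]
    rw [h1]
    refine (norm_sum_le _ _).trans ((Finset.sum_le_sum
      (g := fun k => C * ‖P F σ k (σ.vec a)‖ * (‖P F σ m η‖ * ‖P F σ n ξ‖)) fun k _ => ?_).trans ?_)
    · refine (norm_inner_le_norm _ _).trans ?_
      have h2 := ContinuousLinearMap.le_of_opNorm_le _ (hC a k m n) (P F σ n ξ)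
      rw [vec_comp] at h2
      nlinarith [norm_nonneg (P F σ m η)]
    · rw [← Finset.sum_mul, ← Finset.mul_sum]
      exact mul_le_mul_of_nonneg_right (mul_le_mul_of_nonneg_left hsum hC0) (by positivity)
  -- The diagonals in the finite set `S` are bounded by the blocks of `a`, and the others are small
  -- by the square-summability of the diagonals of `[D, a]`.
  refine norm_op_le_of_inner_le σ (by positivity) fun b c => ?_
  obtain ⟨N₁, hb⟩ := F.exhaust b
  obtain ⟨N₂, hc⟩ := F.exhaust c
  set N := max N₁ N₂
  have hb := F.mono _ _ (le_max_left N₁ N₂) hb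
  have hc := F.mono _ _ (le_max_right N₁ N₂) hc
  rw [inner_eq_sum_diag F σ _ hb hc]
  set X := ‖σ.vec c‖ * ‖σ.vec b‖
  have hX : 0 ≤ X := by positivity
  set d := diag F σ (σ.op a) N (σ.vec c) (σ.vec b)
  have hd : ∀ j, ‖d j‖ ≤ C * (s₁ + δ * r) * X := fun j =>
    norm_diag_le F σ (by positivity) hblock N _ _ j
  have hin : ∑ j ∈ Finset.Icc (-N : ℤ) N ∩ S, ‖d j‖ ≤ S.card * (C * (s₁ + δ * r) * X) := by
    refine (Finset.sum_le_card_nsmul _ _ _ fun j _ => hd j).trans ?_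
    rw [nsmul_eq_mul]
    refine mul_le_mul_of_nonneg_right ?_ (by positivity)
    exact_mod_cast Finset.card_le_card Finset.inter_subset_right
  have hout : ∑ j ∈ Finset.Icc (-N : ℤ) N \ S, ‖d j‖ ≤ ε / 2 * (r * X) := by
    refine sum_le_of_sum_mul_sq_le _ (fun j : ℤ => (j : ℝ)) _ (fun j hj => ?_) (by positivity)
      (by positivity) (hS _ Finset.sdiff_disjoint).le ?_
    · intro h0
      have : j = 0 := by exact_mod_cast h0
      exact (Finset.mem_sdiff.mp hj).2 (this ▸ hS0)
    · refine le_trans ?_ (ha.sum_diag_sq_le F σ hr N b c)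
      refine (Finset.sum_le_sum_of_subset_of_nonneg Finset.sdiff_subset
        fun _ _ _ => sq_nonneg _).trans_eq (Finset.sum_congr rfl fun j _ => ?_)
      rw [norm_mul, Complex.norm_intCast, mul_pow, mul_pow, sq_abs]
  have hδC : S.card * C * δ ≤ ε / 2 := by
    rw [hδ, mul_div_assoc', div_le_iff₀ (by positivity)]
    nlinarith
  refine (norm_sum_le _ _).trans ?_
  rw [← Finset.sum_inter_add_sum_sdiff _ S]
  have : S.card * C * δ * (r * X) ≤ ε / 2 * (r * X) :=
    mul_le_mul_of_nonneg_right hδC (by positivity)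
  nlinarith

variable {F σ} in
lemma LipBound.add {a b : A} {r s : ℝ} (ha : LipBound F σ a r) (hb : LipBound F σ b s) :
    LipBound F σ (a + b) (r + s) := fun c => by
  have h : dirac F σ (σ.vec ((a + b) * c)) - σ.op (a + b) (dirac F σ (σ.vec c)) =
      (dirac F σ (σ.vec (a * c)) - σ.op a (dirac F σ (σ.vec c))) +
        (dirac F σ (σ.vec (b * c)) - σ.op b (dirac F σ (σ.vec c))) := by
    rw [add_mul, dirac_vec_add, op_add, add_apply]
    abel
  rw [h, add_mul]
  exact (norm_add_le _ _).trans (add_le_add (ha c) (hb c))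

variable {F σ} in
lemma LipBound.smul {a : A} {r : ℝ} (c : ℂ) (ha : LipBound F σ a r) :
    LipBound F σ (c • a) (‖c‖ * r) := fun b => by
  rw [smul_mul_assoc, map_smul, dirac_smul, op_smul, smul_apply, ← smul_sub,
    norm_smul, mul_assoc]
  exact mul_le_mul_of_nonneg_left (ha b) (norm_nonneg c)

lemma lipBound_one : LipBound F σ 1 0 := fun b => by
  have h : σ.op 1 = ContinuousLinearMap.id ℂ σ.L2 := by
    ext ξ
    exact eq_of_eq_on_vec σ (σ.op 1).continuous continuous_id
      (fun c => by rw [RegularState.op_vec, one_mul, id]) ξ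
  simp [h]

/-- An element of `A_k` only has the diagonals `|j| ≤ k`, so its commutator with `D` is bounded. -/
lemma exists_lipBound (a : A) : ∃ r : ℝ, 0 ≤ r ∧ LipBound F σ a r := by
  obtain ⟨k, hk⟩ := F.exhaust a
  set r : ℝ := ∑ j ∈ Finset.Icc (-k : ℤ) k, |(j : ℝ)| * ‖σ.op a‖
  have hr : 0 ≤ r := Finset.sum_nonneg fun _ _ => by positivity
  have hsupp : ∀ (a : A), a ∈ F.space k → ∀ (m n : ℕ) (ξ η : σ.L2), n + k < m →
      ⟪P F σ m η, σ.op a (P F σ n ξ)⟫_ℂ = 0 := by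
    intro a ha m n ξ η h
    obtain ⟨b, hb, hbv⟩ := P_apply_mem F σ n ξ
    rw [← hbv, RegularState.op_vec, inner_P_left, P_vec_of_lt F σ h, inner_zero_right]
    rw [add_comm]
    exact F.mul_mem _ _ a ha b hb
  refine ⟨r, hr, fun b => norm_le_of_inner_vec_le σ fun c => ?_⟩
  obtain ⟨N₁, hb⟩ := F.exhaust b
  obtain ⟨N₂, hc⟩ := F.exhaust c
  set N := max N₁ N₂
  rw [inner_commutator_eq_sum_diag F σ a (F.mono _ _ (le_max_left N₁ N₂) hb)
    (F.mono _ _ (le_max_right N₁ N₂) hc)]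
  refine (norm_sum_le _ _).trans ?_
  have hd : ∀ j, ‖diag F σ (σ.op a) N (σ.vec c) (σ.vec b) j‖ ≤
      ‖σ.op a‖ * (‖σ.vec c‖ * ‖σ.vec b‖) := fun j => by
    refine norm_diag_le F σ (norm_nonneg _) (fun m n ξ η => ?_) N _ _ j
    refine (norm_inner_le_norm _ _).trans ?_
    nlinarith [(σ.op a).le_opNorm (P F σ n ξ), norm_nonneg (P F σ m η)]
  have h0 : ∀ j : ℤ, j ∉ Finset.Icc (-k : ℤ) k →
      diag F σ (σ.op a) N (σ.vec c) (σ.vec b) j = 0 := fun j hj => by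
    refine Finset.sum_eq_zero fun p hp => ?_
    have hp := (Finset.mem_filter.mp hp).2
    rw [Finset.mem_Icc, not_and_or, not_le, not_le] at hj
    rcases hj with hj | hj
    · rw [← inner_conj_symm, inner_op_left, hsupp _ (F.star_mem k a hk) _ _ _ _ (by omega),
        map_zero]
    · exact hsupp a hk _ _ _ _ (by omega)
  refine (sum_le_sum_of_injOn_support (t := Finset.Icc (-k : ℤ) k)
    (g := fun j : ℤ => |(j : ℝ)| * ‖σ.op a‖ * (‖σ.vec c‖ * ‖σ.vec b‖)) id
    (fun _ _ => by positivity) (fun j _ hj => ⟨?_, ?_⟩) fun _ _ _ _ _ _ h => h).trans ?_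
  · by_contra hjk
    exact hj (by rw [h0 j hjk]; simp)
  · rw [norm_mul, Complex.norm_intCast, mul_assoc]
    exact mul_le_mul_of_nonneg_left (hd j) (abs_nonneg _)
  · rw [← Finset.sum_mul]
    exact le_of_eq (by ring)

lemma lipSeminorm_ne_top (a : A) : lipSeminorm F σ a ≠ ∞ := by
  obtain ⟨r, hr, h⟩ := exists_lipBound F σ a
  exact ne_top_of_le_ne_top ENNReal.ofReal_ne_top ((lipSeminorm_le_iff F σ a hr).mpr h)

lemma lipBound_toReal (a : A) : LipBound F σ a (lipSeminorm F σ a).toReal :=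
  (lipSeminorm_le_iff F σ a ENNReal.toReal_nonneg).mp
    (ENNReal.ofReal_toReal (lipSeminorm_ne_top F σ a)).ge

lemma lipSeminorm_add_le (a b : A) :
    lipSeminorm F σ (a + b) ≤ lipSeminorm F σ a + lipSeminorm F σ b := by
  have h := (lipSeminorm_le_iff F σ (a + b) (by positivity)).mpr
    ((lipBound_toReal F σ a).add (lipBound_toReal F σ b))
  rwa [ENNReal.ofReal_add ENNReal.toReal_nonneg ENNReal.toReal_nonneg,
    ENNReal.ofReal_toReal (lipSeminorm_ne_top F σ a),
    ENNReal.ofReal_toReal (lipSeminorm_ne_top F σ b)] at h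

lemma lipSeminorm_smul_le (c : ℂ) (a : A) :
    lipSeminorm F σ (c • a) ≤ ‖c‖ₑ * lipSeminorm F σ a := by
  have h := (lipSeminorm_le_iff F σ (c • a) (by positivity)).mpr
    ((lipBound_toReal F σ a).smul c)
  rwa [ENNReal.ofReal_mul (norm_nonneg c), ofReal_norm,
    ENNReal.ofReal_toReal (lipSeminorm_ne_top F σ a)] at h

lemma lipSeminorm_smul (c : ℂ) (a : A) :
    lipSeminorm F σ (c • a) = ‖c‖ₑ * lipSeminorm F σ a := by
  refine le_antisymm (lipSeminorm_smul_le F σ c a) ?_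
  by_cases hc : c = 0
  · simp [hc]
  · have h := lipSeminorm_smul_le F σ c⁻¹ (c • a)
    rw [smul_smul, inv_mul_cancel₀ hc, one_smul] at h
    refine (mul_le_mul_right h ‖c‖ₑ).trans_eq ?_
    rw [← mul_assoc, ← enorm_mul, mul_inv_cancel₀ hc, enorm_one, one_mul]

lemma lipSeminorm_eq_zero_iff (a : A) :
    lipSeminorm F σ a = 0 ↔ a ∈ Submodule.span ℂ {(1 : A)} := by
  constructor
  · intro h
    have h1 : LipBound F σ a 0 := by simpa [h] using lipBound_toReal F σ a
    obtain ⟨N, hN⟩ := F.exhaust a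
    have h2 := h1.sum_comp_sq_le F σ (N + 1)
    rw [zero_pow two_ne_zero] at h2
    have h3 := (Finset.sum_eq_zero_iff_of_nonneg fun _ _ => sq_nonneg _).mp
      (le_antisymm h2 (Finset.sum_nonneg fun _ _ => sq_nonneg _))
    rw [← F.zero, ← vec_mem_spaceL2 F σ, ← sum_P_vec F σ hN]
    refine sum_mem fun k hk => ?_
    rcases Nat.eq_zero_or_pos k with rfl | hk0
    · exact P_apply_mem F σ 0 _
    · have h4 := h3 k hk
      have h5 : (k : ℝ) ≠ 0 := by exact_mod_cast hk0.ne'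
      have h6 : P F σ k (σ.vec a) = 0 := by
        simpa [h5] using h4
      rw [h6]
      exact zero_mem _
  · intro h
    obtain ⟨c, rfl⟩ := Submodule.mem_span_singleton.mp h
    have h1 : lipSeminorm F σ 1 = 0 := by
      simpa using (lipSeminorm_le_iff F σ 1 le_rfl).mpr (lipBound_one F σ)
    rw [lipSeminorm_smul, h1, mul_zero]

lemma P_zero_vec {a : A} (h : σ.toLin a = 0) : P F σ 0 (σ.vec a) = 0 := by
  obtain ⟨b, hb, hbv⟩ := P_apply_mem F σ 0 (σ.vec a)
  rw [F.zero] at hb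
  obtain ⟨c, rfl⟩ := Submodule.mem_span_singleton.mp hb
  rw [← inner_self_eq_zero (𝕜 := ℂ), inner_P_left, P_P_self]
  rw [← inner_conj_symm]
  rw [← hbv, map_smul, inner_smul_left, RegularState.inner_vec, star_one, one_mul, h]
  simp

lemma norm_vec_le {a : A} (h : σ.toLin a = 0) {r : ℝ} (hr : 0 ≤ r) (ha : LipBound F σ a r) :
    ‖σ.vec a‖ ≤ r := by
  obtain ⟨N, hN⟩ := F.exhaust a
  refine (sq_le_sq₀ (norm_nonneg _) hr).mp (le_trans ?_ (ha.sum_comp_sq_le F σ (N + 1)))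
  conv_lhs => rw [← sum_P_vec F σ hN]
  rw [norm_sum_P_sq F σ _ fun _ => σ.vec a]
  refine Finset.sum_le_sum fun k _ => ?_
  rcases Nat.eq_zero_or_pos k with rfl | hk
  · rw [P_zero_vec F σ h]
    simp
  · have : (1 : ℝ) ≤ k := by exact_mod_cast hk
    exact pow_le_pow_left₀ (norm_nonneg _)
      (le_mul_of_one_le_left (norm_nonneg _) this) 2

/-- The elements with `L(a) ≤ 1` and `σ(a) = 0` are totally bounded in the operator norm. -/
lemma HaagerupType.exists_finite_net {C : ℝ} (hC : HaagerupType F σ C) {ε : ℝ} (hε : 0 < ε) :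
    ∃ t : Set A, t.Finite ∧ ∀ a, σ.toLin a = 0 → LipBound F σ a 1 →
      ∃ b ∈ t, ‖σ.op (a - b)‖ < ε := by
  obtain ⟨K, M, hM, hK⟩ := hC.norm_op_le F σ (show 0 < ε / 4 by positivity)
  set S : Set A := {a | σ.toLin a = 0 ∧ LipBound F σ a 1}
  set N := K.sup id
  set δ : ℝ := ε / 4 / (M * K.card + 1)
  have hδ : 0 < δ := by positivity
  let g : A → spaceL2 F σ N := fun a => ⟨Q F σ N (σ.vec a), Q_apply_mem F σ N _⟩
  have hbdd : TotallyBounded (g '' S) := by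
    refine (isCompact_closedBall (0 : spaceL2 F σ N) 1).totallyBounded.subset ?_
    rintro _ ⟨a, ha, rfl⟩
    rw [mem_closedBall_zero_iff]
    exact (norm_Q_le F σ N _).trans (norm_vec_le F σ ha.1 zero_le_one ha.2)
  obtain ⟨t', ht', hfin, hcov⟩ := Metric.finite_approx_of_totallyBounded hbdd δ hδ
  obtain ⟨t, htS, htfin, rfl⟩ := Set.exists_subset_image_finite_and (p := fun x => x = t') |>.mp
    ⟨t', ht', hfin, rfl⟩
  refine ⟨t, htfin, fun a ha0 ha => ?_⟩
  obtain ⟨_, ⟨b, hb, rfl⟩, hab⟩ := Set.mem_iUnion₂.mp (hcov ⟨a, ⟨ha0, ha⟩, rfl⟩)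
  refine ⟨b, hb, ?_⟩
  have hL : LipBound F σ (a - b) 2 := by
    have := ha.add ((htS hb).2.smul (-1))
    norm_num at this
    rwa [sub_eq_add_neg]
  have hab' : ‖Q F σ N (σ.vec (a - b))‖ < δ := by
    rw [Metric.mem_ball, dist_eq_norm] at hab
    rw [map_sub, map_sub]
    exact hab
  have hP : ∀ k ∈ K, ‖P F σ k (σ.vec (a - b))‖ ≤ δ := fun k hk => by
    have h1 : P F σ k (σ.vec (a - b)) = P F σ k (Q F σ N (σ.vec (a - b))) := by
      have hkN : k ≤ N := Finset.le_sup (f := id) hk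
      cases k with
      | zero => exact (Q_Q_of_ge F σ hkN _).symm
      | succ k => simp only [P, sub_apply, Q_Q_of_ge F σ hkN,
          Q_Q_of_ge F σ (Nat.le_of_succ_le hkN)]
    rw [h1]
    exact (norm_P_le F σ k _).trans hab'.le
  have h1 := hK (a - b) 2 zero_le_two hL
  have h2 : ∑ k ∈ K, ‖P F σ k (σ.vec (a - b))‖ ≤ K.card * δ := by
    simpa using Finset.sum_le_card_nsmul _ _ _ hP
  have h3 : M * (K.card * δ) ≤ ε / 4 := by
    rw [← mul_assoc, mul_div_assoc', div_le_iff₀ (by positivity)]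
    nlinarith
  have h4 := mul_le_mul_of_nonneg_left h2 hM
  linarith

lemma enorm_sub_le_rho (φ ψ : StateSpace σ) (a : A) :
    ‖ψ.1 a - φ.1 a‖ₑ ≤ (lipSeminorm F σ a + 1) * rho σ (lipSeminorm F σ) φ ψ := by
  have hL := lipSeminorm_ne_top F σ a
  set t : ℝ := (lipSeminorm F σ a).toReal + 1 with ht
  have ht0 : 0 < t := by positivity
  have hte : ‖(t : ℂ)‖ₑ = lipSeminorm F σ a + 1 := by
    rw [← ofReal_norm, Complex.norm_real, Real.norm_of_nonneg ht0.le, ht,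
      ENNReal.ofReal_add ENNReal.toReal_nonneg zero_le_one, ENNReal.ofReal_toReal hL,
      ENNReal.ofReal_one]
  have htc : (t : ℂ) ≠ 0 := by exact_mod_cast ht0.ne'
  have hb : lipSeminorm F σ ((t : ℂ)⁻¹ • a) ≤ 1 := by
    rw [lipSeminorm_smul, enorm_inv htc, hte, mul_comm, ← div_eq_mul_inv]
    exact ENNReal.div_le_of_le_mul (by rw [one_mul]; exact le_self_add)
  have h1 : ‖φ.1 ((t : ℂ)⁻¹ • a) - ψ.1 ((t : ℂ)⁻¹ • a)‖ₑ ≤ rho σ (lipSeminorm F σ) φ ψ :=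
    le_iSup₂_of_le (f := fun (a : A) (_ : lipSeminorm F σ a ≤ 1) => ‖φ.1 a - ψ.1 a‖ₑ) _ hb le_rfl
  rw [← hte, ← enorm_neg, neg_sub]
  calc ‖φ.1 a - ψ.1 a‖ₑ = ‖(t : ℂ) * (φ.1 ((t : ℂ)⁻¹ • a) - ψ.1 ((t : ℂ)⁻¹ • a))‖ₑ := by
        rw [map_smul, map_smul, smul_eq_mul, smul_eq_mul, ← mul_sub, mul_inv_cancel_left₀ htc]
    _ ≤ _ := by
        rw [enorm_mul]
        exact mul_le_mul_right h1 _

lemma HaagerupType.tendsto_rho {C : ℝ} (hC : HaagerupType F σ C) (φ : StateSpace σ) :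
    Filter.Tendsto (rho σ (lipSeminorm F σ) φ) (@nhds _ (weakStar σ) φ) (𝓝 0) := by
  let := weakStar σ
  have hcont : ∀ a, Continuous fun ψ : StateSpace σ => ψ.1 a := fun a =>
    (continuous_apply a).comp continuous_induced_dom
  refine ENNReal.tendsto_nhds_zero.mpr fun ε' hε' => ?_
  obtain ⟨ε, hε0, hεε⟩ := ENNReal.lt_iff_exists_nnreal_btwn.mp hε'
  have hε : (0 : ℝ) < ε := by exact_mod_cast hε0
  obtain ⟨t, htfin, ht⟩ := hC.exists_finite_net F σ (show 0 < (ε : ℝ) / 3 by positivity)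
  have hev : ∀ᶠ ψ in 𝓝 φ, ∀ b ∈ t, ‖ψ.1 b - φ.1 b‖ < (ε : ℝ) / 3 := by
    refine (Filter.eventually_all_finite htfin).mpr fun b _ => ?_
    have := (Metric.tendsto_nhds.mp ((hcont b).tendsto φ)) (ε / 3) (by positivity)
    simpa only [dist_eq_norm] using this
  filter_upwards [hev] with ψ hψ
  refine le_trans (iSup₂_le fun a ha => ?_) hεε.le
  -- Subtracting `σ(a)` from `a` changes neither `L(a)` nor `φ(a) - ψ(a)`.
  set a' : A := a - σ.toLin a • 1
  have ha'0 : σ.toLin a' = 0 := by simp [a', σ.map_one]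
  have ha' : LipBound F σ a' 1 := by
    have h1 := (lipSeminorm_le_iff F σ a zero_le_one).mp (by simpa using ha)
    have h2 := h1.add ((lipBound_one F σ).smul (-σ.toLin a))
    rw [mul_zero, add_zero, neg_smul, ← sub_eq_add_neg] at h2
    exact h2
  have haa : φ.1 a - ψ.1 a = φ.1 a' - ψ.1 a' := by simp [a', φ.2.1, ψ.2.1]
  obtain ⟨b, hb, hab⟩ := ht a' ha'0 ha'
  have h1 := φ.2.2 (a' - b)
  have h2 := ψ.2.2 (a' - b)
  have h3 := hψ b hb
  have h4 : φ.1 a' - ψ.1 a' = φ.1 (a' - b) - ψ.1 (a' - b) - (ψ.1 b - φ.1 b) := by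
    simp only [map_sub]
    ring
  have h5 : ‖φ.1 a - ψ.1 a‖ ≤ ε := by
    rw [haa, h4]
    have := norm_sub_le (φ.1 (a' - b) - ψ.1 (a' - b)) (ψ.1 b - φ.1 b)
    have := norm_sub_le (φ.1 (a' - b)) (ψ.1 (a' - b))
    linarith
  rw [← ofReal_norm]
  exact (ENNReal.ofReal_le_ofReal h5).trans_eq ENNReal.ofReal_coe_nnreal

/-- The filtered algebras with the Haagerup-type condition are compact quantum metric spaces. -/
lemma HaagerupType.isLipNorm {C : ℝ} (hC : HaagerupType F σ C) :
    IsLipNorm σ (lipSeminorm F σ) where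
  finite := lipSeminorm_ne_top F σ
  add_le := lipSeminorm_add_le F σ
  smul_eq := lipSeminorm_smul F σ
  eq_zero_iff := lipSeminorm_eq_zero_iff F σ
  isOpen_iff U := by
    let := weakStar σ
    have hnhds : ∀ φ : StateSpace σ,
        𝓝 φ = Filter.comap (rho σ (lipSeminorm F σ) φ) (𝓝 0) := by
      intro φ
      refine le_antisymm (hC.tendsto_rho F σ φ).le_comap ?_
      rw [nhds_induced, ← Filter.tendsto_iff_comap, tendsto_pi_nhds]
      intro a
      rw [tendsto_iff_edist_tendsto_0]
      simp only [edist_eq_enorm_sub]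
      refine tendsto_of_tendsto_of_tendsto_of_le_of_le tendsto_const_nhds ?_
        (fun _ => zero_le) fun ψ => enorm_sub_le_rho F σ φ ψ a
      have := ENNReal.Tendsto.const_mul (a := lipSeminorm F σ a + 1)
        (Filter.tendsto_comap (f := rho σ (lipSeminorm F σ) φ) (x := 𝓝 0))
        (Or.inr (by simpa using lipSeminorm_ne_top F σ a))
      rwa [mul_zero] at this
    rw [isOpen_iff_mem_nhds]
    refine forall₂_congr fun φ _ => ?_
    rw [hnhds, (ENNReal.nhds_zero_basis.comap _).mem_iff]
    rfl

end LipNorm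

/-! ### Self-adjoint orthonormal bases adapted to a filtration -/

section AdaptedBasis

variable {A : Type*} [Ring A] [StarRing A] [Algebra ℂ A]

/-- An orthonormal basis of self-adjoint elements of `A`, with the unit as one of its members,
whose elements of degree at most `n` span `A_n`. -/
structure AdaptedBasis (F : StarFiltration A) (σ : RegularState A) where
  /-- The indices of the basis elements other than the unit. -/
  S : Type
  /-- The basis elements; the index `none` stands for the unit. -/
  e : Option S → A
  /-- The degrees of the basis elements. -/
  deg : Option S → ℕ
  e_none : e none = 1
  deg_none : deg none = 0
  deg_some : ∀ s, 0 < deg (some s)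
  star_e : ∀ s, star (e s) = e s
  orth_self : ∀ s, σ.toLin (e s * e s) = 1
  orth_ne : ∀ s t, s ≠ t → σ.toLin (e s * e t) = 0
  space_eq : ∀ n, F.space n = Submodule.span ℂ (e '' {s | deg s ≤ n})
  finite : ∀ n, {s | deg s ≤ n}.Finite

variable [StarModule ℂ A] (F : StarFiltration A) (σ : RegularState A)

lemma one_mem_space (n : ℕ) : (1 : A) ∈ F.space n :=
  F.mono 0 n n.zero_le (by rw [F.zero]; exact Submodule.mem_span_singleton_self 1)

/-- A complex inner product space as a real one, with the real part of the inner product. -/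
local instance realInnerProductSpace {H : Type*} [NormedAddCommGroup H] [InnerProductSpace ℂ H] :
    InnerProductSpace ℝ H :=
  InnerProductSpace.complexToReal

/-- The self-adjoint elements of `A_{n+1}` that are orthogonal to `A_n`, as vectors. -/
def selfAdjointLayer (n : ℕ) : Submodule ℝ σ.L2 where
  carrier := {x | ∃ a, (a ∈ F.space (n + 1) ∧ star a = a ∧ ∀ b ∈ F.space n, σ.toLin (b * a) = 0) ∧
    σ.vec a = x}
  add_mem' := by
    rintro _ _ ⟨x, ⟨h1, h2, h3⟩, rfl⟩ ⟨y, ⟨h4, h5, h6⟩, rfl⟩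
    exact ⟨x + y, ⟨add_mem h1 h4, by rw [star_add, h2, h5],
      fun b hb => by rw [mul_add, map_add, h3 b hb, h6 b hb, add_zero]⟩, map_add _ _ _⟩
  zero_mem' := ⟨0, ⟨zero_mem _, star_zero _, by simp⟩, map_zero _⟩
  smul_mem' := by
    rintro r _ ⟨x, ⟨h1, h2, h3⟩, rfl⟩
    refine ⟨(r : ℂ) • x, ⟨Submodule.smul_mem _ _ h1, ?_, fun b hb => ?_⟩, map_smul _ _ _⟩
    · rw [star_smul, h2, Complex.star_def, Complex.conj_ofReal]
    · rw [mul_smul_comm, map_smul, h3 b hb, smul_zero]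

instance (n : ℕ) : FiniteDimensional ℝ (selfAdjointLayer F σ n) := by
  have hT : FiniteDimensional ℝ (spaceL2 F σ (n + 1)) := FiniteDimensional.complexToReal _
  have hT' : FiniteDimensional ℝ ((spaceL2 F σ (n + 1)).restrictScalars ℝ) := hT
  refine Submodule.finiteDimensional_of_le (S₂ := (spaceL2 F σ (n + 1)).restrictScalars ℝ) ?_
  rintro _ ⟨a, ha, rfl⟩
  exact ⟨a, ha.1, rfl⟩

/-- The elements of the adapted basis: the unit, and orthonormal bases of the layers. -/
def layerElem : Option (Σ n, Fin (Module.finrank ℝ (selfAdjointLayer F σ n))) → A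
  | none => 1
  | some s => (stdOrthonormalBasis ℝ (selfAdjointLayer F σ s.1) s.2).2.choose

/-- The degrees of the elements of the adapted basis. -/
def layerDeg : Option (Σ n, Fin (Module.finrank ℝ (selfAdjointLayer F σ n))) → ℕ
  | none => 0
  | some s => s.1 + 1

lemma layerElem_some_mem (s : Σ n, Fin (Module.finrank ℝ (selfAdjointLayer F σ n))) :
    layerElem F σ (some s) ∈ F.space (s.1 + 1) ∧
    star (layerElem F σ (some s)) = layerElem F σ (some s) ∧
    ∀ b ∈ F.space s.1, σ.toLin (b * layerElem F σ (some s)) = 0 :=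
  (stdOrthonormalBasis ℝ (selfAdjointLayer F σ s.1) s.2).2.choose_spec.1

lemma vec_layerElem_some (s : Σ n, Fin (Module.finrank ℝ (selfAdjointLayer F σ n))) :
    σ.vec (layerElem F σ (some s)) = stdOrthonormalBasis ℝ (selfAdjointLayer F σ s.1) s.2 :=
  (stdOrthonormalBasis ℝ (selfAdjointLayer F σ s.1) s.2).2.choose_spec.2

lemma layerElem_mem (s) : layerElem F σ s ∈ F.space (layerDeg F σ s) := by
  cases s with
  | none => exact one_mem_space F 0
  | some s => exact (layerElem_some_mem F σ s).1

lemma layerElem_inner_re (n : ℕ) (i j : Fin (Module.finrank ℝ (selfAdjointLayer F σ n))) :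
    (σ.toLin (layerElem F σ (some ⟨n, i⟩) * layerElem F σ (some ⟨n, j⟩))).re =
      if i = j then 1 else 0 := by
  rw [← orthonormal_iff_ite.mp (stdOrthonormalBasis ℝ (selfAdjointLayer F σ n)).orthonormal i j,
    Submodule.coe_inner, real_inner_eq_re_inner ℂ, ← vec_layerElem_some F σ ⟨n, i⟩,
    ← vec_layerElem_some F σ ⟨n, j⟩, σ.inner_vec, (layerElem_some_mem F σ ⟨n, i⟩).2.1]
  rfl

variable {σ} in
lemma layerElem_ortho_of_ne (hσ : σ.IsTracial) {s t} (h : s ≠ t) :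
    σ.toLin (layerElem F σ s * layerElem F σ t) = 0 := by
  -- The lower of two degrees belongs to a space to which the higher layer is orthogonal.
  have hlt : ∀ s t, layerDeg F σ s < layerDeg F σ t →
      σ.toLin (layerElem F σ s * layerElem F σ t) = 0 := by
    intro s t h
    cases t with
    | none => simp [layerDeg] at h
    | some t =>
      exact (layerElem_some_mem F σ t).2.2 _
        (F.mono _ _ (Nat.lt_succ_iff.mp h) (layerElem_mem F σ s))
  rcases lt_trichotomy (layerDeg F σ s) (layerDeg F σ t) with h1 | h1 | h1
  · exact hlt s t h1
  · rcases s with _ | ⟨n, i⟩ <;> rcases t with _ | ⟨m, j⟩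
    · exact absurd rfl h
    · simp [layerDeg] at h1
    · simp [layerDeg] at h1
    · obtain rfl : n = m := by simpa [layerDeg] using h1
      have hij : i ≠ j := fun hij => h (by rw [hij])
      have h3 := (layerElem_some_mem F σ ⟨n, i⟩).2.1
      have h4 := (layerElem_some_mem F σ ⟨n, j⟩).2.1
      have him := σ.conj_symm (layerElem F σ (some ⟨n, j⟩)) (layerElem F σ (some ⟨n, i⟩))
      rw [h3, h4, hσ (layerElem F σ (some ⟨n, j⟩))] at him
      refine Complex.ext ?_ (Complex.conj_eq_iff_im.mp him)
      simpa [hij] using layerElem_inner_re F σ n i j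
  · rw [hσ]
    exact hlt t s h1

lemma layerElem_ortho_self (s) :
    σ.toLin (layerElem F σ s * layerElem F σ s) = 1 := by
  rcases s with _ | ⟨n, i⟩
  · simp [layerElem, σ.map_one]
  · have h3 := (layerElem_some_mem F σ ⟨n, i⟩).2.1
    have him := σ.conj_symm (layerElem F σ (some ⟨n, i⟩)) (layerElem F σ (some ⟨n, i⟩))
    rw [h3] at him
    refine Complex.ext ?_ (Complex.conj_eq_iff_im.mp him)
    simpa using layerElem_inner_re F σ n i i

variable {σ} in
lemma space_eq_span_layerElem (hσ : σ.IsTracial) (n : ℕ) :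
    F.space n = Submodule.span ℂ (layerElem F σ '' {s | layerDeg F σ s ≤ n}) := by
  refine le_antisymm ?_ (Submodule.span_le.mpr ?_)
  · induction n with
    | zero =>
      rw [F.zero]
      refine Submodule.span_mono ?_
      rintro _ rfl
      exact ⟨none, le_refl 0, rfl⟩
    | succ n ih =>
      set T := Submodule.span ℂ (layerElem F σ '' {s | layerDeg F σ s ≤ n + 1})
      have hlow : F.space n ≤ T := ih.trans (Submodule.span_mono
        (Set.image_mono fun s hs => Nat.le_succ_of_le hs))
      have hlayer : ∀ a ∈ F.space (n + 1), star a = a →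
          (∀ b ∈ F.space n, σ.toLin (b * a) = 0) → a ∈ T := by
        intro a h1 h2 h3
        let T' : Submodule ℝ (selfAdjointLayer F σ n) :=
          ((T.map σ.vec).restrictScalars ℝ).comap (selfAdjointLayer F σ n).subtype
        have h4 : ⊤ ≤ T' := by
          rw [← (stdOrthonormalBasis ℝ (selfAdjointLayer F σ n)).toBasis.span_eq,
            Submodule.span_le]
          rintro _ ⟨j, rfl⟩
          rw [OrthonormalBasis.coe_toBasis]
          exact ⟨_, Submodule.subset_span ⟨some ⟨n, j⟩, le_refl (n + 1), rfl⟩,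
            vec_layerElem_some F σ ⟨n, j⟩⟩
        obtain ⟨b, hb, hba⟩ :=
          h4 (show (⟨σ.vec a, a, ⟨h1, h2, h3⟩, rfl⟩ : selfAdjointLayer F σ n) ∈ ⊤ from trivial)
        exact vec_injective σ hba ▸ hb
      intro a ha
      obtain ⟨b, hb, hbv⟩ := Q_apply_mem F σ n (σ.vec a)
      have hc : a - b ∈ F.space (n + 1) := sub_mem ha (F.mono _ _ n.le_succ hb)
      have horth : ∀ d ∈ F.space n, σ.toLin (d * (a - b)) = 0 := fun d hd => by
        rw [← star_star d, ← σ.inner_vec, map_sub, hbv,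
          ← Q_vec F σ (F.star_mem n d hd), inner_Q_left, map_sub, Q_Q_of_le F σ le_rfl, sub_self,
          inner_zero_right]
      have horth' : ∀ d ∈ F.space n, σ.toLin (d * star (a - b)) = 0 := fun d hd => by
        have h1 := σ.conj_symm (a - b) d
        rw [hσ, ← h1, horth _ (F.star_mem n d hd), map_zero]
      have hc' := F.star_mem _ _ hc
      -- The real and imaginary parts of `a - b` belong to the layer.
      have hre : (1 / 2 : ℂ) • (a - b + star (a - b)) ∈ T := by
        refine hlayer _ ?_ ?_ fun d hd => ?_
        · exact Submodule.smul_mem _ _ (add_mem hc hc')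
        · rw [star_smul, star_add, star_star, add_comm]
          simp
        · rw [mul_smul_comm, map_smul, mul_add, map_add, horth d hd,
            horth' d hd, add_zero, smul_zero]
      have him : (Complex.I / 2 : ℂ) • (a - b - star (a - b)) ∈ T := by
        refine hlayer _ ?_ ?_ fun d hd => ?_
        · exact Submodule.smul_mem _ _ (sub_mem hc hc')
        · rw [star_smul, star_sub, star_star,
            ← neg_sub (a - b), smul_neg, ← neg_smul]
          simp [neg_div]
        · rw [mul_smul_comm, map_smul, mul_sub, map_sub, horth d hd,
            horth' d hd, sub_zero, smul_zero]
      have hab : a = b + ((1 / 2 : ℂ) • (a - b + star (a - b)) +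
          (-Complex.I) • ((Complex.I / 2 : ℂ) • (a - b - star (a - b)))) := by
        have h1 : -Complex.I * (Complex.I / 2) = 1 / 2 := by
          rw [neg_mul, mul_div_assoc', Complex.I_mul_I, neg_div, neg_neg]
        rw [smul_smul, h1, ← smul_add, add_add_sub_cancel, ← two_smul ℂ, smul_smul]
        norm_num
      rw [hab]
      exact add_mem (hlow hb) (add_mem hre (Submodule.smul_mem _ _ him))
  · rintro _ ⟨s, hs, rfl⟩
    exact F.mono _ _ hs (layerElem_mem F σ s)

variable {σ} in
/-- A filtered algebra with a faithful tracial state has an adapted basis. Traciality is what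
makes the adjoint isometric, so that the layers are spanned by their self-adjoint elements. -/
def adaptedBasis (hσ : σ.IsTracial) : AdaptedBasis F σ where
  S := Σ n, Fin (Module.finrank ℝ (selfAdjointLayer F σ n))
  e := layerElem F σ
  deg := layerDeg F σ
  e_none := rfl
  deg_none := rfl
  deg_some _ := Nat.succ_pos _
  star_e s := by
    cases s with
    | none => exact star_one A
    | some s => exact (layerElem_some_mem F σ s).2.1
  orth_self := layerElem_ortho_self F σ
  orth_ne _ _ := layerElem_ortho_of_ne F hσ
  space_eq := space_eq_span_layerElem F hσ
  finite n := by
    refine Set.Finite.subset (((Finset.range (n + 1)).sigma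
      fun m => (Finset.univ : Finset (Fin (Module.finrank ℝ (selfAdjointLayer F σ m))))).map
        Function.Embedding.some |>.cons none (by simp)).finite_toSet ?_
    rintro (_ | ⟨m, j⟩) h
    · simp
    · have : m < n := h
      simp only [Finset.coe_cons, Set.mem_insert_iff, reduceCtorEq, Finset.coe_map, Set.mem_image,
        Finset.mem_coe, Finset.mem_sigma, Finset.mem_range, Finset.mem_univ, and_true, false_or]
      exact ⟨⟨m, j⟩, by simp; omega, rfl⟩

namespace AdaptedBasis

variable {F σ} (E : AdaptedBasis F σ)

/-- The adapted basis, as a basis of the vector space `A`. -/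
def basis : Module.Basis (Option E.S) ℂ A :=
  Module.Basis.mk (v := E.e)
    (by
      refine linearIndependent_iff'.mpr fun s g hg i hi => ?_
      have h1 : σ.toLin (E.e i * ∑ j ∈ s, g j • E.e j) = g i := by
        rw [Finset.mul_sum, map_sum, Finset.sum_eq_single_of_mem i hi fun j _ hj => by
          rw [mul_smul_comm, map_smul, E.orth_ne i j hj.symm, smul_zero],
          mul_smul_comm, map_smul, E.orth_self, smul_eq_mul, mul_one]
      rw [← h1, hg, mul_zero, map_zero])
    (by
      intro a _
      obtain ⟨n, hn⟩ := F.exhaust a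
      rw [E.space_eq] at hn
      exact Submodule.span_mono (Set.image_subset_range _ _) hn)

lemma basis_apply (s : Option E.S) : E.basis s = E.e s := by
  rw [basis, Module.Basis.mk_apply]

lemma repr_apply (a : A) (s : Option E.S) : E.basis.repr a s = σ.toLin (E.e s * a) := by
  classical
  have h : E.basis.coord s = σ.toLin ∘ₗ LinearMap.mulLeft ℂ (E.e s) := by
    refine E.basis.ext fun t => ?_
    rw [Module.Basis.coord_apply, Module.Basis.repr_self, LinearMap.comp_apply,
      LinearMap.mulLeft_apply, basis_apply]
    by_cases hst : s = t
    · rw [hst, Finsupp.single_eq_same, E.orth_self]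
    · rw [E.orth_ne s t hst, Finsupp.single_eq_of_ne hst]
  exact DFunLike.congr_fun h a

lemma e_mem (s : Option E.S) : E.e s ∈ F.space (E.deg s) := by
  rw [E.space_eq]
  exact Submodule.subset_span ⟨s, le_refl (E.deg s), rfl⟩

lemma repr_eq_zero_of_lt {n : ℕ} {a : A} (ha : a ∈ F.space n) {s : Option E.S}
    (h : n < E.deg s) : σ.toLin (E.e s * a) = 0 := by
  rw [E.space_eq] at ha
  refine Submodule.span_induction (p := fun a _ => σ.toLin (E.e s * a) = 0) ?_ (by simp)
    (fun x y _ _ hx hy => by rw [mul_add, map_add, hx, hy, add_zero])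
    (fun c x _ hx => by rw [mul_smul_comm, map_smul, hx, smul_zero]) ha
  rintro _ ⟨t, ht, rfl⟩
  refine E.orth_ne s t ?_
  rintro rfl
  exact absurd h (not_lt.mpr ht)

lemma mem_space_of_repr {n : ℕ} {a : A} (h : ∀ s, n < E.deg s → E.basis.repr a s = 0) :
    a ∈ F.space n := by
  rw [← E.basis.linearCombination_repr a, Finsupp.linearCombination_apply]
  refine sum_mem fun s hs => Submodule.smul_mem _ _ ?_
  rw [basis_apply]
  refine F.mono _ _ ?_ (E.e_mem s)
  by_contra hlt
  exact (Finsupp.mem_support_iff.mp hs) (h s (not_le.mp hlt))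

end AdaptedBasis

end AdaptedBasis

/-! ### The basis of words of the free product -/

section Words

open LinearAlgebra

variable {A : Fin 2 → Type*} [∀ i, Ring (A i)] [∀ i, StarRing (A i)] [∀ i, Algebra ℂ (A i)]
  [∀ i, StarModule ℂ (A i)]
variable {F : ∀ i, StarFiltration (A i)} {σ : ∀ i, RegularState (A i)}
variable (E : ∀ i, AdaptedBasis (F i) (σ i))

/-- An element of the free product belongs to each subalgebra that contains both factors. -/
lemma mem_of_incl_mem (T : Subalgebra ℂ (Free A)) (h : ∀ i a, incl A i a ∈ T) (x : Free A) :
    x ∈ T := by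
  let f : Free A →ₐ[ℂ] T :=
    FreeProduct.lift ℂ A (fun {i} => (incl A i).codRestrict T (h i))
  have hf : T.val.comp f = AlgHom.id ℂ (Free A) := free_hom_ext fun i b => by
    have h : f.comp (incl A i) = (incl A i).codRestrict T (h i) := FreeProduct.lift_comp_ι ℂ A _
    exact congrArg Subtype.val (DFunLike.congr_fun h b)
  have h1 : (f x : Free A) = x := DFunLike.congr_fun hf x
  exact h1 ▸ (f x).2

/-- The letters: the elements of the two adapted bases other than the units. -/
abbrev Letter : Type := Σ i, (E i).S

variable {E} in
/-- Consecutive letters come from different factors. -/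
def IsWord (l : List (Letter E)) : Prop := l.IsChain (fun p q => p.1 ≠ q.1)

/-- The words in the letters. -/
abbrev Word : Type := {l : List (Letter E) // IsWord l}

/-- The empty word. -/
def emptyWord : Word E := ⟨[], List.IsChain.nil⟩

/-- The words that do not begin with a letter from the factor `i`. -/
abbrev WordOff (i : Fin 2) : Type := {l : List (Letter E) // IsWord l ∧ ∀ p ∈ l.head?, p.1 ≠ i}

variable {E} in
lemma isWord_cons {p : Letter E} {l : List (Letter E)} :
    IsWord (p :: l) ↔ IsWord l ∧ ∀ q ∈ l.head?, q.1 ≠ p.1 := by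
  cases l with
  | nil => simp [IsWord]
  | cons q l => simp [IsWord, List.isChain_cons_cons, and_comm, ne_comm]

/-- A word is uniquely an element of the adapted basis of the factor `i`, followed by a word that
does not begin with a letter from this factor. -/
def consWord (i : Fin 2) : WordOff E i × Option (E i).S → Word E
  | (w, none) => ⟨w.1, w.2.1⟩
  | (w, some s) => ⟨⟨i, s⟩ :: w.1, isWord_cons.mpr ⟨w.2.1, w.2.2⟩⟩

lemma consWord_bijective (i : Fin 2) : Function.Bijective (consWord E i) := by
  constructor
  · rintro ⟨⟨w, hw, hw'⟩, _ | s⟩ ⟨⟨v, hv, hv'⟩, _ | t⟩ h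
    · obtain rfl : w = v := congrArg Subtype.val h
      rfl
    · obtain rfl : w = ⟨i, t⟩ :: v := congrArg Subtype.val h
      exact absurd rfl (hw' ⟨i, t⟩ (by simp))
    · obtain rfl : ⟨i, s⟩ :: w = v := congrArg Subtype.val h
      exact absurd rfl (hv' ⟨i, s⟩ (by simp))
    · have h1 : (⟨i, s⟩ :: w : List (Letter E)) = ⟨i, t⟩ :: v := congrArg Subtype.val h
      obtain ⟨h2, rfl⟩ := List.cons.inj h1
      obtain rfl : s = t := by simpa using h2
      rfl
  · rintro ⟨_ | ⟨⟨j, s⟩, w⟩, hw⟩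
    · exact ⟨(⟨[], hw, by simp⟩, none), rfl⟩
    · by_cases hj : j = i
      · subst hj
        have h1 := isWord_cons.mp hw
        exact ⟨(⟨w, h1.1, h1.2⟩, some s), rfl⟩
      · exact ⟨(⟨⟨j, s⟩ :: w, hw, by simpa using hj⟩, none), rfl⟩

/-- The bijection of `consWord`. -/
def wordEquiv (i : Fin 2) : WordOff E i × Option (E i).S ≃ Word E :=
  Equiv.ofBijective _ (consWord_bijective E i)

lemma wordEquiv_none {i : Fin 2} (w : WordOff E i) : (wordEquiv E i (w, none)).1 = w.1 := rfl

lemma wordEquiv_some {i : Fin 2} (w : WordOff E i) (s : (E i).S) :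
    (wordEquiv E i (w, some s)).1 = ⟨i, s⟩ :: w.1 := rfl

/-- The identification of the span of the words with the direct sum of copies of `A i`, one for
each word that does not begin with a letter from the factor `i`. -/
def expand (i : Fin 2) : (Word E →₀ ℂ) ≃ₗ[ℂ] (WordOff E i →₀ A i) :=
  Finsupp.domLCongr (wordEquiv E i).symm ≪≫ₗ Finsupp.curryLinearEquiv ℂ ≪≫ₗ
    Finsupp.mapRange.linearEquiv (E i).basis.repr.symm

lemma repr_expand (i : Fin 2) (v : Word E →₀ ℂ) (w : WordOff E i) (o : Option (E i).S) :
    (σ i).toLin ((E i).e o * expand E i v w) = v (wordEquiv E i (w, o)) := by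
  rw [← AdaptedBasis.repr_apply]
  simp [expand]

lemma expand_single (i : Fin 2) (w : WordOff E i) (o : Option (E i).S) (c : ℂ) :
    expand E i (Finsupp.single (wordEquiv E i (w, o)) c) = Finsupp.single w (c • (E i).e o) := by
  simp [expand, AdaptedBasis.basis_apply]

/-- Left multiplication by the elements of `A i`, on the span of the words. -/
def leftAct (i : Fin 2) : A i →ₐ[ℂ] Module.End ℂ (Word E →₀ ℂ) :=
  ((expand E i).symm.conjAlgEquiv ℂ).toAlgHom.comp (Algebra.lsmul ℂ ℂ (WordOff E i →₀ A i))

lemma expand_leftAct (i : Fin 2) (a : A i) (v : Word E →₀ ℂ) :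
    expand E i (leftAct E i a v) = a • expand E i v := by
  simp [leftAct, LinearEquiv.conjAlgEquiv_apply]

lemma leftAct_apply (i : Fin 2) (a : A i) (v : Word E →₀ ℂ) (w : WordOff E i)
    (o : Option (E i).S) :
    leftAct E i a v (wordEquiv E i (w, o)) = (σ i).toLin ((E i).e o * (a * expand E i v w)) := by
  rw [← repr_expand, expand_leftAct]
  rfl

/-- The representation of the free product on the span of the words. -/
def rep : Free A →ₐ[ℂ] Module.End ℂ (Word E →₀ ℂ) :=
  FreeProduct.lift ℂ A (fun {i} => leftAct E i)

lemma rep_incl (i : Fin 2) (a : A i) : rep E (incl A i a) = leftAct E i a := by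
  have h : (rep E).comp (incl A i) = leftAct E i := FreeProduct.lift_comp_ι ℂ A _
  exact DFunLike.congr_fun h a

lemma leftAct_letter (i : Fin 2) (w : WordOff E i) (s : (E i).S) :
    leftAct E i ((E i).e (some s)) (Finsupp.single (wordEquiv E i (w, none)) 1) =
      Finsupp.single (wordEquiv E i (w, some s)) 1 := by
  apply (expand E i).injective
  rw [expand_leftAct, expand_single, expand_single, Finsupp.smul_single, (E i).e_none, one_smul,
    one_smul, smul_eq_mul, mul_one]

variable {E} in
/-- A letter, as an element of the free product. -/
def letterElem (p : Letter E) : Free A := incl A p.1 ((E p.1).e (some p.2))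

variable {E} in
/-- The product of the letters of a word. -/
def wordElem (l : List (Letter E)) : Free A := (l.map letterElem).prod

lemma wordElem_cons (p : Letter E) (l : List (Letter E)) :
    wordElem (p :: l) = letterElem p * wordElem l := by
  simp [wordElem]

/-- The map that takes a word to the product of its letters. -/
def ofWords : (Word E →₀ ℂ) →ₗ[ℂ] Free A := Finsupp.linearCombination ℂ fun w => wordElem w.1

lemma ofWords_eq (i : Fin 2) (v : Word E →₀ ℂ) :
    ofWords E v = (expand E i v).sum fun w a => incl A i a * wordElem w.1 := by
  let f : (WordOff E i →₀ A i) →ₗ[ℂ] Free A := Finsupp.lsum ℂ fun w =>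
    LinearMap.mulRight ℂ (wordElem w.1) ∘ₗ (incl A i).toLinearMap
  have h : ofWords E = f ∘ₗ (expand E i).toLinearMap := by
    refine Finsupp.lhom_ext fun w c => ?_
    obtain ⟨⟨w, o⟩, rfl⟩ := (wordEquiv E i).surjective w
    simp only [ofWords, Finsupp.linearCombination_single, LinearMap.comp_apply,
      LinearEquiv.coe_coe, expand_single, f, Finsupp.lsum_single, LinearMap.mulRight_apply,
      AlgHom.toLinearMap_apply, map_smul]
    cases o with
    | none => rw [(E i).e_none, map_one, one_mul, wordEquiv_none]
    | some s => rw [wordEquiv_some, wordElem_cons, letterElem]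
  exact DFunLike.congr_fun h v

lemma ofWords_rep (x : Free A) (v : Word E →₀ ℂ) : ofWords E (rep E x v) = x * ofWords E v := by
  let T : Subalgebra ℂ (Free A) :=
    { carrier := {x | ∀ v, ofWords E (rep E x v) = x * ofWords E v}
      mul_mem' := fun {x y} hx hy v => by
        rw [map_mul, Module.End.mul_apply, hx, hy, mul_assoc]
      add_mem' := fun {x y} hx hy v => by
        rw [map_add, LinearMap.add_apply, map_add, hx, hy, add_mul]
      algebraMap_mem' := fun c v => by
        rw [AlgHom.commutes, Module.algebraMap_end_apply, map_smul, Algebra.smul_def] }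
  refine mem_of_incl_mem T (fun i a v => ?_) x v
  rw [rep_incl, ofWords_eq E i, ofWords_eq E i, expand_leftAct, Finsupp.sum_smul_index' (by simp),
    Finsupp.mul_sum]
  simp only [smul_eq_mul, map_mul, mul_assoc]

/-- The coordinates of an element of the free product in the basis of words. -/
def toWords : Free A →ₗ[ℂ] (Word E →₀ ℂ) :=
  (LinearMap.applyₗ (Finsupp.single (emptyWord E) 1)) ∘ₗ (rep E).toLinearMap

lemma toWords_apply (x : Free A) : toWords E x = rep E x (Finsupp.single (emptyWord E) 1) := rfl

lemma toWords_mul (x y : Free A) : toWords E (x * y) = rep E x (toWords E y) := by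
  rw [toWords_apply, map_mul]
  rfl

lemma ofWords_toWords (x : Free A) : ofWords E (toWords E x) = x := by
  rw [toWords_apply, ofWords_rep, ofWords, Finsupp.linearCombination_single]
  simp [emptyWord, wordElem]

lemma toWords_wordElem (w : Word E) : toWords E (wordElem w.1) = Finsupp.single w 1 := by
  obtain ⟨l, hl⟩ := w
  induction l with
  | nil => simp [toWords_apply, wordElem, emptyWord]
  | cons p l ih =>
    obtain ⟨h1, h2⟩ := isWord_cons.mp hl
    rw [wordElem_cons, toWords_mul, ih h1, letterElem, rep_incl]
    exact leftAct_letter E p.1 ⟨l, h1, h2⟩ p.2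

/-- The words form a basis of the free product. -/
def wordBasis : Module.Basis (Word E) ℂ (Free A) :=
  Module.Basis.ofRepr (LinearEquiv.ofLinearMap (toWords E) (ofWords E)
    (Finsupp.lhom_ext fun w c => by
      rw [LinearMap.comp_apply, ofWords, Finsupp.linearCombination_single, map_smul,
        toWords_wordElem, LinearMap.id_apply, Finsupp.smul_single, smul_eq_mul, mul_one])
    (LinearMap.ext fun x => ofWords_toWords E x))

lemma wordBasis_apply (w : Word E) : wordBasis E w = wordElem w.1 := by
  change ofWords E (Finsupp.single w 1) = _
  rw [ofWords, Finsupp.linearCombination_single, one_smul]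

end Words

/-! ### The free product state -/

section FreeState

open LinearAlgebra

variable {A : Fin 2 → Type*} [∀ i, Ring (A i)] [∀ i, StarRing (A i)] [∀ i, Algebra ℂ (A i)]
  [∀ i, StarModule ℂ (A i)]
variable {F : ∀ i, StarFiltration (A i)} {σ : ∀ i, RegularState (A i)}
variable (E : ∀ i, AdaptedBasis (F i) (σ i))

variable {E} in
/-- The inner product for which the words are orthonormal. -/
def ip (v u : Word E →₀ ℂ) : ℂ := v.sum fun w c => (starRingEnd ℂ) c * u w

lemma ip_add_left (v v' u : Word E →₀ ℂ) : ip (v + v') u = ip v u + ip v' u :=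
  Finsupp.sum_add_index' (by simp) (by intros; simp [add_mul])

lemma ip_add_right (v u u' : Word E →₀ ℂ) : ip v (u + u') = ip v u + ip v u' := by
  simp [ip, mul_add, Finsupp.sum_add]

lemma ip_smul_left (c : ℂ) (v u : Word E →₀ ℂ) : ip (c • v) u = (starRingEnd ℂ) c * ip v u := by
  rw [ip, Finsupp.sum_smul_index' (by simp), ip, Finsupp.mul_sum]
  simp [mul_assoc]

lemma ip_smul_right (c : ℂ) (v u : Word E →₀ ℂ) : ip v (c • u) = c * ip v u := by
  simp only [ip, Finsupp.mul_sum, Finsupp.smul_apply, smul_eq_mul, mul_left_comm c]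

lemma ip_single_left (w : Word E) (c : ℂ) (u : Word E →₀ ℂ) :
    ip (Finsupp.single w c) u = (starRingEnd ℂ) c * u w := by
  simp [ip]

lemma ip_self (v : Word E →₀ ℂ) : ip v v = ((∑ w ∈ v.support, ‖v w‖ ^ 2 : ℝ) : ℂ) := by
  rw [ip, Finsupp.sum, Complex.ofReal_sum]
  refine Finset.sum_congr rfl fun w _ => ?_
  rw [← Complex.normSq_eq_conj_mul_self, Complex.normSq_eq_norm_sq]

lemma ip_self_re_nonneg (v : Word E →₀ ℂ) : 0 ≤ (ip v v).re := by
  rw [ip_self, Complex.ofReal_re]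
  positivity

lemma ip_eq_sum_expand (i : Fin 2) (v u : Word E →₀ ℂ) :
    ip v u = (expand E i v).sum fun w a => (σ i).toLin (star a * expand E i u w) := by
  induction v using Finsupp.induction_linear with
  | zero => simp [ip]
  | add v v' hv hv' =>
    rw [ip_add_left, hv, hv', map_add]
    exact (Finsupp.sum_add_index' (by simp) (by intros; simp [add_mul])).symm
  | single w c =>
    obtain ⟨⟨w, o⟩, rfl⟩ := (wordEquiv E i).surjective w
    rw [ip_single_left, expand_single, Finsupp.sum_single_index (by simp), star_smul,
      (E i).star_e, smul_mul_assoc, map_smul, repr_expand]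
    rfl

/-- The representation of the free product on the span of the words is a `*`-representation. -/
lemma ip_rep_left (x : Free A) (v u : Word E →₀ ℂ) :
    ip (rep E x v) u = ip v (rep E (star x) u) := by
  let T : Subalgebra ℂ (Free A) :=
    { carrier := {x | ∀ v u, ip (rep E x v) u = ip v (rep E (star x) u)}
      mul_mem' := fun {x y} hx hy v u => by
        rw [map_mul, Module.End.mul_apply, hx, hy, star_mul, map_mul, Module.End.mul_apply]
      add_mem' := fun {x y} hx hy v u => by
        rw [map_add, LinearMap.add_apply, ip_add_left, hx, hy, star_add, map_add,
          LinearMap.add_apply, ip_add_right]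
      algebraMap_mem' := fun c v u => by
        have h : star (algebraMap ℂ (Free A) c) = algebraMap ℂ (Free A) ((starRingEnd ℂ) c) :=
          freeStar_algebraMap c
        rw [h, AlgHom.commutes, AlgHom.commutes, Module.algebraMap_end_apply,
          Module.algebraMap_end_apply, ip_smul_left, ip_smul_right] }
  refine mem_of_incl_mem T (fun i a v u => ?_) x v u
  rw [star_incl, rep_incl, rep_incl, ip_eq_sum_expand E i, ip_eq_sum_expand E i, expand_leftAct,
    expand_leftAct, Finsupp.sum_smul_index' (by simp)]
  simp only [smul_eq_mul, star_mul, mul_assoc, Finsupp.smul_apply]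

/-- The representation of the free product on the span of the words is by bounded operators: an
element of a factor acts as a direct sum of copies of its action on this factor. -/
lemma rep_bounded (x : Free A) :
    ∃ K : ℝ, 0 ≤ K ∧ ∀ v, (ip (rep E x v) (rep E x v)).re ≤ K * (ip v v).re := by
  let T : Subalgebra ℂ (Free A) :=
    { carrier := {x | ∃ K : ℝ, 0 ≤ K ∧ ∀ v, (ip (rep E x v) (rep E x v)).re ≤ K * (ip v v).re}
      mul_mem' := by
        rintro x y ⟨K, hK, hx⟩ ⟨M, hM, hy⟩
        refine ⟨K * M, mul_nonneg hK hM, fun v => ?_⟩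
        rw [map_mul, Module.End.mul_apply, mul_assoc]
        exact (hx _).trans (mul_le_mul_of_nonneg_left (hy v) hK)
      add_mem' := by
        rintro x y ⟨K, hK, hx⟩ ⟨M, hM, hy⟩
        refine ⟨2 * K + 2 * M, by positivity, fun v => ?_⟩
        have h1 := ip_self_re_nonneg E (rep E x v + (-1 : ℂ) • rep E y v)
        have h2 := hx v
        have h3 := hy v
        simp only [map_add, LinearMap.add_apply, ip_add_left, ip_add_right, ip_smul_left,
          ip_smul_right, map_neg, map_one, Complex.add_re, neg_mul, one_mul, Complex.neg_re] at h1 ⊢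
        nlinarith
      algebraMap_mem' := fun c => by
        refine ⟨Complex.normSq c, Complex.normSq_nonneg c, fun v => le_of_eq ?_⟩
        rw [AlgHom.commutes, Module.algebraMap_end_apply, ip_smul_left, ip_smul_right, ← mul_assoc,
          ← Complex.normSq_eq_conj_mul_self, Complex.re_ofReal_mul] }
  refine mem_of_incl_mem T (fun i a => ?_) x
  obtain ⟨K, hK⟩ := (σ i).bounded a
  refine ⟨max K 0, le_max_right _ _, fun v => ?_⟩
  rw [rep_incl, ip_eq_sum_expand E i, ip_eq_sum_expand E i, expand_leftAct,
    Finsupp.sum_smul_index' (by simp), Finsupp.sum, Finsupp.sum, Complex.re_sum, Complex.re_sum,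
    Finset.mul_sum]
  refine Finset.sum_le_sum fun w _ => (hK _).trans ?_
  exact mul_le_mul_of_nonneg_right (le_max_left _ _)
    (Complex.nonneg_iff.mp ((σ i).nonneg _)).1

/-- The coefficient of the empty word. -/
def freeLin : Free A →ₗ[ℂ] ℂ := Finsupp.lapply (emptyWord E) ∘ₗ toWords E

lemma freeLin_apply (x : Free A) : freeLin E x = toWords E x (emptyWord E) := rfl

lemma freeLin_star_mul (x y : Free A) :
    freeLin E (star x * y) = ip (toWords E x) (toWords E y) := by
  rw [freeLin_apply, toWords_mul, toWords_apply E x, ip_rep_left, ip_single_left, map_one, one_mul]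

/-- The free product of the two states. -/
def freeState : RegularState (Free A) where
  toLin := freeLin E
  map_one := by simp [freeLin_apply, toWords_apply]
  pos a ha := by
    rw [freeLin_star_mul, ip_self, Complex.zero_lt_real]
    have h : toWords E a ≠ 0 := fun h => ha (by rw [← ofWords_toWords E a, h, map_zero])
    obtain ⟨w, hw⟩ := Finsupp.support_nonempty_iff.mpr h
    refine Finset.sum_pos' (fun _ _ => sq_nonneg _) ⟨w, hw, ?_⟩
    have := norm_pos_iff.mpr (Finsupp.mem_support_iff.mp hw)
    positivity
  bounded a := by
    obtain ⟨K, -, hK⟩ := rep_bounded E a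
    refine ⟨K, fun b => ?_⟩
    rw [freeLin_star_mul, freeLin_star_mul, toWords_mul]
    exact hK _

lemma freeState_apply (x : Free A) : (freeState E).toLin x = toWords E x (emptyWord E) := rfl

lemma freeState_incl (i : Fin 2) (a : A i) :
    (freeState E).toLin (incl A i a) = (σ i).toLin a := by
  rw [freeState_apply, toWords_apply, rep_incl]
  obtain ⟨w₀, h1⟩ : ∃ w₀ : WordOff E i, emptyWord E = wordEquiv E i (w₀, none) :=
    ⟨⟨[], (emptyWord E).2, by simp⟩, rfl⟩
  rw [h1, leftAct_apply, expand_single, Finsupp.single_eq_same, (E i).e_none]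
  simp

/-- An alternating product of centred elements is a combination of words whose first letter comes
from the same factor as the first element of the product. -/
lemma toWords_alternating (l : List (Σ i, A i)) (hl : l.IsChain (fun p q => p.1 ≠ q.1))
    (h0 : ∀ p ∈ l, (σ p.1).toLin p.2 = 0) (w : Word E)
    (hw : toWords E (l.map fun p => incl A p.1 p.2).prod w ≠ 0) :
    w.1.head?.map Sigma.fst = l.head?.map Sigma.fst := by
  induction l generalizing w with
  | nil =>
    have h1 : w = emptyWord E := by
      by_contra h
      apply hw
      simp [toWords_apply, Finsupp.single_eq_of_ne h]
    rw [h1]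
    rfl
  | cons p l ih =>
    obtain ⟨i, a⟩ := p
    have ih := ih hl.of_cons fun q hq => h0 q (List.mem_cons_of_mem _ hq)
    set v := toWords E (l.map fun p => incl A p.1 p.2).prod
    obtain ⟨⟨w, o⟩, rfl⟩ := (wordEquiv E i).surjective w
    cases o with
    | some s => simp [wordEquiv_some]
    | none =>
      exfalso
      apply hw
      rw [List.map_cons, List.prod_cons, toWords_mul, rep_incl, leftAct_apply]
      have h1 : expand E i v w ∈ (F i).space 0 := by
        refine (E i).mem_space_of_repr fun o ho => ?_
        cases o with
        | none => exact absurd ho (by rw [(E i).deg_none]; exact lt_irrefl 0)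
        | some s =>
          rw [AdaptedBasis.repr_apply, repr_expand]
          by_contra hne
          have h2 := ih _ hne
          rw [wordEquiv_some] at h2
          cases l with
          | nil => simp at h2
          | cons q l =>
            have h3 : i = q.1 := by simpa using h2
            exact (List.isChain_cons_cons.mp hl).1 h3
      rw [(F i).zero] at h1
      obtain ⟨c, hc⟩ := Submodule.mem_span_singleton.mp h1
      have h2 : (σ i).toLin a = 0 := h0 ⟨i, a⟩ List.mem_cons_self
      rw [← hc, (E i).e_none, one_mul, mul_smul_comm, mul_one, map_smul, h2, smul_zero]

lemma freeState_alternating (l : List (Σ i, A i)) (hne : l ≠ [])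
    (hl : l.IsChain (fun p q => p.1 ≠ q.1)) (h0 : ∀ p ∈ l, (σ p.1).toLin p.2 = 0) :
    (freeState E).toLin (l.map fun p => incl A p.1 p.2).prod = 0 := by
  by_contra h
  have h1 := toWords_alternating E l hl h0 (emptyWord E) h
  cases l with
  | nil => exact hne rfl
  | cons p l => simp [emptyWord] at h1

lemma isFreeProductState_freeState : IsFreeProductState σ (freeState E).toLin :=
  ⟨freeState_incl E, freeState_alternating E⟩

variable {E} in
/-- A word, as a list of elements of the factors. -/
def wordList (l : List (Letter E)) : List (Σ i, A i) :=
  l.map fun p => ⟨p.1, (E p.1).e (some p.2)⟩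

lemma wordList_prod (l : List (Letter E)) :
    ((wordList l).map fun p => incl A p.1 p.2).prod = wordElem l := by
  rw [wordList, List.map_map]
  rfl

lemma isChain_wordList {l : List (Letter E)} (hl : IsWord l) :
    (wordList l).IsChain (fun p q => p.1 ≠ q.1) := by
  rw [wordList, List.isChain_map]
  exact hl

lemma toLin_e_some (i : Fin 2) (s : (E i).S) : (σ i).toLin ((E i).e (some s)) = 0 := by
  have h := (E i).orth_ne none (some s) (by simp)
  rwa [(E i).e_none, one_mul] at h

lemma wordList_centred (l : List (Letter E)) : ∀ p ∈ wordList l, (σ p.1).toLin p.2 = 0 := by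
  intro p hp
  obtain ⟨q, _, rfl⟩ := List.mem_map.mp hp
  exact toLin_e_some E q.1 q.2

variable {E} in
lemma IsFreeProductState.wordElem_eq_zero {φ : Free A →ₗ[ℂ] ℂ} (hφ : IsFreeProductState σ φ)
    {l : List (Letter E)} (hl : IsWord l) (hne : l ≠ []) : φ (wordElem l) = 0 := by
  rw [← wordList_prod]
  exact hφ.alternating _ (by simpa [wordList] using hne) (isChain_wordList E hl)
    (wordList_centred E l)

lemma IsFreeProductState.eq_freeState {φ : Free A →ₗ[ℂ] ℂ} (hφ : IsFreeProductState σ φ) :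
    φ = (freeState E).toLin := by
  refine (wordBasis E).ext fun w => ?_
  rw [wordBasis_apply]
  by_cases h : w.1 = []
  · rw [h]
    have h1 : (wordElem ([] : List (Letter E))) = incl A 0 1 := by simp [wordElem]
    rw [h1, hφ.restrict, freeState_incl]
  · rw [hφ.wordElem_eq_zero w.2 h, (isFreeProductState_freeState E).wordElem_eq_zero w.2 h]

lemma star_wordElem (l : List (Letter E)) : star (wordElem l) = wordElem l.reverse := by
  induction l with
  | nil => simp [wordElem]
  | cons p l ih =>
    rw [wordElem_cons, star_mul, ih, letterElem, star_incl, (E p.1).star_e]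
    simp [wordElem, letterElem]

lemma freeState_star (x : Free A) :
    (freeState E).toLin (star x) = (starRingEnd ℂ) ((freeState E).toLin x) := by
  have h := (freeState E).conj_symm x 1
  rw [star_one, one_mul, mul_one] at h
  exact h.symm

/-- The state of the product of a centred element of a factor and a word with at least two letters
is zero. -/
lemma freeState_incl_mul_wordElem {i : Fin 2} {a : A i} (ha : (σ i).toLin a = 0)
    {l : List (Letter E)} (hl : IsWord l) (hlen : 2 ≤ l.length) :
    (freeState E).toLin (incl A i a * wordElem l) = 0 := by
  have key : ∀ (b : A i) (l : List (Letter E)), (σ i).toLin b = 0 → IsWord l →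
      (∀ q ∈ l.head?, q.1 ≠ i) → (freeState E).toLin (incl A i b * wordElem l) = 0 := by
    intro b l hb hl hq
    have := freeState_alternating E (⟨i, b⟩ :: wordList l) (by simp) ?_ ?_
    · rwa [List.map_cons, List.prod_cons, wordList_prod] at this
    · rw [List.isChain_cons]
      refine ⟨fun q hq' => ?_, isChain_wordList E hl⟩
      cases l with
      | nil => simp [wordList] at hq'
      | cons p l =>
        have h1 : ⟨p.1, (E p.1).e (some p.2)⟩ = q := by simpa [wordList] using hq'
        rw [← h1]
        exact (hq p (by simp)).symm
    · intro p hp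
      rcases List.mem_cons.mp hp with rfl | hp
      · exact hb
      · exact wordList_centred E l p hp
  cases l with
  | nil => simp at hlen
  | cons p l =>
    by_cases hp : p.1 = i
    · obtain ⟨j, s⟩ := p
      obtain rfl : j = i := hp
      obtain ⟨h1, h2⟩ := isWord_cons.mp hl
      set c := (σ j).toLin (a * (E j).e (some s))
      have h3 : incl A j a * wordElem (⟨j, s⟩ :: l) =
          incl A j (a * (E j).e (some s) - c • 1) * wordElem l + c • wordElem l := by
        rw [wordElem_cons, letterElem, map_sub, map_mul, map_smul, map_one, sub_mul, ← mul_assoc,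
          smul_mul_assoc, one_mul, sub_add_cancel]
      have hne : l ≠ [] := by
        rintro rfl
        simp at hlen
      rw [h3, map_add, map_smul, (isFreeProductState_freeState E).wordElem_eq_zero h1 hne,
        key _ l (by simp [c, (σ j).map_one]) h1 h2]
      simp
    · exact key a (p :: l) ha hl (by simpa using hp)

lemma freeState_isTracial (hσ : ∀ i, (σ i).IsTracial) : (freeState E).IsTracial := by
  let T : Subalgebra ℂ (Free A) :=
    { carrier := {x | ∀ y, (freeState E).toLin (x * y) = (freeState E).toLin (y * x)}
      mul_mem' := fun {x x'} hx hx' y => by rw [mul_assoc, hx, mul_assoc, hx', mul_assoc]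
      add_mem' := fun {x x'} hx hx' y => by rw [add_mul, mul_add, map_add, map_add, hx, hx']
      algebraMap_mem' := fun c y => by rw [Algebra.commutes] }
  refine fun x => mem_of_incl_mem T (fun i a => ?_) x
  suffices h : ∀ a : A i, (σ i).toLin a = 0 → incl A i a ∈ T by
    have h1 : incl A i a = incl A i (a - (σ i).toLin a • 1) +
        algebraMap ℂ (Free A) ((σ i).toLin a) := by
      rw [map_sub, map_smul, map_one, Algebra.algebraMap_eq_smul_one, sub_add_cancel]
    rw [h1]
    exact add_mem (h _ (by simp [(σ i).map_one])) (T.algebraMap_mem _)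
  intro a ha
  have h : (freeState E).toLin ∘ₗ LinearMap.mulLeft ℂ (incl A i a) =
      (freeState E).toLin ∘ₗ LinearMap.mulRight ℂ (incl A i a) := by
    refine (wordBasis E).ext fun w => ?_
    rw [wordBasis_apply]
    obtain ⟨l, hl⟩ := w
    simp only [LinearMap.comp_apply, LinearMap.mulLeft_apply, LinearMap.mulRight_apply]
    rcases lt_or_ge l.length 2 with hlen | hlen
    · match l, hl, hlen with
      | [], _, _ => simp [wordElem]
      | [⟨j, s⟩], _, _ =>
        have h1 : wordElem [(⟨j, s⟩ : Letter E)] = incl A j ((E j).e (some s)) := by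
          simp [wordElem, letterElem]
        rw [h1]
        by_cases hij : i = j
        · subst hij
          rw [← map_mul, ← map_mul, freeState_incl, freeState_incl, hσ]
        · have h2 := freeState_alternating E [⟨i, a⟩, ⟨j, (E j).e (some s)⟩] (by simp)
            (by simpa using hij) (by simpa using ⟨ha, toLin_e_some E j s⟩)
          have h3 := freeState_alternating E [⟨j, (E j).e (some s)⟩, ⟨i, a⟩] (by simp)
            (by simpa using Ne.symm hij) (by simpa using ⟨toLin_e_some E j s, ha⟩)
          simp only [List.map_cons, List.map_nil, List.prod_cons, List.prod_nil, mul_one] at h2 h3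
          rw [h2, h3]
      | _ :: _ :: _, _, hlen => simp at hlen
    · have ha' : (σ i).toLin (star a) = 0 := by
        have := (σ i).conj_symm a 1
        rw [star_one, one_mul, mul_one, ha, map_zero] at this
        exact this.symm
      have hrev : IsWord l.reverse := by
        rw [IsWord, List.isChain_reverse]
        exact hl.imp fun _ _ h => h.symm
      rw [freeState_incl_mul_wordElem E ha hl hlen, ← star_star (wordElem l * incl A i a),
        freeState_star, star_mul, star_incl, star_wordElem,
        freeState_incl_mul_wordElem E ha' hrev (by simpa using hlen), map_zero]
  exact fun y => DFunLike.congr_fun h y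

end FreeState

/-! ### The filtration of the free product in the basis of words -/

section FreeFiltration

open LinearAlgebra

variable {A : Fin 2 → Type*} [∀ i, Ring (A i)] [∀ i, StarRing (A i)] [∀ i, Algebra ℂ (A i)]
  [∀ i, StarModule ℂ (A i)]
variable {F : ∀ i, StarFiltration (A i)} {σ : ∀ i, RegularState (A i)}
variable (E : ∀ i, AdaptedBasis (F i) (σ i))

variable {E} in
/-- The degree of a letter. -/
def ldeg (p : Letter E) : ℕ := (E p.1).deg (some p.2)

variable {E} in
lemma ldeg_pos (p : Letter E) : 0 < ldeg p := (E p.1).deg_some p.2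

variable {E} in
/-- The degree of a word. -/
def wdeg (l : List (Letter E)) : ℕ := (l.map ldeg).sum

@[simp] lemma wdeg_nil : wdeg ([] : List (Letter E)) = 0 := rfl

@[simp] lemma wdeg_cons (p : Letter E) (l : List (Letter E)) :
    wdeg (p :: l) = ldeg p + wdeg l := by
  simp [wdeg]

@[simp] lemma wdeg_append (l l' : List (Letter E)) : wdeg (l ++ l') = wdeg l + wdeg l' := by
  simp [wdeg]

@[simp] lemma wdeg_reverse (l : List (Letter E)) : wdeg l.reverse = wdeg l := by
  simp [wdeg, List.sum_reverse]

lemma wdeg_wordEquiv {i : Fin 2} (w : WordOff E i) (o : Option (E i).S) :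
    wdeg (wordEquiv E i (w, o)).1 = (E i).deg o + wdeg w.1 := by
  cases o with
  | none => rw [wordEquiv_none, (E i).deg_none, zero_add]
  | some s => rw [wordEquiv_some, wdeg_cons]; rfl

lemma leftAct_degree {i : Fin 2} {m N : ℕ} {a : A i} (ha : a ∈ (F i).space m)
    {v : Word E →₀ ℂ} (hv : ∀ w, N < wdeg w.1 → v w = 0) (w : Word E) (hw : m + N < wdeg w.1) :
    leftAct E i a v w = 0 := by
  obtain ⟨⟨w, o⟩, rfl⟩ := (wordEquiv E i).surjective w
  rw [wdeg_wordEquiv] at hw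
  rw [leftAct_apply]
  by_cases h : wdeg w.1 ≤ N
  · have h1 : expand E i v w ∈ (F i).space (N - wdeg w.1) := by
      refine (E i).mem_space_of_repr fun o ho => ?_
      rw [AdaptedBasis.repr_apply, repr_expand]
      exact hv _ (by rw [wdeg_wordEquiv]; omega)
    exact (E i).repr_eq_zero_of_lt ((F i).mul_mem _ _ a ha _ h1) (by omega)
  · have h1 : expand E i v w = 0 := by
      refine (E i).basis.repr.injective ?_
      ext o
      rw [AdaptedBasis.repr_apply, repr_expand, map_zero]
      exact hv _ (by rw [wdeg_wordEquiv]; omega)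
    rw [h1, mul_zero, mul_zero, map_zero]

lemma toWords_eq_zero_of_mem_wordSpace {l : List (Fin 2 × ℕ)} {x : Free A}
    (hx : x ∈ wordSpace F l) (w : Word E) (hw : (l.map Prod.snd).sum < wdeg w.1) :
    toWords E x w = 0 := by
  suffices h : ∀ (l : List (Fin 2 × ℕ)) (x : Free A), x ∈ wordSpace F l → ∀ (N : ℕ)
      (v : Word E →₀ ℂ), (∀ w, N < wdeg w.1 → v w = 0) →
      ∀ w, (l.map Prod.snd).sum + N < wdeg w.1 → rep E x v w = 0 by
    refine h l x hx 0 _ (fun w hw => ?_) w (by simpa using hw)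
    refine Finsupp.single_eq_of_ne ?_
    rintro rfl
    simp [emptyWord] at hw
  intro l
  induction l with
  | nil =>
    intro x hx N v hv w hw
    obtain ⟨c, rfl⟩ := Submodule.mem_one.mp hx
    rw [AlgHom.commutes, Module.algebraMap_end_apply, Finsupp.smul_apply, hv w (by simpa using hw),
      smul_zero]
  | cons p l ih =>
    intro x hx N v hv w hw
    rw [wordSpace_cons] at hx
    refine Submodule.mul_induction_on hx ?_ ?_
    · rintro _ ⟨a, ha, rfl⟩ y hy
      rw [map_mul, Module.End.mul_apply, AlgHom.toLinearMap_apply, rep_incl]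
      refine leftAct_degree E ha (ih y hy N v hv) w ?_
      simpa [add_assoc] using hw
    · intro x y hx hy
      rw [map_add, LinearMap.add_apply, Finsupp.add_apply, hx, hy, add_zero]

lemma wordElem_mem_freeSpace (l : List (Letter E)) : wordElem l ∈ freeSpace F (wdeg l) := by
  have h : wordElem l ∈ wordSpace F (l.map fun p => (p.1, ldeg p)) := by
    induction l with
    | nil => exact Submodule.mem_one.mpr ⟨1, by simp [wordElem]⟩
    | cons p l ih =>
      rw [List.map_cons, wordSpace_cons, wordElem_cons]
      exact Submodule.mul_mem_mul ⟨_, (E p.1).e_mem (some p.2), rfl⟩ ih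
  refine wordSpace_le F _ (le_of_eq ?_) h
  rw [List.map_map]
  rfl

lemma mem_freeSpace_iff {n : ℕ} {x : Free A} :
    x ∈ freeSpace F n ↔ ∀ w, n < wdeg w.1 → toWords E x w = 0 := by
  constructor
  · intro hx w hw
    have h : freeSpace F n ≤ LinearMap.ker (Finsupp.lapply w ∘ₗ toWords E) :=
      iSup₂_le fun l hl y hy =>
        toWords_eq_zero_of_mem_wordSpace E hy w (hl.2.trans_lt hw)
    exact h hx
  · intro h
    rw [← ofWords_toWords E x, ofWords, Finsupp.linearCombination_apply]
    refine sum_mem fun w hw => Submodule.smul_mem _ _ (freeSpace_mono F ?_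
      (wordElem_mem_freeSpace E w.1))
    by_contra hlt
    exact (Finsupp.mem_support_iff.mp hw) (h w (not_le.mp hlt))

lemma toWords_ofWords (v : Word E →₀ ℂ) : toWords E (ofWords E v) = v :=
  (wordBasis E).repr.apply_symm_apply v

lemma Q_freeState (n : ℕ) (x : Free A) :
    Q (freeFiltration F) (freeState E) n ((freeState E).vec x) =
      (freeState E).vec (ofWords E ((toWords E x).filter fun w => wdeg w.1 ≤ n)) := by
  refine Submodule.eq_starProjection_of_mem_of_inner_eq_zero ?_ ?_
  · refine (vec_mem_spaceL2 _ _).mpr ((mem_freeSpace_iff E).mpr fun w hw => ?_)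
    rw [toWords_ofWords, Finsupp.filter_apply, if_neg (not_le.mpr hw)]
  · rintro _ ⟨y, hy, rfl⟩
    rw [← map_sub, RegularState.inner_vec]
    refine (freeLin_star_mul E _ _).trans (Finset.sum_eq_zero fun w _ => ?_)
    by_cases hw : wdeg w.1 ≤ n
    · rw [map_sub, toWords_ofWords, Finsupp.sub_apply, Finsupp.filter_apply, if_pos hw]
      simp
    · simp only [(mem_freeSpace_iff E).mp hy w (not_le.mp hw), mul_zero]

/-- The projection `P_n` restricts the coordinates to the words of degree `n`. -/
lemma P_freeState (n : ℕ) (x : Free A) :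
    P (freeFiltration F) (freeState E) n ((freeState E).vec x) =
      (freeState E).vec (ofWords E ((toWords E x).filter fun w => wdeg w.1 = n)) := by
  cases n with
  | zero => simp only [P, Q_freeState, Nat.le_zero]
  | succ n =>
    rw [P, sub_apply, Q_freeState, Q_freeState, ← map_sub, ← map_sub]
    congr 2
    ext w
    simp only [Finsupp.sub_apply, Finsupp.filter_apply]
    split_ifs <;> first | omega | simp

lemma norm_vec_freeState_sq (x : Free A) (s : Finset (Word E)) (hs : ∀ w, toWords E x w ≠ 0 → w ∈ s) :
    ‖(freeState E).vec x‖ ^ 2 = ∑ w ∈ s, ‖toWords E x w‖ ^ 2 := by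
  rw [norm_vec_sq]
  change (freeLin E (star x * x)).re = _
  rw [freeLin_star_mul, ip_self, Complex.ofReal_re]
  refine Finset.sum_subset (fun w hw => hs w (Finsupp.mem_support_iff.mp hw)) fun w _ hw => ?_
  rw [Finsupp.notMem_support_iff.mp hw]
  simp

/-- There are finitely many words of each degree. -/
lemma finite_wdeg_le (n : ℕ) : {l : List (Letter E) | wdeg l ≤ n}.Finite := by
  have hfin : {p : Letter E | ldeg p ≤ n}.Finite := by
    have h1 : ∀ i, {s : (E i).S | (E i).deg (some s) ≤ n}.Finite := fun i =>
      ((E i).finite n).preimage (Option.some_injective _).injOn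
    refine (Set.finite_iUnion fun i => (h1 i).image (Sigma.mk i)).subset ?_
    rintro ⟨i, s⟩ h
    exact Set.mem_iUnion.mpr ⟨i, s, h, rfl⟩
  have := hfin.to_subtype
  refine ((List.finite_length_le {p : Letter E | ldeg p ≤ n} n).image
    (List.map Subtype.val)).subset fun l hl => ?_
  have hl : wdeg l ≤ n := hl
  have h1 : ∀ p ∈ l, p ∈ {p : Letter E | ldeg p ≤ n} := fun p hp =>
    (List.single_le_sum (by simp) _ (List.mem_map_of_mem hp)).trans hl
  refine ⟨l.attachWith _ h1, ?_, List.attachWith_map_subtype_val h1⟩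
  have h2 : l.length ≤ wdeg l := by
    clear * -
    induction l with
    | nil => simp
    | cons p l ih =>
      have := ldeg_pos p
      simp only [List.length_cons, wdeg_cons]
      omega
  change (l.attachWith _ h1).length ≤ n
  rw [List.length_attachWith]
  exact h2.trans hl

end FreeFiltration

/-! ### Cancellation and merging in products of words -/

section Combinatorics

variable {α : Type*} (δ : α → ℕ)

/-- The total weight of a list of letters. -/
def wt (l : List α) : ℕ := (l.map δ).sum

@[simp] lemma wt_nil : wt δ [] = 0 := rfl

@[simp] lemma wt_cons (p : α) (l : List α) : wt δ (p :: l) = δ p + wt δ l := by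
  simp [wt]

@[simp] lemma wt_append (l l' : List α) : wt δ (l ++ l') = wt δ l + wt δ l' := by
  simp [wt]

@[simp] lemma wt_reverse (l : List α) : wt δ l.reverse = wt δ l := by
  simp [wt, List.sum_reverse]

lemma split_unique {a c a' c' : List α} {r r' : α} (h : a ++ r :: c = a' ++ r' :: c') :
    (a = a' ∧ r = r' ∧ c = c') ∨ wt δ a + δ r ≤ wt δ a' ∨ wt δ a' + δ r' ≤ wt δ a := by
  rcases List.append_eq_append_iff.mp h with ⟨d, h1, h2⟩ | ⟨d, h1, h2⟩
  · cases d with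
    | nil => simp_all
    | cons q d =>
      obtain ⟨rfl, -⟩ := List.cons.inj (by simpa using h2)
      right; left
      simp [h1, ← add_assoc]
  · cases d with
    | nil => simp_all
    | cons q d =>
      obtain ⟨rfl, -⟩ := List.cons.inj (by simpa using h2)
      right; right
      simp [h1, ← add_assoc]

lemma split_cut {a c a' c' : List α} {r : α} (h : a ++ r :: c = a' ++ c') :
    wt δ a' ≤ wt δ a ∨ wt δ a + δ r ≤ wt δ a' := by
  rcases List.append_eq_append_iff.mp h with ⟨d, h1, h2⟩ | ⟨d, h1, h2⟩
  · cases d with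
    | nil => simp_all
    | cons q d =>
      obtain ⟨rfl, -⟩ := List.cons.inj (by simpa using h2)
      right
      simp [h1, ← add_assoc]
  · left
    simp [h1]

lemma cut_unique (hδ : ∀ p, 0 < δ p) {a c a' c' : List α} (h : a ++ c = a' ++ c')
    (hw : wt δ a = wt δ a') : a = a' ∧ c = c' := by
  have key : ∀ d : List α, wt δ d = 0 → d = [] := by
    rintro (_ | ⟨p, d⟩) h
    · rfl
    · have := hδ p
      simp at h
      omega
  rcases List.append_eq_append_iff.mp h with ⟨d, h1, h2⟩ | ⟨d, h1, h2⟩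
  · have := key d (by simpa [h1] using hw)
    simp_all
  · have := key d (by simpa [h1] using hw.symm)
    simp_all

lemma sum_norm_sq_fiber_le {ι β : Type*} [DecidableEq β] (s : Finset ι) (Y : Finset β)
    (Θ : ι → β) (g : ι → ℂ)
    (hinj : ∀ a ∈ s, ∀ b ∈ s, g a ≠ 0 → g b ≠ 0 → Θ a = Θ b → a = b) :
    ∑ y ∈ Y, ‖∑ a ∈ s, if Θ a = y then g a else 0‖ ^ 2 ≤ ∑ a ∈ s, ‖g a‖ ^ 2 := by
  have h : ∀ y, ‖∑ a ∈ s, if Θ a = y then g a else 0‖ ^ 2 =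
      ∑ a ∈ s, if Θ a = y then ‖g a‖ ^ 2 else 0 := by
    intro y
    by_cases hy : ∃ a ∈ s, Θ a = y ∧ g a ≠ 0
    · obtain ⟨a, ha, rfl, hga⟩ := hy
      have h0 : ∀ b ∈ s, b ≠ a → Θ b = Θ a → g b = 0 := fun b hb hba hΘ => by
        by_contra hgb
        exact hba (hinj b hb a ha hgb hga hΘ)
      rw [Finset.sum_eq_single_of_mem a ha fun b hb hba => by
          split_ifs with hΘ
          · exact h0 b hb hba hΘ
          · rfl,
        Finset.sum_eq_single_of_mem a ha fun b hb hba => by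
          split_ifs with hΘ
          · rw [h0 b hb hba hΘ]; simp
          · rfl]
      simp
    · have h0 : ∀ b ∈ s, Θ b = y → g b = 0 := fun b hb hΘ => by
        by_contra hgb
        exact hy ⟨b, hb, hΘ, hgb⟩
      rw [Finset.sum_eq_zero fun b hb => by
          split_ifs with hΘ
          · exact h0 b hb hΘ
          · rfl,
        Finset.sum_eq_zero fun b hb => by
          split_ifs with hΘ
          · rw [h0 b hb hΘ]; simp
          · rfl]
      simp
  simp only [h]
  rw [Finset.sum_comm]
  refine Finset.sum_le_sum fun a _ => ?_
  rw [Finset.sum_ite_eq]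
  split_ifs
  · exact le_rfl
  · positivity

/-- The triangle inequality followed by the Cauchy-Schwarz inequality. -/
lemma sum_norm_sq_sum_le {ι κ : Type*} (U : Finset ι) (R : Finset κ) (v : ι → κ → ℂ)
    (p q : ι → ℝ) {C : ℝ} (hp : ∀ b ∈ U, 0 ≤ p b) (hq : ∀ b ∈ U, 0 ≤ q b)
    (h : ∀ b ∈ U, ∑ r ∈ R, ‖v b r‖ ^ 2 ≤ C ^ 2 * p b * q b) :
    ∑ r ∈ R, ‖∑ b ∈ U, v b r‖ ^ 2 ≤ C ^ 2 * (∑ b ∈ U, p b) * ∑ b ∈ U, q b := by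
  let w : ι → EuclideanSpace ℂ R := fun b => WithLp.toLp 2 fun r => v b r
  have hw : ∀ b, ‖w b‖ ^ 2 = ∑ r ∈ R, ‖v b r‖ ^ 2 := fun b => by
    rw [EuclideanSpace.norm_sq_eq]
    exact Finset.sum_coe_sort R fun r => ‖v b r‖ ^ 2
  have hsum : ‖∑ b ∈ U, w b‖ ^ 2 = ∑ r ∈ R, ‖∑ b ∈ U, v b r‖ ^ 2 := by
    rw [EuclideanSpace.norm_sq_eq, ← Finset.sum_coe_sort R fun r => ‖∑ b ∈ U, v b r‖ ^ 2]
    refine Finset.sum_congr rfl fun r _ => ?_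
    rw [WithLp.ofLp_sum, Finset.sum_apply]
  have hb : ∀ b ∈ U, ‖w b‖ ≤ |C| * (√(p b) * √(q b)) := fun b hb => by
    refine (sq_le_sq₀ (norm_nonneg _) (by positivity)).mp ?_
    rw [hw, mul_pow, mul_pow, Real.sq_sqrt (hp b hb), Real.sq_sqrt (hq b hb), sq_abs, ← mul_assoc]
    exact h b hb
  have h1 : ‖∑ b ∈ U, w b‖ ≤ |C| * (√(∑ b ∈ U, p b) * √(∑ b ∈ U, q b)) := by
    refine (norm_sum_le_of_le _ hb).trans ?_
    rw [← Finset.mul_sum]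
    refine mul_le_mul_of_nonneg_left ((Real.sum_mul_le_sqrt_mul_sqrt _ _ _).trans_eq ?_)
      (abs_nonneg C)
    rw [Finset.sum_congr rfl fun b hb => Real.sq_sqrt (hp b hb),
      Finset.sum_congr rfl fun b hb => Real.sq_sqrt (hq b hb)]
  rw [← hsum]
  refine (pow_le_pow_left₀ (norm_nonneg _) h1 2).trans_eq ?_
  rw [mul_pow, mul_pow, Real.sq_sqrt (Finset.sum_nonneg hp), Real.sq_sqrt (Finset.sum_nonneg hq),
    sq_abs, mul_assoc]

variable (cc : α → α → α → ℂ) (U : Finset (List α)) (T : Finset α)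

/-- The Haagerup-type condition in coordinates, for multiplication with structure constants
`cc`. -/
def MergeBound (C : ℝ) : Prop :=
  ∀ (ξ η : α → ℂ) (i j d : ℕ), (∀ s, ξ s ≠ 0 → δ s = i) → (∀ t, η t ≠ 0 → δ t = j) →
    ∑ r ∈ T with δ r = d, ‖∑ s ∈ T, ∑ t ∈ T, cc s t r * (ξ s * η t)‖ ^ 2 ≤
      C ^ 2 * (∑ s ∈ T, ‖ξ s‖ ^ 2) * ∑ t ∈ T, ‖η t‖ ^ 2

/-- The coefficient of `a r c` in the sum of the products of `a s b` and `b⁻¹ t c` in which `b`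
cancels and the letters `s`, `t` merge to the letter `r`; here `b⁻¹` is the reversed word. -/
def merge (X f : List α → α → List α → ℂ) (a : List α) (r : α) (c : List α) : ℂ :=
  ∑ b ∈ U, ∑ s ∈ T, ∑ t ∈ T, cc s t r * (X a s b * f b.reverse t c)

variable {δ cc U T}

lemma sum_norm_sq_merge_le {C : ℝ} (hH : MergeBound δ cc T C)
    (hU : ∀ l ∈ U, l.reverse ∈ U) {X f : List α → α → List α → ℂ} {k n : ℕ} (m : ℕ)
    (hX : ∀ a s b, X a s b ≠ 0 → wt δ a + δ s + wt δ b = k)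
    (hf : ∀ a s b, f a s b ≠ 0 → wt δ a + δ s + wt δ b = n) :
    ∑ x ∈ U ×ˢ T ×ˢ U with wt δ x.1 + δ x.2.1 + wt δ x.2.2 = m,
        ‖merge cc U T X f x.1 x.2.1 x.2.2‖ ^ 2 ≤
      C ^ 2 * (∑ x ∈ U ×ˢ T ×ˢ U, ‖X x.1 x.2.1 x.2.2‖ ^ 2) *
        ∑ x ∈ U ×ˢ T ×ˢ U, ‖f x.1 x.2.1 x.2.2‖ ^ 2 := by
  have key : ∀ a c, ∑ r ∈ T with wt δ a + δ r + wt δ c = m, ‖merge cc U T X f a r c‖ ^ 2 ≤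
      C ^ 2 * (∑ s ∈ T, ∑ b ∈ U, ‖X a s b‖ ^ 2) * ∑ t ∈ T, ∑ b ∈ U, ‖f b t c‖ ^ 2 := by
    intro a c
    have hrev : ∀ t, ∑ b ∈ U, ‖f b.reverse t c‖ ^ 2 = ∑ b ∈ U, ‖f b t c‖ ^ 2 := fun t =>
      Finset.sum_nbij' List.reverse List.reverse hU hU (by simp) (by simp) (by simp)
    have h1 := sum_norm_sq_sum_le U ({r ∈ T | wt δ a + δ r + wt δ c = m})
      (fun b r => ∑ s ∈ T, ∑ t ∈ T, cc s t r * (X a s b * f b.reverse t c))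
      (fun b => ∑ s ∈ T, ‖X a s b‖ ^ 2) (fun b => ∑ t ∈ T, ‖f b.reverse t c‖ ^ 2) (C := C)
      (fun b _ => by positivity) (fun b _ => by positivity) fun b _ => by
        refine le_trans ?_ (hH (fun s => X a s b) (fun t => f b.reverse t c)
          (k - wt δ a - wt δ b) (n - wt δ b - wt δ c) (m - wt δ a - wt δ c)
          (fun s hs => by have := hX _ _ _ hs; omega)
          (fun t ht => by have := hf _ _ _ ht; rw [wt_reverse] at this; omega))
        refine Finset.sum_le_sum_of_subset_of_nonneg (fun r hr => ?_) fun _ _ _ => by positivity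
        rw [Finset.mem_filter] at hr ⊢
        exact ⟨hr.1, by omega⟩
    rw [Finset.sum_comm (s := U) (t := T), Finset.sum_comm (s := U) (t := T)] at h1
    simp only [hrev] at h1
    exact h1
  calc _ = ∑ a ∈ U, ∑ c ∈ U, ∑ r ∈ T with wt δ a + δ r + wt δ c = m,
        ‖merge cc U T X f a r c‖ ^ 2 := by
        rw [Finset.sum_filter, Finset.sum_product]
        refine Finset.sum_congr rfl fun a _ => ?_
        rw [Finset.sum_product, Finset.sum_comm]
        simp only [Finset.sum_filter]
    _ ≤ ∑ a ∈ U, ∑ c ∈ U,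
        C ^ 2 * (∑ s ∈ T, ∑ b ∈ U, ‖X a s b‖ ^ 2) * ∑ t ∈ T, ∑ b ∈ U, ‖f b t c‖ ^ 2 :=
        Finset.sum_le_sum fun a _ => Finset.sum_le_sum fun c _ => key a c
    _ = _ := by
        simp only [← Finset.mul_sum, ← Finset.sum_mul]
        congr 1
        · simp only [Finset.sum_product]
        · simp only [Finset.sum_product]
          rw [Finset.sum_comm]
          conv_rhs => rw [Finset.sum_comm]
          exact Finset.sum_congr rfl fun t _ => Finset.sum_comm

variable (δ) in
/-- The value of `X` at the words `a s b` with a distinguished letter `s`, restricted to those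
for which the weights of `a` and `s` satisfy the condition `p`. -/
def mark (p : ℕ → ℕ → Prop) (X : List α → ℂ) (a : List α) (s : α) (b : List α) : ℂ :=
  open Classical in if p (wt δ a) (δ s) then X (a ++ s :: b) else 0

/-- The condition `p` singles out at most one letter of each word. -/
def Exclusive (p : ℕ → ℕ → Prop) : Prop :=
  ∀ a s a' s', 0 < s → 0 < s' → p a s → p a' s' → a' < a + s

lemma Exclusive.eq (hδ : ∀ p, 0 < δ p) {p : ℕ → ℕ → Prop} (hp : Exclusive p)
    {a c a' c' : List α} {r r' : α} (h1 : p (wt δ a) (δ r)) (h2 : p (wt δ a') (δ r'))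
    (h : a ++ r :: c = a' ++ r' :: c') : a = a' ∧ r = r' ∧ c = c' := by
  have e1 := hp _ _ _ _ (hδ r) (hδ r') h1 h2
  have e2 := hp _ _ _ _ (hδ r') (hδ r) h2 h1
  rcases split_unique δ h with h | h | h
  · exact h
  · omega
  · omega

lemma sum_norm_sq_mark_le (hδ : ∀ p, 0 < δ p) {p : ℕ → ℕ → Prop} (hp : Exclusive p)
    {X : List α → ℂ} (hX : ∀ u, X u ≠ 0 → u ∈ U) (B : List α → Prop)
    [DecidablePred B]
    (hB : ∀ a s b, p (wt δ a) (δ s) → X (a ++ s :: b) ≠ 0 → B (a ++ s :: b)) :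
    ∑ x ∈ U ×ˢ T ×ˢ U, ‖mark δ p X x.1 x.2.1 x.2.2‖ ^ 2 ≤ ∑ u ∈ U with B u, ‖X u‖ ^ 2 := by
  have h0 : ∀ x : List α × α × List α, ‖mark δ p X x.1 x.2.1 x.2.2‖ ^ 2 ≠ 0 →
      p (wt δ x.1) (δ x.2.1) ∧ X (x.1 ++ x.2.1 :: x.2.2) ≠ 0 := fun x hx => by
    simpa [mark] using hx
  refine sum_le_sum_of_injOn_support (fun x => x.1 ++ x.2.1 :: x.2.2) (fun _ _ => by positivity)
    (fun x _ hx => ?_) fun x _ y _ hx hy hxy => ?_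
  · obtain ⟨h1, h2⟩ := h0 x hx
    exact ⟨Finset.mem_filter.mpr ⟨hX _ h2, hB _ _ _ h1 h2⟩, by simp [mark, h1]⟩
  · obtain ⟨e1, e2, e3⟩ := hp.eq hδ (h0 x hx).1 (h0 y hy).1 hxy
    exact Prod.ext e1 (Prod.ext e2 e3)

end Combinatorics

/-! ### The combinatorial estimate -/

section Estimate

variable {α : Type*} {δ : α → ℕ} {cc : α → α → α → ℂ} {U : Finset (List α)} {T : Finset α}

variable (cc U T) in
/-- The coefficient of `y` in the sum of the products of `a b` and `b⁻¹ c` in which `b` cancels. -/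
def cancelSum (X f : List α → ℂ) (y : List α) : ℂ :=
  open Classical in
  ∑ x ∈ U ×ˢ U, if x.1 ++ x.2 = y then ∑ b ∈ U, X (x.1 ++ b) * f (b.reverse ++ x.2) else 0

variable (δ cc U T) in
/-- The coefficient of `y` in the sum of the products of `a s b` and `b⁻¹ t c` in which `b`
cancels and `s`, `t` merge to a letter `r`, restricted to those for which the weights of `a` and
`r` satisfy the condition `q`. -/
def mergeSum (q : ℕ → ℕ → Prop) (X f : List α → ℂ) (y : List α) : ℂ :=
  open Classical in
  ∑ x ∈ U ×ˢ T ×ˢ U, if x.1 ++ x.2.1 :: x.2.2 = y then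
    (if q (wt δ x.1) (δ x.2.1) then
      merge cc U T (fun a s b => X (a ++ s :: b)) (fun a s b => f (a ++ s :: b)) x.1 x.2.1 x.2.2
    else 0) else 0

lemma sum_norm_sq_mergeSum_le {C : ℝ} (hH : MergeBound δ cc T C) (hδ : ∀ p, 0 < δ p)
    (hU : ∀ l ∈ U, l.reverse ∈ U) {X f : List α → ℂ} {k n m : ℕ}
    (hX : ∀ u, X u ≠ 0 → u ∈ U ∧ wt δ u = k) (hf : ∀ u, f u ≠ 0 → u ∈ U ∧ wt δ u = n)
    {Y : Finset (List α)} (hY : ∀ y ∈ Y, wt δ y = m) {q p₁ p₂ : ℕ → ℕ → Prop}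
    (hq : Exclusive q) (h₁ : Exclusive p₁) (h₂ : Exclusive p₂)
    (hp : ∀ a b c s t r, cc s t r ≠ 0 → wt δ a + δ s + wt δ b = k → wt δ b + δ t + wt δ c = n →
      wt δ a + δ r + wt δ c = m → q (wt δ a) (δ r) → p₁ (wt δ a) (δ s) ∧ p₂ (wt δ b) (δ t))
    (B₁ B₂ : List α → Prop) [DecidablePred B₁] [DecidablePred B₂]
    (hB₁ : ∀ a s b, p₁ (wt δ a) (δ s) → X (a ++ s :: b) ≠ 0 → B₁ (a ++ s :: b))
    (hB₂ : ∀ a s b, p₂ (wt δ a) (δ s) → f (a ++ s :: b) ≠ 0 → B₂ (a ++ s :: b)) :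
    ∑ y ∈ Y, ‖mergeSum δ cc U T q X f y‖ ^ 2 ≤
      C ^ 2 * (∑ u ∈ U with B₁ u, ‖X u‖ ^ 2) * ∑ u ∈ U with B₂ u, ‖f u‖ ^ 2 := by
  classical
  let g : List α × α × List α → ℂ := fun x =>
    if q (wt δ x.1) (δ x.2.1) ∧ wt δ x.1 + δ x.2.1 + wt δ x.2.2 = m then
      merge cc U T (mark δ p₁ X) (mark δ p₂ f) x.1 x.2.1 x.2.2 else 0
  have hsum : ∀ y ∈ Y, mergeSum δ cc U T q X f y =
      ∑ x ∈ U ×ˢ T ×ˢ U, if x.1 ++ x.2.1 :: x.2.2 = y then g x else 0 := by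
    intro y hy
    refine Finset.sum_congr rfl fun x _ => ?_
    by_cases hxy : x.1 ++ x.2.1 :: x.2.2 = y
    · have hm : wt δ x.1 + δ x.2.1 + wt δ x.2.2 = m := by
        rw [← hY y hy, ← hxy]; simp [add_assoc]
      by_cases hqx : q (wt δ x.1) (δ x.2.1)
      · rw [if_pos hxy, if_pos hqx, if_pos hxy]
        simp only [g]
        rw [if_pos ⟨hqx, hm⟩, merge, merge]
        refine Finset.sum_congr rfl fun b _ => Finset.sum_congr rfl fun s _ =>
          Finset.sum_congr rfl fun t _ => ?_
        by_cases h0 : cc s t x.2.1 = 0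
        · simp [h0]
        by_cases h1 : X (x.1 ++ s :: b) = 0
        · simp [h1, mark]
        by_cases h2 : f (b.reverse ++ t :: x.2.2) = 0
        · simp [h2, mark]
        have w1 := (hX _ h1).2
        have w2 := (hf _ h2).2
        simp only [wt_append, wt_cons, wt_reverse] at w1 w2
        obtain ⟨e1, e2⟩ := hp x.1 b x.2.2 s t x.2.1 h0 (by omega) (by omega) hm hqx
        simp [mark, e1, e2]
      · simp [hqx, g]
    · simp [hxy]
  have hinj := sum_norm_sq_fiber_le (U ×ˢ T ×ˢ U) Y (fun x => x.1 ++ x.2.1 :: x.2.2) g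
    fun x _ x' _ hx hx' h => by
      have e : ∀ x, g x ≠ 0 → q (wt δ x.1) (δ x.2.1) := fun x hx => by
        by_contra h
        simp [g, h] at hx
      obtain ⟨e1, e2, e3⟩ := hq.eq hδ (e x hx) (e x' hx') h
      exact Prod.ext e1 (Prod.ext e2 e3)
  have hle : ∑ y ∈ Y, ‖mergeSum δ cc U T q X f y‖ ^ 2 ≤ ∑ x ∈ U ×ˢ T ×ˢ U, ‖g x‖ ^ 2 := by
    refine le_of_eq_of_le (Finset.sum_congr rfl fun y hy => ?_) hinj
    rw [hsum y hy]
  refine hle.trans ?_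
  have h3 := sum_norm_sq_merge_le hH hU (X := mark δ p₁ X) (f := mark δ p₂ f) (k := k) (n := n) m
    (fun a s b h => by
      by_cases h0 : X (a ++ s :: b) = 0
      · simp [mark, h0] at h
      · have := (hX _ h0).2
        simp only [wt_append, wt_cons] at this
        omega)
    (fun a s b h => by
      by_cases h0 : f (a ++ s :: b) = 0
      · simp [mark, h0] at h
      · have := (hf _ h0).2
        simp only [wt_append, wt_cons] at this
        omega)
  calc _ ≤ ∑ x ∈ U ×ˢ T ×ˢ U with wt δ x.1 + δ x.2.1 + wt δ x.2.2 = m,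
        ‖merge cc U T (mark δ p₁ X) (mark δ p₂ f) x.1 x.2.1 x.2.2‖ ^ 2 := by
        rw [Finset.sum_filter]
        refine Finset.sum_le_sum fun x _ => ?_
        by_cases h1 : wt δ x.1 + δ x.2.1 + wt δ x.2.2 = m
        · by_cases h2 : q (wt δ x.1) (δ x.2.1)
          · simp [g, h1, h2]
          · simp [g, h1, h2]
        · simp [g, h1]
    _ ≤ _ := h3
    _ ≤ _ := by
        have i1 := sum_norm_sq_mark_le (T := T) hδ h₁ (fun u hu => (hX u hu).1) B₁ hB₁
        have i2 := sum_norm_sq_mark_le (T := T) hδ h₂ (fun u hu => (hf u hu).1) B₂ hB₂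
        gcongr

open Classical in
lemma sum_norm_sq_cancelSum_le (hδ : ∀ p, 0 < δ p)
    (hU : ∀ l ∈ U, l.reverse ∈ U) {X f : List α → ℂ} {k n m : ℕ}
    (hX : ∀ u, X u ≠ 0 → u ∈ U ∧ wt δ u = k) (hf : ∀ u, f u ≠ 0 → u ∈ U ∧ wt δ u = n)
    {Y : Finset (List α)} (hY : ∀ y ∈ Y, wt δ y = m) :
    ∑ y ∈ Y, ‖cancelSum U X f y‖ ^ 2 ≤
      (∑ u ∈ U with ∃ a b, u = a ++ b ∧ 2 * wt δ a + n = k + m, ‖X u‖ ^ 2) *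
        ∑ u ∈ U with ∃ a b, u = a ++ b ∧ 2 * wt δ a + m = k + n, ‖f u‖ ^ 2 := by
  let ξ : List α → List α → ℂ := fun a b => if 2 * wt δ a + n = k + m then X (a ++ b) else 0
  let η : List α → List α → ℂ := fun b c => if 2 * wt δ b + m = k + n then f (b ++ c) else 0
  let g : List α × List α → ℂ := fun x => ∑ b ∈ U, ξ x.1 b * η b.reverse x.2
  have hsum : ∀ y ∈ Y, cancelSum U X f y =
      ∑ x ∈ U ×ˢ U, if x.1 ++ x.2 = y then g x else 0 := by
    intro y hy
    refine Finset.sum_congr rfl fun x _ => ?_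
    by_cases hxy : x.1 ++ x.2 = y
    · have hm : wt δ x.1 + wt δ x.2 = m := by
        rw [← hY y hy, ← hxy]; simp
      simp only [if_pos hxy, g]
      refine Finset.sum_congr rfl fun b _ => ?_
      by_cases h1 : X (x.1 ++ b) = 0
      · simp [h1, ξ]
      by_cases h2 : f (b.reverse ++ x.2) = 0
      · simp [h2, η]
      have w1 := (hX _ h1).2
      have w2 := (hf _ h2).2
      simp only [wt_append, wt_reverse] at w1 w2
      have e1 : 2 * wt δ x.1 + n = k + m := by omega
      have e2 : 2 * wt δ b + m = k + n := by omega
      simp [ξ, η, e1, e2]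
    · simp [hxy]
  have hinj := sum_norm_sq_fiber_le (U ×ˢ U) Y (fun x => x.1 ++ x.2) g
    fun x _ x' _ hx hx' h => by
      have e : ∀ x, g x ≠ 0 → 2 * wt δ x.1 + n = k + m := fun x hx => by
        by_contra h
        simp [g, ξ, h] at hx
      obtain ⟨e1, e2⟩ := cut_unique δ hδ h (by have := e x hx; have := e x' hx'; omega)
      exact Prod.ext e1 e2
  have hle : ∑ y ∈ Y, ‖cancelSum U X f y‖ ^ 2 ≤ ∑ x ∈ U ×ˢ U, ‖g x‖ ^ 2 := by
    refine le_of_eq_of_le (Finset.sum_congr rfl fun y hy => ?_) hinj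
    rw [hsum y hy]
  refine hle.trans ?_
  have hcs : ∀ x : List α × List α, ‖g x‖ ^ 2 ≤
      (∑ b ∈ U, ‖ξ x.1 b‖ ^ 2) * ∑ b ∈ U, ‖η b x.2‖ ^ 2 := fun x => by
    have hrev : ∑ b ∈ U, ‖η b.reverse x.2‖ ^ 2 = ∑ b ∈ U, ‖η b x.2‖ ^ 2 :=
      Finset.sum_nbij' List.reverse List.reverse hU hU (by simp) (by simp) (by simp)
    have := sum_norm_sq_sum_le U ({()} : Finset Unit) (fun b _ => ξ x.1 b * η b.reverse x.2)
      (fun b => ‖ξ x.1 b‖ ^ 2) (fun b => ‖η b.reverse x.2‖ ^ 2) (C := 1)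
      (fun _ _ => by positivity) (fun _ _ => by positivity) (fun b _ => by simp [mul_pow])
    simpa [hrev, g] using this
  have i1 : ∑ x ∈ U ×ˢ U, ‖ξ x.1 x.2‖ ^ 2 ≤
      ∑ u ∈ U with ∃ a b, u = a ++ b ∧ 2 * wt δ a + n = k + m, ‖X u‖ ^ 2 := by
    have h0 : ∀ x : List α × List α, ‖ξ x.1 x.2‖ ^ 2 ≠ 0 →
        2 * wt δ x.1 + n = k + m ∧ X (x.1 ++ x.2) ≠ 0 := fun x hx => by simpa [ξ] using hx
    refine sum_le_sum_of_injOn_support (fun x => x.1 ++ x.2) (fun _ _ => by positivity)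
      (fun x _ hx => ?_) fun x _ y _ hx hy hxy => ?_
    · obtain ⟨h1, h2⟩ := h0 x hx
      exact ⟨Finset.mem_filter.mpr ⟨(hX _ h2).1, _, _, rfl, h1⟩, by simp [ξ, h1]⟩
    · obtain ⟨e1, e2⟩ := cut_unique δ hδ hxy (by have := (h0 x hx).1; have := (h0 y hy).1; omega)
      exact Prod.ext e1 e2
  have i2 : ∑ x ∈ U ×ˢ U, ‖η x.1 x.2‖ ^ 2 ≤
      ∑ u ∈ U with ∃ a b, u = a ++ b ∧ 2 * wt δ a + m = k + n, ‖f u‖ ^ 2 := by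
    have h0 : ∀ x : List α × List α, ‖η x.1 x.2‖ ^ 2 ≠ 0 →
        2 * wt δ x.1 + m = k + n ∧ f (x.1 ++ x.2) ≠ 0 := fun x hx => by simpa [η] using hx
    refine sum_le_sum_of_injOn_support (fun x => x.1 ++ x.2) (fun _ _ => by positivity)
      (fun x _ hx => ?_) fun x _ y _ hx hy hxy => ?_
    · obtain ⟨h1, h2⟩ := h0 x hx
      exact ⟨Finset.mem_filter.mpr ⟨(hf _ h2).1, _, _, rfl, h1⟩, by simp [η, h1]⟩
    · obtain ⟨e1, e2⟩ := cut_unique δ hδ hxy (by have := (h0 x hx).1; have := (h0 y hy).1; omega)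
      exact Prod.ext e1 e2
  calc _ ≤ ∑ x ∈ U ×ˢ U, (∑ b ∈ U, ‖ξ x.1 b‖ ^ 2) * ∑ b ∈ U, ‖η b x.2‖ ^ 2 :=
        Finset.sum_le_sum fun x _ => hcs x
    _ = (∑ x ∈ U ×ˢ U, ‖ξ x.1 x.2‖ ^ 2) * ∑ x ∈ U ×ˢ U, ‖η x.1 x.2‖ ^ 2 := by
        rw [Finset.sum_product (f := fun x => ‖ξ x.1 x.2‖ ^ 2),
          Finset.sum_product_right (f := fun x => ‖η x.1 x.2‖ ^ 2), Finset.sum_mul_sum,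
          Finset.sum_product]
    _ ≤ _ := by gcongr

/-- The sum of the products in which some letters cancel, with or without a merging of two letters
thereafter, satisfies the Haagerup-type condition with constant `2 C`. If a product of a word of
weight `k` and a word of weight `n` has weight `m`, then the relation between `k`, `n` and `m`
tells where in the three words the cancellation ends: at a cut between two letters or inside a
letter. -/
theorem sum_norm_sq_product_le {C : ℝ} (hC : 1 ≤ C) (hH : MergeBound δ cc T C)
    (hδ : ∀ p, 0 < δ p)
    (hcc : ∀ s t r, cc s t r ≠ 0 → δ r ≤ δ s + δ t ∧ δ s ≤ δ r + δ t ∧ δ t ≤ δ s + δ r)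
    (hU : ∀ l ∈ U, l.reverse ∈ U) {X f : List α → ℂ} {k n m : ℕ}
    (hX : ∀ u, X u ≠ 0 → u ∈ U ∧ wt δ u = k) (hf : ∀ u, f u ≠ 0 → u ∈ U ∧ wt δ u = n)
    {Y : Finset (List α)} (hY : ∀ y ∈ Y, wt δ y = m) :
    ∑ y ∈ Y, ‖cancelSum U X f y + mergeSum δ cc U T (fun _ _ => True) X f y‖ ^ 2 ≤
      4 * C ^ 2 * (∑ u ∈ U, ‖X u‖ ^ 2) * ∑ u ∈ U, ‖f u‖ ^ 2 := by
  classical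
  -- The cancellation ends, in the product, at the left end of the merged letter `r`, at its right
  -- end, or strictly inside it. As `2 wt(a) + n - (k + m) = t - s - r` for the weights of the
  -- letters, these are the cases `t = s + r`, `s = r + t`, and `t < s + r`, `s < r + t`.
  let q₁ : ℕ → ℕ → Prop := fun a _ => 2 * a + n = k + m
  let q₂ : ℕ → ℕ → Prop := fun a r => 2 * a + 2 * r + n = k + m
  let q₃ : ℕ → ℕ → Prop := fun a r => 2 * a + n < k + m ∧ k + m < 2 * a + 2 * r + n
  -- The words of the two arguments that have a cut where the cancellation would end. In the case
  -- `q₁` it ends inside the letter `t` of the second argument, in the case `q₂` inside the letter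
  -- `s` of the first, so these words have no such cut.
  let BX : List α → Prop := fun u => ∃ a b, u = a ++ b ∧ 2 * wt δ a + n = k + m
  let Bf : List α → Prop := fun u => ∃ a b, u = a ++ b ∧ 2 * wt δ a + m = k + n
  have h₁ : ∑ y ∈ Y, ‖mergeSum δ cc U T q₁ X f y‖ ^ 2 ≤
      C ^ 2 * (∑ u ∈ U with BX u, ‖X u‖ ^ 2) * ∑ u ∈ U with ¬ Bf u, ‖f u‖ ^ 2 := by
    refine sum_norm_sq_mergeSum_le hH hδ hU hX hf hY (q := q₁) (p₁ := q₁)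
      (p₂ := fun b t => 2 * b + m < k + n ∧ k + n < 2 * b + 2 * t + m)
      (fun a s a' s' _ _ h h' => by simp only [q₁] at h h'; omega)
      (fun a s a' s' _ _ h h' => by simp only [q₁] at h h'; omega)
      (fun a s a' s' _ _ h h' => by omega) (fun a b c s t r h0 w1 w2 w3 hq => ?_) BX
      (fun u => ¬ Bf u)
      (fun a s b h _ => ⟨a, s :: b, rfl, h⟩) (fun a s b h _ => ?_)
    · have := hcc s t r h0
      have := hδ s
      have := hδ t
      have := hδ r
      simp only [q₁] at hq ⊢
      omega
    · rintro ⟨a', b', e, h'⟩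
      rcases split_cut δ e with h2 | h2 <;> omega
  have h₂ : ∑ y ∈ Y, ‖mergeSum δ cc U T q₂ X f y‖ ^ 2 ≤
      C ^ 2 * (∑ u ∈ U with ¬ BX u, ‖X u‖ ^ 2) * ∑ u ∈ U with Bf u, ‖f u‖ ^ 2 := by
    refine sum_norm_sq_mergeSum_le hH hδ hU hX hf hY (q := q₂)
      (p₁ := fun a s => 2 * a + n < k + m ∧ k + m < 2 * a + 2 * s + n)
      (p₂ := fun b t => 2 * b + 2 * t + m = k + n)
      (fun a s a' s' _ _ h h' => by simp only [q₂] at h h'; omega)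
      (fun a s a' s' _ _ h h' => by omega)
      (fun a s a' s' _ _ h h' => by omega) (fun a b c s t r h0 w1 w2 w3 hq => ?_)
      (fun u => ¬ BX u) Bf
      (fun a s b h _ => ?_) (fun a s b h _ => ⟨a ++ [s], b, by simp, by simp; omega⟩)
    · have := hcc s t r h0
      have := hδ s
      have := hδ t
      have := hδ r
      simp only [q₂] at hq
      omega
    · rintro ⟨a', b', e, h'⟩
      rcases split_cut δ e with h2 | h2 <;> omega
  have h₃ : ∑ y ∈ Y, ‖mergeSum δ cc U T q₃ X f y‖ ^ 2 ≤
      C ^ 2 * (∑ u ∈ U, ‖X u‖ ^ 2) * ∑ u ∈ U, ‖f u‖ ^ 2 := by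
    have := sum_norm_sq_mergeSum_le hH hδ hU hX hf hY (q := q₃)
      (p₁ := fun a s => 2 * a + n < k + m ∧ k + m ≤ 2 * a + 2 * s + n)
      (p₂ := fun b t => 2 * b + m ≤ k + n ∧ k + n < 2 * b + 2 * t + m)
      (fun a s a' s' _ _ h h' => by simp only [q₃] at h h'; omega)
      (fun a s a' s' _ _ h h' => by omega)
      (fun a s a' s' _ _ h h' => by omega) (fun a b c s t r h0 w1 w2 w3 hq => by
        have := hcc s t r h0
        simp only [q₃] at hq
        omega) (fun _ => True) (fun _ => True) (fun _ _ _ _ _ => trivial)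
      (fun _ _ _ _ _ => trivial)
    simpa using this
  have h₀ : ∑ y ∈ Y, ‖cancelSum U X f y‖ ^ 2 ≤
      (∑ u ∈ U with BX u, ‖X u‖ ^ 2) * ∑ u ∈ U with Bf u, ‖f u‖ ^ 2 :=
    sum_norm_sq_cancelSum_le hδ hU hX hf hY
  have hsplit : ∀ y ∈ Y, mergeSum δ cc U T (fun _ _ => True) X f y =
      mergeSum δ cc U T q₁ X f y + mergeSum δ cc U T q₂ X f y + mergeSum δ cc U T q₃ X f y := by
    intro y hy
    simp only [mergeSum]
    rw [← Finset.sum_add_distrib, ← Finset.sum_add_distrib]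
    refine Finset.sum_congr rfl fun x _ => ?_
    by_cases hxy : x.1 ++ x.2.1 :: x.2.2 = y
    · simp only [if_pos hxy, if_true]
      set M := merge cc U T (fun a s b => X (a ++ s :: b)) (fun a s b => f (a ++ s :: b))
        x.1 x.2.1 x.2.2 with hM
      by_cases h0 : M = 0
      · simp [h0]
      obtain ⟨b, _, hb⟩ := Finset.exists_ne_zero_of_sum_ne_zero (hM ▸ h0)
      obtain ⟨s, _, hs⟩ := Finset.exists_ne_zero_of_sum_ne_zero hb
      obtain ⟨t, _, ht⟩ := Finset.exists_ne_zero_of_sum_ne_zero hs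
      obtain ⟨e0, e⟩ := mul_ne_zero_iff.mp ht
      obtain ⟨e1, e2⟩ := mul_ne_zero_iff.mp e
      have w0 := hcc _ _ _ e0
      have w1 := (hX _ e1).2
      have w2 := (hf _ e2).2
      have w3 := hY y hy
      have w4 := hδ x.2.1
      simp only [← hxy, wt_append, wt_cons, wt_reverse] at w1 w2 w3
      by_cases c1 : q₁ (wt δ x.1) (δ x.2.1)
      · have c2 : ¬ q₂ (wt δ x.1) (δ x.2.1) := by simp only [q₁, q₂] at c1 ⊢; omega
        have c3 : ¬ q₃ (wt δ x.1) (δ x.2.1) := by simp only [q₁, q₃] at c1 ⊢; omega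
        simp [c1, c2, c3]
      · by_cases c2 : q₂ (wt δ x.1) (δ x.2.1)
        · have c3 : ¬ q₃ (wt δ x.1) (δ x.2.1) := by simp only [q₂, q₃] at c2 ⊢; omega
          simp [c1, c2, c3]
        · have c3 : q₃ (wt δ x.1) (δ x.2.1) := by simp only [q₁, q₂, q₃] at c1 c2 ⊢; omega
          simp [c1, c2, c3]
    · simp [hxy]
  -- The last sum and the three others are not both nonzero at a word.
  have hpt : ∀ y ∈ Y,
      ‖cancelSum U X f y + mergeSum δ cc U T (fun _ _ => True) X f y‖ ^ 2 ≤
        3 * (‖cancelSum U X f y‖ ^ 2 + ‖mergeSum δ cc U T q₁ X f y‖ ^ 2 +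
          ‖mergeSum δ cc U T q₂ X f y‖ ^ 2) + ‖mergeSum δ cc U T q₃ X f y‖ ^ 2 := by
    intro y hy
    rw [hsplit y hy]
    by_cases hB : ∃ a c, y = a ++ c ∧ 2 * wt δ a + n = k + m
    · obtain ⟨a, c, rfl, hac⟩ := hB
      have e : mergeSum δ cc U T q₃ X f (a ++ c) = 0 := by
        refine Finset.sum_eq_zero fun x _ => ?_
        split_ifs with g1 g2
        · exfalso
          simp only [q₃] at g2
          rcases split_cut δ g1 with h2 | h2 <;> omega
        · rfl
        · rfl
      rw [e, add_zero, norm_zero]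
      set p := cancelSum U X f (a ++ c)
      set q := mergeSum δ cc U T q₁ X f (a ++ c)
      set r := mergeSum δ cc U T q₂ X f (a ++ c)
      have t : ‖p + (q + r)‖ ≤ ‖p‖ + ‖q‖ + ‖r‖ := by
        rw [← add_assoc]
        exact norm_add₃_le
      have := pow_le_pow_left₀ (norm_nonneg _) t 2
      nlinarith [sq_nonneg (‖p‖ - ‖q‖), sq_nonneg (‖p‖ - ‖r‖), sq_nonneg (‖q‖ - ‖r‖)]
    · have e0 : cancelSum U X f y = 0 := by
        refine Finset.sum_eq_zero fun x _ => ?_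
        split_ifs with g1
        · refine Finset.sum_eq_zero fun b _ => ?_
          by_contra h
          obtain ⟨e1, e2⟩ := mul_ne_zero_iff.mp h
          have w1 := (hX _ e1).2
          have w2 := (hf _ e2).2
          have w3 := hY y hy
          simp only [← g1, wt_append, wt_reverse] at w1 w2 w3
          exact hB ⟨x.1, x.2, g1.symm, by omega⟩
        · rfl
      have e1 : mergeSum δ cc U T q₁ X f y = 0 := by
        refine Finset.sum_eq_zero fun x _ => ?_
        split_ifs with g1 g2
        · exact absurd ⟨x.1, _, g1.symm, g2⟩ hB
        · rfl
        · rfl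
      have e2 : mergeSum δ cc U T q₂ X f y = 0 := by
        refine Finset.sum_eq_zero fun x _ => ?_
        split_ifs with g1 g2
        · exact absurd ⟨x.1 ++ [x.2.1], x.2.2, by simp [g1], by simp only [q₂] at g2; simp; omega⟩ hB
        · rfl
        · rfl
      simp [e0, e1, e2]
  refine (Finset.sum_le_sum hpt).trans ?_
  rw [Finset.sum_add_distrib, ← Finset.mul_sum, Finset.sum_add_distrib, Finset.sum_add_distrib]
  have eX : ∑ u ∈ U, ‖X u‖ ^ 2 = ∑ u ∈ U with BX u, ‖X u‖ ^ 2 + ∑ u ∈ U with ¬ BX u, ‖X u‖ ^ 2 :=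
    (Finset.sum_filter_add_sum_filter_not _ _ _).symm
  have ef : ∑ u ∈ U, ‖f u‖ ^ 2 = ∑ u ∈ U with Bf u, ‖f u‖ ^ 2 + ∑ u ∈ U with ¬ Bf u, ‖f u‖ ^ 2 :=
    (Finset.sum_filter_add_sum_filter_not _ _ _).symm
  rw [eX, ef] at h₃ ⊢
  have n1 : 0 ≤ ∑ u ∈ U with BX u, ‖X u‖ ^ 2 := by positivity
  have n2 : 0 ≤ ∑ u ∈ U with ¬ BX u, ‖X u‖ ^ 2 := by positivity
  have n3 : 0 ≤ ∑ u ∈ U with Bf u, ‖f u‖ ^ 2 := by positivity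
  have n4 : 0 ≤ ∑ u ∈ U with ¬ Bf u, ‖f u‖ ^ 2 := by positivity
  generalize ∑ u ∈ U with BX u, ‖X u‖ ^ 2 = x at *
  generalize ∑ u ∈ U with ¬ BX u, ‖X u‖ ^ 2 = x' at *
  generalize ∑ u ∈ U with Bf u, ‖f u‖ ^ 2 = z at *
  generalize ∑ u ∈ U with ¬ Bf u, ‖f u‖ ^ 2 = z' at *
  have hC2 : 1 ≤ C ^ 2 := one_le_pow₀ hC
  have p1 : x * z ≤ C ^ 2 * (x * z) := le_mul_of_one_le_left (by positivity) hC2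
  have p2 : 0 ≤ C ^ 2 * (x' * z') := by positivity
  linarith

end Estimate

/-! ### The Haagerup-type condition in an adapted basis -/

section Coordinates

variable {A : Type*} [Ring A] [StarRing A] [Algebra ℂ A] [StarModule ℂ A]
variable {F : StarFiltration A} {σ : RegularState A} (E : AdaptedBasis F σ)

namespace AdaptedBasis

lemma orthonormal_vec : Orthonormal ℂ fun s => σ.vec (E.e s) := by
  classical
  refine orthonormal_iff_ite.mpr fun s t => ?_
  rw [RegularState.inner_vec, E.star_e]
  split_ifs with h
  · rw [h, E.orth_self]
  · exact E.orth_ne s t h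

lemma Q_vec_e_of_lt {n : ℕ} {s : Option E.S} (h : n < E.deg s) : Q F σ n (σ.vec (E.e s)) = 0 := by
  refine (Submodule.eq_starProjection_of_mem_of_inner_eq_zero (zero_mem _) ?_)
  rintro _ ⟨b, hb, rfl⟩
  rw [sub_zero, RegularState.inner_vec, E.star_e]
  exact E.repr_eq_zero_of_lt hb h

lemma P_vec_e (s : Option E.S) : P F σ (E.deg s) (σ.vec (E.e s)) = σ.vec (E.e s) := by
  have h := Q_vec F σ (E.e_mem s)
  cases hd : E.deg s with
  | zero => rwa [hd] at h
  | succ n =>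
    rw [hd] at h
    rw [P, sub_apply, h, E.Q_vec_e_of_lt (by omega), sub_zero]

lemma norm_vec_sum_sq (T : Finset E.S) (ξ : E.S → ℂ) :
    ‖σ.vec (∑ s ∈ T, ξ s • E.e (some s))‖ ^ 2 = ∑ s ∈ T, ‖ξ s‖ ^ 2 := by
  have h := (E.orthonormal_vec.comp some (Option.some_injective _)).inner_sum ξ ξ T
  simp only [Function.comp_apply, ← map_smul, ← map_sum] at h
  rw [inner_self_eq_norm_sq_to_K] at h
  simp only [Complex.conj_mul'] at h
  refine Complex.ofReal_injective ?_
  simpa using h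

lemma comp_sum {n : ℕ} (T : Finset E.S) (ξ : E.S → ℂ) (hξ : ∀ s, ξ s ≠ 0 → E.deg (some s) = n) :
    comp F σ n (∑ s ∈ T, ξ s • E.e (some s)) = ∑ s ∈ T, ξ s • E.e (some s) := by
  refine vec_injective σ ?_
  rw [vec_comp]
  simp only [map_sum, map_smul]
  refine Finset.sum_congr rfl fun s _ => ?_
  by_cases h : ξ s = 0
  · simp [h]
  · rw [← hξ s h, E.P_vec_e]

/-- The Haagerup-type condition, as an estimate for the structure constants of an adapted basis. -/
lemma sum_norm_sq_mul_le {C : ℝ} (hC : HaagerupType F σ C) (T : Finset E.S) (ξ η : E.S → ℂ)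
    (i j d : ℕ) (hξ : ∀ s, ξ s ≠ 0 → E.deg (some s) = i) (hη : ∀ s, η s ≠ 0 → E.deg (some s) = j) :
    ∑ r ∈ T with E.deg (some r) = d, ‖∑ s ∈ T, ∑ t ∈ T,
        σ.toLin (E.e (some r) * (E.e (some s) * E.e (some t))) * (ξ s * η t)‖ ^ 2 ≤
      C ^ 2 * (∑ s ∈ T, ‖ξ s‖ ^ 2) * ∑ t ∈ T, ‖η t‖ ^ 2 := by
  have h := hC.bound F σ (∑ s ∈ T, ξ s • E.e (some s)) (∑ t ∈ T, η t • E.e (some t)) i d j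
  rw [E.comp_sum T ξ hξ, E.comp_sum T η hη] at h
  have h2 := pow_le_pow_left₀ (norm_nonneg _) h 2
  rw [mul_pow, mul_pow, E.norm_vec_sum_sq, E.norm_vec_sum_sq] at h2
  refine le_trans ?_ h2
  refine le_trans (le_of_eq ?_) ((E.orthonormal_vec.comp some
    (Option.some_injective _)).sum_inner_products_le (s := {r ∈ T | E.deg (some r) = d}) _)
  refine Finset.sum_congr rfl fun r hr => ?_
  rw [Function.comp_apply, ← inner_P_left, ← (Finset.mem_filter.mp hr).2, E.P_vec_e,
    RegularState.inner_vec, E.star_e]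
  rw [Finset.sum_mul_sum]
  simp only [Finset.mul_sum, map_sum, smul_mul_assoc, mul_smul_comm, map_smul, smul_eq_mul]
  refine congrArg (fun z : ℂ => ‖z‖ ^ 2) (Finset.sum_congr rfl fun s _ =>
    Finset.sum_congr rfl fun t _ => by ring)

lemma toLin_mul_eq_sum (b φ : A) (T : Finset E.S)
    (hT : ∀ t, σ.toLin (E.e (some t) * φ) ≠ 0 → t ∈ T) :
    σ.toLin (b * φ) = σ.toLin φ * σ.toLin b +
      ∑ t ∈ T, σ.toLin (b * E.e (some t)) * σ.toLin (E.e (some t) * φ) := by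
  classical
  have h : φ = σ.toLin φ • 1 + ∑ t ∈ T, σ.toLin (E.e (some t) * φ) • E.e (some t) := by
    refine E.basis.repr.injective (Finsupp.ext fun o => ?_)
    rw [E.repr_apply, E.repr_apply]
    cases o with
    | none =>
      have h1 : ∀ t, σ.toLin (E.e (some t)) = 0 := fun t => by
        have := E.orth_ne none (some t) (by simp)
        rwa [E.e_none, one_mul] at this
      simp [E.e_none, h1, σ.map_one]
    | some s =>
      have h1 : σ.toLin (E.e (some s)) = 0 := by
        have := E.orth_ne none (some s) (by simp)
        rwa [E.e_none, one_mul] at this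
      simp only [mul_add, map_add, mul_smul_comm, map_smul, mul_one, h1,
        smul_eq_mul, mul_zero, zero_add, Finset.mul_sum, map_sum]
      by_cases hs : s ∈ T
      · rw [Finset.sum_eq_single_of_mem s hs fun t _ ht => by
          rw [E.orth_ne _ _ (by simpa using ht.symm), mul_zero], E.orth_self, mul_one]
      · rw [Finset.sum_eq_zero fun t ht => by
          rw [E.orth_ne (some s) (some t) fun h => hs (Option.some.inj h ▸ ht), mul_zero]]
        by_contra h0
        exact hs (hT s h0)
  conv_lhs => rw [h]
  simp only [mul_add, map_add, mul_smul_comm, map_smul, mul_one, Finset.mul_sum, map_sum,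
    smul_eq_mul]
  simp only [mul_comm (σ.toLin (_ * φ))]

end AdaptedBasis

end Coordinates

/-! ### Recursions for the cancelling and merging sums -/

section Recursion

variable {α : Type*} {δ : α → ℕ} {cc : α → α → α → ℂ} {U : Finset (List α)} {T : Finset α}

lemma cancelSum_nil (h : [] ∈ U) (X f : List α → ℂ) :
    cancelSum U X f [] = ∑ b ∈ U, X b * f b.reverse := by
  classical
  rw [cancelSum, Finset.sum_eq_single_of_mem ([], []) (by simp [h]) fun x _ hx => if_neg ?_]
  · simp
  · rintro h0
    exact hx (by simpa [Prod.ext_iff] using h0)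

lemma cancelSum_cons (hU : ∀ a b, a ++ b ∈ U → a ∈ U ∧ b ∈ U) {r : α} {w : List α}
    (h : r :: w ∈ U) (X f : List α → ℂ) :
    cancelSum U X f (r :: w) =
      ∑ b ∈ U, X b * f (b.reverse ++ r :: w) + cancelSum U (fun v => X (r :: v)) f w := by
  classical
  have hs : {x ∈ U ×ˢ U | x.1 ++ x.2 = r :: w} =
      insert ([], r :: w) ({x ∈ U ×ˢ U | x.1 ++ x.2 = w}.image fun x => (r :: x.1, x.2)) := by
    ext ⟨a, c⟩
    simp only [Finset.mem_filter, Finset.mem_product, Finset.mem_insert, Finset.mem_image,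
      Prod.mk.injEq, Prod.exists]
    constructor
    · rintro ⟨⟨h1, h2⟩, h3⟩
      rcases a with _ | ⟨p, a⟩
      · exact Or.inl ⟨rfl, h3⟩
      · obtain ⟨rfl, rfl⟩ := List.cons.inj h3
        exact Or.inr ⟨a, c, ⟨⟨(hU [p] a h1).2, h2⟩, rfl⟩, rfl, rfl⟩
    · rintro (⟨rfl, rfl⟩ | ⟨a, c, ⟨⟨h1, h2⟩, rfl⟩, rfl, rfl⟩)
      · exact ⟨⟨(hU [] _ h).1, h⟩, rfl⟩
      · exact ⟨⟨(hU (r :: a) c h).1, h2⟩, rfl⟩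
  rw [cancelSum, cancelSum, ← Finset.sum_filter, ← Finset.sum_filter, hs, Finset.sum_insert
    (by simp), Finset.sum_image fun x _ y _ hxy => by simpa [Prod.ext_iff] using hxy]
  rfl

lemma mergeSum_nil (q : ℕ → ℕ → Prop) (X f : List α → ℂ) : mergeSum δ cc U T q X f [] = 0 :=
  Finset.sum_eq_zero fun x _ => if_neg (by simp)

lemma mergeSum_cons (hU : ∀ a b, a ++ b ∈ U → a ∈ U ∧ b ∈ U) (hT : ∀ r w, r :: w ∈ U → r ∈ T)
    {r : α} {w : List α} (h : r :: w ∈ U) (X f : List α → ℂ) :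
    mergeSum δ cc U T (fun _ _ => True) X f (r :: w) =
      ∑ b ∈ U, ∑ s ∈ T, ∑ t ∈ T, cc s t r * (X (s :: b) * f (b.reverse ++ t :: w)) +
        mergeSum δ cc U T (fun _ _ => True) (fun v => X (r :: v)) f w := by
  classical
  have hs : {x ∈ U ×ˢ T ×ˢ U | x.1 ++ x.2.1 :: x.2.2 = r :: w} = insert ([], r, w)
      ({x ∈ U ×ˢ T ×ˢ U | x.1 ++ x.2.1 :: x.2.2 = w}.image fun x => (r :: x.1, x.2)) := by
    ext ⟨a, p, c⟩
    simp only [Finset.mem_filter, Finset.mem_product, Finset.mem_insert, Finset.mem_image,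
      Prod.mk.injEq, Prod.exists]
    constructor
    · rintro ⟨⟨h1, h2, h3⟩, h4⟩
      rcases a with _ | ⟨p', a⟩
      · obtain ⟨rfl, rfl⟩ := List.cons.inj h4
        exact Or.inl ⟨rfl, rfl, rfl⟩
      · obtain ⟨rfl, rfl⟩ := List.cons.inj h4
        exact Or.inr ⟨a, p, c, ⟨⟨(hU [p'] a h1).2, h2, h3⟩, rfl⟩, rfl, rfl, rfl⟩
    · rintro (⟨rfl, rfl, rfl⟩ | ⟨a, p, c, ⟨⟨h1, h2, h3⟩, rfl⟩, rfl, rfl, rfl⟩)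
      · exact ⟨⟨(hU [] _ h).1, hT _ _ h, (hU [p] _ h).2⟩, rfl⟩
      · exact ⟨⟨(hU (r :: a) (p :: c) h).1, h2, h3⟩, rfl⟩
  rw [mergeSum, mergeSum, ← Finset.sum_filter, ← Finset.sum_filter, hs, Finset.sum_insert
    (by simp), Finset.sum_image fun x _ y _ hxy => by simpa [Prod.ext_iff] using hxy]
  simp only [if_true]
  rfl

lemma cancelSum_add (X X' f : List α → ℂ) (y : List α) :
    cancelSum U (X + X') f y = cancelSum U X f y + cancelSum U X' f y := by
  simp only [cancelSum]
  rw [← Finset.sum_add_distrib]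
  refine Finset.sum_congr rfl fun x _ => ?_
  split_ifs
  · simp [add_mul, Finset.sum_add_distrib]
  · simp

lemma cancelSum_smul (z : ℂ) (X f : List α → ℂ) (y : List α) :
    cancelSum U (z • X) f y = z * cancelSum U X f y := by
  simp only [cancelSum]
  rw [Finset.mul_sum]
  refine Finset.sum_congr rfl fun x _ => ?_
  split_ifs
  · simp [mul_assoc, Finset.mul_sum]
  · simp

lemma mergeSum_add (q : ℕ → ℕ → Prop) (X X' f : List α → ℂ) (y : List α) :
    mergeSum δ cc U T q (X + X') f y = mergeSum δ cc U T q X f y + mergeSum δ cc U T q X' f y := by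
  simp only [mergeSum, merge]
  rw [← Finset.sum_add_distrib]
  refine Finset.sum_congr rfl fun x _ => ?_
  split_ifs
  · simp [add_mul, mul_add, Finset.sum_add_distrib]
  · simp
  · simp

lemma mergeSum_smul (q : ℕ → ℕ → Prop) (z : ℂ) (X f : List α → ℂ) (y : List α) :
    mergeSum δ cc U T q (z • X) f y = z * mergeSum δ cc U T q X f y := by
  simp only [mergeSum, merge]
  rw [Finset.mul_sum]
  refine Finset.sum_congr rfl fun x _ => ?_
  split_ifs
  · simp [mul_assoc, mul_left_comm z, Finset.mul_sum]
  · simp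
  · simp

end Recursion

/-! ### Products in the basis of words -/

section ProductFormula

open LinearAlgebra

variable {A : Fin 2 → Type*} [∀ i, Ring (A i)] [∀ i, StarRing (A i)] [∀ i, Algebra ℂ (A i)]
  [∀ i, StarModule ℂ (A i)]
variable {F : ∀ i, StarFiltration (A i)} {σ : ∀ i, RegularState (A i)}
variable (E : ∀ i, AdaptedBasis (F i) (σ i))

/-- The coefficient of a list of letters in an element of the free product; it is zero if the list
is not a word. -/
def coef (l : List (Letter E)) : Free A →ₗ[ℂ] ℂ :=
  open Classical in if h : IsWord l then Finsupp.lapply ⟨l, h⟩ ∘ₗ toWords E else 0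

variable {E}

lemma coef_of_isWord {l : List (Letter E)} (h : IsWord l) (x : Free A) :
    coef E l x = toWords E x ⟨l, h⟩ := by
  simp [coef, h]

lemma coef_word (w : Word E) (x : Free A) : coef E w.1 x = toWords E x w := coef_of_isWord w.2 x

lemma coef_of_not_isWord {l : List (Letter E)} (h : ¬ IsWord l) (x : Free A) :
    coef E l x = 0 := by
  simp [coef, h]

lemma isWord_of_coef_ne_zero {l : List (Letter E)} {x : Free A} (h : coef E l x ≠ 0) : IsWord l :=
  not_imp_comm.mp (fun hl => coef_of_not_isWord hl x) h

open Classical in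
lemma coef_wordElem (w : Word E) (l : List (Letter E)) :
    coef E l (wordElem w.1) = if l = w.1 then 1 else 0 := by
  by_cases h : IsWord l
  · rw [coef_of_isWord h, toWords_wordElem, Finsupp.single_apply]
    simp only [Subtype.ext_iff, eq_comm]
  · rw [coef_of_not_isWord h, if_neg]
    rintro rfl
    exact h w.2

lemma coef_incl_mul {i : Fin 2} (a : A i) (f : Free A) (w : WordOff E i) (o : Option (E i).S) :
    coef E (wordEquiv E i (w, o)).1 (incl A i a * f) =
      (σ i).toLin ((E i).e o * (a * expand E i (toWords E f) w)) := by
  rw [coef_word, toWords_mul, rep_incl, leftAct_apply]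

lemma repr_expand_toWords (i : Fin 2) (f : Free A) (w : WordOff E i) (o : Option (E i).S) :
    (σ i).toLin ((E i).e o * expand E i (toWords E f) w) =
      coef E (wordEquiv E i (w, o)).1 f := by
  rw [coef_word, repr_expand]

/-- The letter `p` creates: its product with the word `p y` is the only one with a coefficient at
`y`, if `y` does not begin with a letter from the factor of `p`. -/
lemma coef_letterElem_mul_of_ne {p : Letter E} {y : List (Letter E)}
    (h : ∀ q ∈ y.head?, q.1 ≠ p.1) (f : Free A) :
    coef E y (letterElem p * f) = coef E (p :: y) f := by
  by_cases hy : IsWord y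
  · have h1 := coef_incl_mul ((E p.1).e (some p.2)) f ⟨y, hy, h⟩ none
    rw [(E p.1).e_none, one_mul, repr_expand_toWords, wordEquiv_none, wordEquiv_some] at h1
    exact h1
  · rw [coef_of_not_isWord hy, coef_of_not_isWord fun h => hy (isWord_cons.mp h).1]

variable (E) in
/-- The structure constants of the products of letters. -/
def structConst (s t r : Letter E) : ℂ := coef E [r] (letterElem s * letterElem t)

lemma coef_singleton_incl {i : Fin 2} (a : A i) (r : (E i).S) :
    coef E [⟨i, r⟩] (incl A i a) = (σ i).toLin ((E i).e (some r) * a) := by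
  have h1 := coef_incl_mul a (1 : Free A) (⟨[], List.IsChain.nil, by simp⟩ : WordOff E i) (some r)
  have h2 : toWords E (1 : Free A) = Finsupp.single
      (wordEquiv E i (⟨[], List.IsChain.nil, by simp⟩, none)) 1 := by
    rw [toWords_apply, map_one]
    rfl
  rw [h2, expand_single, Finsupp.single_eq_same, (E i).e_none, one_smul, mul_one, mul_one] at h1
  exact h1

lemma structConst_same (i : Fin 2) (s t r : (E i).S) :
    structConst E ⟨i, s⟩ ⟨i, t⟩ ⟨i, r⟩ =
      (σ i).toLin ((E i).e (some r) * ((E i).e (some s) * (E i).e (some t))) := by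
  rw [structConst, letterElem, letterElem, ← map_mul, coef_singleton_incl]

lemma structConst_ne_zero {s t r : Letter E} (h : structConst E s t r ≠ 0) :
    s.1 = r.1 ∧ t.1 = r.1 := by
  obtain ⟨i, s⟩ := s
  obtain ⟨j, t⟩ := t
  obtain ⟨l, r⟩ := r
  by_cases h1 : i = j
  · subst h1
    by_contra hne
    have hl : l ≠ i := fun h => hne ⟨h.symm, h.symm⟩
    have h2 : structConst E ⟨i, s⟩ ⟨i, t⟩ ⟨l, r⟩ = coef E [⟨i, s⟩, ⟨l, r⟩] (letterElem ⟨i, t⟩) :=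
      coef_letterElem_mul_of_ne (by simpa using hl) _
    have h3 := coef_wordElem (⟨[⟨i, t⟩], by simp [IsWord]⟩ : Word E) [⟨i, s⟩, ⟨l, r⟩]
    rw [if_neg (by simp)] at h3
    exact h (h2.trans (by simpa [wordElem] using h3))
  · have h3 := coef_wordElem (⟨[⟨i, s⟩, ⟨j, t⟩], by simpa [IsWord] using h1⟩ : Word E) [⟨l, r⟩]
    rw [if_neg (by simp)] at h3
    exact absurd (by simpa [wordElem, structConst] using h3) h

open Classical in
lemma coef_letterElem_mul {p r : Letter E} {w : List (Letter E)} (hw : IsWord (r :: w))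
    (f : Free A) (T : Finset (Letter E)) (hT : ∀ t, t.1 = p.1 → coef E (t :: w) f ≠ 0 → t ∈ T) :
    coef E (r :: w) (letterElem p * f) = coef E (p :: r :: w) f +
      ((if p = r then coef E w f else 0) + ∑ t ∈ T, structConst E p t r * coef E (t :: w) f) := by
  by_cases hpr : r.1 = p.1
  · obtain ⟨i, p⟩ := p
    obtain ⟨j, r⟩ := r
    obtain rfl : j = i := hpr
    obtain ⟨hw1, hw2⟩ := isWord_cons.mp hw
    have h0 : coef E (⟨j, p⟩ :: ⟨j, r⟩ :: w) f = 0 :=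
      coef_of_not_isWord (fun h : IsWord (⟨j, p⟩ :: ⟨j, r⟩ :: w) =>
        (isWord_cons.mp h).2 ⟨j, r⟩ rfl rfl) f
    have h1 := coef_incl_mul ((E j).e (some p)) f ⟨w, hw1, hw2⟩ (some r)
    let ι : (E j).S → Letter E := fun s => ⟨j, s⟩
    have h2 : Set.InjOn ι (ι ⁻¹' (T : Set (Letter E))) :=
      (sigma_mk_injective (β := fun i => (E i).S)).injOn
    rw [← mul_assoc, (E j).toLin_mul_eq_sum _ _ (T.preimage ι h2) (fun t ht => by
      rw [repr_expand_toWords, wordEquiv_some] at ht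
      exact Finset.mem_preimage.mpr (hT (ι t) rfl ht))] at h1
    rw [h0, zero_add]
    refine h1.trans ?_
    congr 1
    · have h3 := repr_expand_toWords j f ⟨w, hw1, hw2⟩ none
      rw [(E j).e_none, one_mul, wordEquiv_none] at h3
      rw [h3]
      split_ifs with h
      · obtain rfl : p = r := by simpa using h
        rw [(E j).orth_self, mul_one]
      · rw [(E j).orth_ne _ _ (by rintro h'; exact h (by simpa using h'.symm)), mul_zero]
    · rw [← Finset.sum_preimage ι T h2
        (fun t => structConst E ⟨j, p⟩ t ⟨j, r⟩ * coef E (t :: w) f) fun t _ ht => by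
          by_contra h
          obtain ⟨k, t⟩ := t
          obtain rfl : k = j := (structConst_ne_zero (left_ne_zero_of_mul h)).2
          exact ht ⟨t, rfl⟩]
      refine Finset.sum_congr rfl fun t _ => ?_
      rw [structConst_same, repr_expand_toWords, wordEquiv_some, mul_assoc]
  · rw [coef_letterElem_mul_of_ne (by simpa using hpr), if_neg (by rintro rfl; exact hpr rfl),
      Finset.sum_eq_zero fun t _ => by
        by_contra h
        exact hpr (structConst_ne_zero (left_ne_zero_of_mul h)).1.symm]
    simp

lemma coef_wordElem_mul_of_ne {u y : List (Letter E)} (hu : IsWord u)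
    (h : ∀ p ∈ u.head?, ∀ q ∈ y.head?, q.1 ≠ p.1) (f : Free A) :
    coef E y (wordElem u * f) = coef E (u.reverse ++ y) f := by
  induction u generalizing y with
  | nil => simp [wordElem]
  | cons p u ih =>
    obtain ⟨h1, h2⟩ := isWord_cons.mp hu
    rw [wordElem_cons, mul_assoc, coef_letterElem_mul_of_ne (h p (by simp)), ih h1, List.reverse_cons,
      List.append_assoc]
    · rfl
    · rintro q hq r hr
      obtain rfl : p = r := by simpa using hr
      exact (h2 q hq).symm

open Classical in
/-- The coefficients of the product of a word and an element of the free product: some letters of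
the word cancel, and then the next letter may merge with a letter of the element. -/
lemma coef_wordElem_mul {u y : List (Letter E)} (hu : IsWord u) (hy : IsWord y) (f : Free A)
    {U : Finset (List (Letter E))} {T : Finset (Letter E)} {δ : Letter E → ℕ}
    (hU : ∀ a b, a ++ b ∈ U → a ∈ U ∧ b ∈ U) (hT : ∀ r w, r :: w ∈ U → r ∈ T)
    (hf : ∀ l, coef E l f ≠ 0 → l ∈ U) (huU : u ∈ U) (hyU : y ∈ U) :
    coef E y (wordElem u * f) =
      cancelSum U (fun v => if v = u then 1 else 0) (fun v => coef E v f) y +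
      mergeSum δ (structConst E) U T (fun _ _ => True) (fun v => if v = u then 1 else 0)
        (fun v => coef E v f) y := by
  have hone : ∀ (u : List (Letter E)), u ∈ U → ∀ (g : List (Letter E) → ℂ),
      ∑ b ∈ U, (if b = u then 1 else 0) * g b = g u := fun u hu g => by
    simp [hu]
  induction y generalizing u with
  | nil =>
    rw [cancelSum_nil (hU [] u huU).1, mergeSum_nil, add_zero,
      hone u huU fun b => coef E b.reverse f, coef_wordElem_mul_of_ne hu (by simp),
      List.append_nil]
  | cons r w ih =>
    obtain ⟨hw1, hw2⟩ := isWord_cons.mp hy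
    rw [cancelSum_cons hU hyU, mergeSum_cons hU hT hyU,
      hone u huU fun b => coef E (b.reverse ++ r :: w) f]
    cases u with
    | nil =>
      simp [wordElem, cancelSum, mergeSum, merge]
    | cons s u =>
      obtain ⟨hu1, hu2⟩ := isWord_cons.mp hu
      have hsT := hT s u huU
      have huU' := (hU [s] u huU).2
      have hmerge : ∑ b ∈ U, ∑ s' ∈ T, ∑ t ∈ T, structConst E s' t r *
          ((if s' :: b = s :: u then 1 else 0) * coef E (b.reverse ++ t :: w) f) =
          ∑ t ∈ T, structConst E s t r * coef E (u.reverse ++ t :: w) f := by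
        rw [Finset.sum_eq_single_of_mem u huU' fun b _ hb => Finset.sum_eq_zero fun s' _ =>
            Finset.sum_eq_zero fun t _ => by simp [hb],
          Finset.sum_eq_single_of_mem s hsT fun s' _ hs => Finset.sum_eq_zero fun t _ => by
            simp [hs]]
        simp
      have hne : ∀ t : Letter E, t.1 = s.1 →
          coef E (t :: w) (wordElem u * f) = coef E (u.reverse ++ t :: w) f := fun t ht =>
        coef_wordElem_mul_of_ne hu1 (fun p hp q hq => by
          obtain rfl : t = q := by simpa using hq
          rw [ht]
          exact (hu2 p hp).symm) f
      rw [hmerge, wordElem_cons, mul_assoc, coef_letterElem_mul hy _ T (fun t ht h => by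
        rw [hne t ht] at h
        exact hT t w (hU _ _ (hf _ h)).2),
        coef_wordElem_mul_of_ne hu1 (y := s :: r :: w) (by
          intro p hp q hq
          obtain rfl : s = q := by simpa using hq
          exact (hu2 p hp).symm)]
      have hsum : ∑ t ∈ T, structConst E s t r * coef E (t :: w) (wordElem u * f) =
          ∑ t ∈ T, structConst E s t r * coef E (u.reverse ++ t :: w) f := by
        refine Finset.sum_congr rfl fun t _ => ?_
        by_cases h : structConst E s t r = 0
        · simp [h]
        · obtain ⟨e1, e2⟩ := structConst_ne_zero h
          rw [hne t (e2.trans e1.symm)]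
      rw [hsum]
      have hrec : (if s = r then coef E w (wordElem u * f) else 0) =
          cancelSum U (fun v => if r :: v = s :: u then 1 else 0) (fun v => coef E v f) w +
          mergeSum δ (structConst E) U T (fun _ _ => True)
            (fun v => if r :: v = s :: u then 1 else 0) (fun v => coef E v f) w := by
        split_ifs with h
        · subst h
          rw [ih hu1 hw1 huU' (hU [s] w hyU).2]
          simp
        · have h' : ∀ v, ¬ (r :: v = s :: u) := fun v hv => h (List.cons.inj hv).1.symm
          simp [h', cancelSum, mergeSum, merge]
      rw [hrec, List.reverse_cons, List.append_assoc]
      simp only [List.singleton_append]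
      ring

lemma coef_mul {x f : Free A} {y : List (Letter E)} (hy : IsWord y)
    {U : Finset (List (Letter E))} {T : Finset (Letter E)} {δ : Letter E → ℕ}
    (hU : ∀ a b, a ++ b ∈ U → a ∈ U ∧ b ∈ U) (hT : ∀ r w, r :: w ∈ U → r ∈ T)
    (hx : ∀ l, coef E l x ≠ 0 → l ∈ U) (hf : ∀ l, coef E l f ≠ 0 → l ∈ U) (hyU : y ∈ U) :
    coef E y (x * f) = cancelSum U (fun v => coef E v x) (fun v => coef E v f) y +
      mergeSum δ (structConst E) U T (fun _ _ => True) (fun v => coef E v x)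
        (fun v => coef E v f) y := by
  classical
  let Γ : Free A →ₗ[ℂ] ℂ :=
    { toFun := fun x => cancelSum U (fun v => coef E v x) (fun v => coef E v f) y +
        mergeSum δ (structConst E) U T (fun _ _ => True) (fun v => coef E v x)
          (fun v => coef E v f) y
      map_add' := fun x x' => by
        have h : (fun v => coef E v (x + x')) = (fun v => coef E v x) + fun v => coef E v x' := by
          ext v; simp
        rw [h, cancelSum_add, mergeSum_add]
        ring
      map_smul' := fun z x => by
        have h : (fun v => coef E v (z • x)) = z • fun v => coef E v x := by
          ext v; simp
        rw [h, cancelSum_smul, mergeSum_smul, RingHom.id_apply, smul_eq_mul]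
        ring }
  have h : ∀ w ∈ (toWords E x).support, coef E y (wordElem w.1 * f) = Γ (wordElem w.1) := by
    intro w hw
    have hwU : w.1 ∈ U := hx _ (by rw [coef_word]; exact Finsupp.mem_support_iff.mp hw)
    rw [coef_wordElem_mul w.2 hy f hU hT hf hwU hyU (δ := δ)]
    simp only [Γ, LinearMap.coe_mk, AddHom.coe_mk, coef_wordElem]
  change _ = Γ x
  rw [← ofWords_toWords E x, ofWords, Finsupp.linearCombination_apply, Finsupp.sum, Finset.sum_mul,
    map_sum, map_sum]
  refine Finset.sum_congr rfl fun w hw => ?_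
  rw [smul_mul_assoc, map_smul, map_smul, h w hw]

end ProductFormula

/-! ### The Haagerup-type condition for the free product -/

section FreeHaagerup

open LinearAlgebra

variable {A : Fin 2 → Type*} [∀ i, Ring (A i)] [∀ i, StarRing (A i)] [∀ i, Algebra ℂ (A i)]
  [∀ i, StarModule ℂ (A i)]
variable {F : ∀ i, StarFiltration (A i)} {σ : ∀ i, RegularState (A i)}
variable {E : ∀ i, AdaptedBasis (F i) (σ i)}

lemma ldeg_le_of_structConst (hσ : ∀ i, (σ i).IsTracial) (s t r : Letter E)
    (h : structConst E s t r ≠ 0) :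
    ldeg r ≤ ldeg s + ldeg t ∧ ldeg s ≤ ldeg r + ldeg t ∧ ldeg t ≤ ldeg s + ldeg r := by
  obtain ⟨h1, h2⟩ := structConst_ne_zero h
  obtain ⟨i, r⟩ := r
  obtain ⟨j, s⟩ := s
  obtain ⟨l, t⟩ := t
  obtain rfl : j = i := h1
  obtain rfl : l = j := h2
  rw [structConst_same] at h
  have key : ∀ a b c : (E l).S, (σ l).toLin ((E l).e (some a) * ((E l).e (some b) *
      (E l).e (some c))) ≠ 0 →
      (E l).deg (some a) ≤ (E l).deg (some b) + (E l).deg (some c) := fun a b c h => by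
    by_contra hlt
    exact h ((E l).repr_eq_zero_of_lt ((F l).mul_mem _ _ _ ((E l).e_mem _) _ ((E l).e_mem _))
      (not_le.mp hlt))
  have rot : ∀ a b c : A l, (σ l).toLin (a * (b * c)) = (σ l).toLin (b * (c * a)) :=
    fun a b c => by rw [hσ l, mul_assoc]
  refine ⟨key r s t h, (key s t r (by rwa [rot] at h)).trans_eq (add_comm _ _),
    (key t r s (by rwa [rot, rot] at h)).trans_eq (add_comm _ _)⟩

lemma mergeBound_structConst {C : ℝ} (hC : ∀ i, HaagerupType (F i) (σ i) C)
    (T : ∀ i, Finset (E i).S) :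
    MergeBound ldeg (structConst E) (Finset.univ.sigma T) C := by
  intro ξ η i j d hξ hη
  have hsum : ∀ (l : Fin 2) (r : (E l).S),
      ∑ s ∈ Finset.univ.sigma T, ∑ t ∈ Finset.univ.sigma T,
        structConst E s t ⟨l, r⟩ * (ξ s * η t) =
      ∑ s ∈ T l, ∑ t ∈ T l, (σ l).toLin ((E l).e (some r) * ((E l).e (some s) *
        (E l).e (some t))) * (ξ ⟨l, s⟩ * η ⟨l, t⟩) := by
    intro l r
    have h0 : ∀ s t : Letter E, s.1 ≠ l ∨ t.1 ≠ l → structConst E s t ⟨l, r⟩ = 0 := by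
      intro s t h
      by_contra h1
      obtain ⟨e1, e2⟩ := structConst_ne_zero h1
      exact h.elim (fun h => h e1) fun h => h e2
    rw [Finset.sum_sigma, Finset.sum_eq_single_of_mem l (Finset.mem_univ l) fun l' _ hl' =>
      Finset.sum_eq_zero fun s _ => Finset.sum_eq_zero fun t _ => by
        rw [h0 _ _ (Or.inl hl'), zero_mul]]
    refine Finset.sum_congr rfl fun s _ => ?_
    rw [Finset.sum_sigma, Finset.sum_eq_single_of_mem l (Finset.mem_univ l) fun l' _ hl' =>
      Finset.sum_eq_zero fun t _ => by rw [h0 _ _ (Or.inr hl'), zero_mul]]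
    exact Finset.sum_congr rfl fun t _ => by rw [structConst_same]
  have hl : ∀ l, ∑ r ∈ T l, (if ldeg (⟨l, r⟩ : Letter E) = d then
      ‖∑ s ∈ Finset.univ.sigma T, ∑ t ∈ Finset.univ.sigma T,
        structConst E s t ⟨l, r⟩ * (ξ s * η t)‖ ^ 2 else 0) ≤
      C ^ 2 * (∑ s ∈ T l, ‖ξ ⟨l, s⟩‖ ^ 2) * ∑ t ∈ T l, ‖η ⟨l, t⟩‖ ^ 2 := fun l => by
    rw [← Finset.sum_filter]
    simp only [hsum]
    exact (E l).sum_norm_sq_mul_le (hC l) (T l) (fun s => ξ ⟨l, s⟩) (fun t => η ⟨l, t⟩) i j d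
      (fun s hs => hξ _ hs) (fun t ht => hη _ ht)
  rw [Finset.sum_filter, Finset.sum_sigma, Finset.sum_sigma, Finset.sum_sigma]
  refine (Finset.sum_le_sum fun l _ => hl l).trans ?_
  simp only [Fin.sum_univ_two]
  have p1 : 0 ≤ C ^ 2 * (∑ s ∈ T 0, ‖ξ ⟨0, s⟩‖ ^ 2) * ∑ t ∈ T 1, ‖η ⟨1, t⟩‖ ^ 2 := by positivity
  have p2 : 0 ≤ C ^ 2 * (∑ s ∈ T 1, ‖ξ ⟨1, s⟩‖ ^ 2) * ∑ t ∈ T 0, ‖η ⟨0, t⟩‖ ^ 2 := by positivity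
  nlinarith

lemma norm_vec_freeState_sq_eq_sum_coef (x : Free A) (U : Finset (List (Letter E)))
    (hU : ∀ l, coef E l x ≠ 0 → l ∈ U) :
    ‖(freeState E).vec x‖ ^ 2 = ∑ l ∈ U, ‖coef E l x‖ ^ 2 := by
  classical
  rw [norm_vec_freeState_sq E x (U.subtype IsWord) fun w hw =>
    Finset.mem_subtype.mpr (hU _ (by rwa [coef_word]))]
  simp only [← coef_word]
  rw [Finset.sum_subtype_eq_sum_filter (s := U) fun l => ‖coef E l x‖ ^ 2]
  exact Finset.sum_filter_of_ne fun l _ h => isWord_of_coef_ne_zero (x := x) (by simpa using h)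

lemma coef_ofWords_filter (v : Word E →₀ ℂ) (n : ℕ) (l : List (Letter E)) :
    coef E l (ofWords E (v.filter fun w => wdeg w.1 = n)) =
      if wdeg l = n then coef E l (ofWords E v) else 0 := by
  by_cases h : IsWord l
  · simp only [coef_of_isWord h, toWords_ofWords, Finsupp.filter_apply]
  · simp [coef_of_not_isWord h]

lemma wdeg_of_coef_comp {n : ℕ} {x : Free A} {l : List (Letter E)}
    (h : coef E l (comp (freeFiltration F) (freeState E) n x) ≠ 0) : wdeg l = n := by
  have h1 : comp (freeFiltration F) (freeState E) n x =
      ofWords E ((toWords E x).filter fun w => wdeg w.1 = n) :=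
    vec_injective _ (by rw [vec_comp, P_freeState])
  rw [h1, coef_ofWords_filter] at h
  exact (ite_ne_right_iff.mp h).1

/-- The free product satisfies the Haagerup-type condition with constant `2 C`. -/
theorem haagerupType_freeState_two_mul (hσ : ∀ i, (σ i).IsTracial) {C : ℝ}
    (hC : ∀ i, HaagerupType (F i) (σ i) C) :
    HaagerupType (freeFiltration F) (freeState E) (2 * C) := by
  classical
  have hC1 : 1 ≤ C := (hC 0).one_le
  refine haagerupType_of_bound _ _ (by linarith) fun a b k m n => ?_
  set x := comp (freeFiltration F) (freeState E) k a
  set f := comp (freeFiltration F) (freeState E) n b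
  let N := k + m + n
  let U : Finset (List (Letter E)) := (finite_wdeg_le E N).toFinset
  have hU : ∀ l, l ∈ U ↔ wdeg l ≤ N := fun l => by simp [U]
  let T : ∀ i, Finset (E i).S := fun i =>
    (((E i).finite N).preimage (Option.some_injective _).injOn).toFinset
  have hT : ∀ p, p ∈ Finset.univ.sigma T ↔ ldeg p ≤ N := fun p => by simp [T, ldeg]
  let Y := {l ∈ U | IsWord l ∧ wdeg l = m}
  have hx : ∀ l, coef E l x ≠ 0 → l ∈ U ∧ wdeg l = k := fun l hl => by
    have := wdeg_of_coef_comp hl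
    exact ⟨(hU l).mpr (by omega), this⟩
  have hf : ∀ l, coef E l f ≠ 0 → l ∈ U ∧ wdeg l = n := fun l hl => by
    have := wdeg_of_coef_comp hl
    exact ⟨(hU l).mpr (by omega), this⟩
  have hP : ‖P (freeFiltration F) (freeState E) m ((freeState E).vec (x * f))‖ ^ 2 =
      ∑ y ∈ Y, ‖coef E y (x * f)‖ ^ 2 := by
    rw [P_freeState, norm_vec_freeState_sq_eq_sum_coef _ Y fun l hl => ?_]
    · refine Finset.sum_congr rfl fun y hy => ?_
      rw [coef_ofWords_filter, if_pos (Finset.mem_filter.mp hy).2.2, ofWords_toWords]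
    · have h1 := isWord_of_coef_ne_zero hl
      rw [coef_ofWords_filter] at hl
      have h2 := (ite_ne_right_iff.mp hl).1
      exact Finset.mem_filter.mpr ⟨(hU l).mpr (by omega), h1, h2⟩
  refine (sq_le_sq₀ (norm_nonneg _) (by positivity)).mp ?_
  rw [hP, mul_pow, mul_pow, norm_vec_freeState_sq_eq_sum_coef x U fun l hl => (hx l hl).1,
    norm_vec_freeState_sq_eq_sum_coef f U fun l hl => (hf l hl).1]
  have hmul : ∀ y ∈ Y, ‖coef E y (x * f)‖ ^ 2 =
      ‖cancelSum U (fun v => coef E v x) (fun v => coef E v f) y +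
        mergeSum ldeg (structConst E) U (Finset.univ.sigma T) (fun _ _ => True)
          (fun v => coef E v x) (fun v => coef E v f) y‖ ^ 2 := fun y hy => by
    obtain ⟨hyU, hyw, -⟩ := Finset.mem_filter.mp hy
    rw [coef_mul (δ := ldeg) (T := Finset.univ.sigma T) hyw (fun a b h => ?_) (fun r w h => ?_)
      (fun l hl => (hx l hl).1) (fun l hl => (hf l hl).1) hyU]
    · rw [hU, wdeg_append] at h
      rw [hU, hU]
      omega
    · rw [hU, wdeg_cons] at h
      rw [hT]
      omega
  rw [Finset.sum_congr rfl hmul]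
  -- `wdeg` is `wt ldeg` by definition.
  refine (sum_norm_sq_product_le (δ := ldeg) hC1 (mergeBound_structConst hC T) ldeg_pos
    (ldeg_le_of_structConst hσ) (fun l hl => ?_) hx hf fun y hy =>
      (Finset.mem_filter.mp hy).2.2).trans_eq ?_
  · rw [hU] at hl ⊢
    rwa [wdeg_reverse]
  · ring

lemma HaagerupType.mono {A : Type*} [Ring A] [StarRing A] [Algebra ℂ A] [StarModule ℂ A]
    {F : StarFiltration A} {σ : RegularState A} {C C' : ℝ} (h : HaagerupType F σ C)
    (hCC' : C ≤ C') : HaagerupType F σ C' := fun a k m n =>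
  (h a k m n).trans (mul_le_mul_of_nonneg_right hCC' (norm_nonneg _))

end FreeHaagerup

end QMS

end

theorem theorem6p1 {A : Fin 2 → Type*} [∀ i, Ring (A i)] [∀ i, StarRing (A i)]
    [∀ i, Algebra ℂ (A i)] [∀ i, StarModule ℂ (A i)]
    (F : ∀ i, QMS.StarFiltration (A i)) (σ : ∀ i, QMS.RegularState (A i))
    (hσ : ∀ i, (σ i).IsTracial) (C : ℝ) (hC : ∀ i, QMS.HaagerupType (F i) (σ i) C) :
    ∃ τ : QMS.RegularState (QMS.Free A),
      QMS.IsFreeProductState σ τ.toLin ∧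
      (∀ φ : QMS.Free A →ₗ[ℂ] ℂ, QMS.IsFreeProductState σ φ → φ = τ.toLin) ∧
      τ.IsTracial ∧
      QMS.HaagerupType (QMS.freeFiltration F) τ (√5 * C) ∧
      QMS.IsLipNorm τ (QMS.lipSeminorm (QMS.freeFiltration F) τ) := by
  let E : ∀ i, QMS.AdaptedBasis (F i) (σ i) := fun i => QMS.adaptedBasis (F i) (hσ i)
  have h2 := QMS.haagerupType_freeState_two_mul (E := E) hσ hC
  refine ⟨QMS.freeState E, QMS.isFreeProductState_freeState E, fun φ hφ => hφ.eq_freeState E,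
    QMS.freeState_isTracial E hσ, h2.mono ?_, h2.isLipNorm⟩
  have hC0 : 0 ≤ C := zero_le_one.trans (hC 0).one_le
  exact mul_le_mul_of_nonneg_right (Real.le_sqrt_of_sq_le (by norm_num)) hC0
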